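/- **Notation.** For a finite set $S$, let $S_\pm=S\sqcup\overline S$ with the involution $s\mapsto\bar s$, let $S_\pm^+$ be the free semigroup of non-empty words on $S_\pm$, with the involution $\overline{s_1\cdots s_k}=\bar s_k\cdots\bar s_1$, and let $\mathrm{Aut}(S_\pm)$ be the finite group of permutations of $S_\pm$ commuting with the involution (equivalently, automorphisms of the free group on $S$ preserving $S\cup S^{-1}$), acting on words letter by letter. **Band complexes.** A band complex $\Sigma$ over $S$ consists of a domain $D$, a disjoint union of finitely many non-degenerate segments, and of finitely many bands. Each band $B$ is a rectangle glued to $D$ along two opposite sides by injective attaching maps, whose images are its two bases $J_0,J_1\subset D$ (non-degenerate segments, oriented so that the attaching maps preserve orientation), together with a twisting automorphism $\phi_B\in\mathrm{Aut}(S_\pm)$. One assumes that the group $\Phi$ generated by the $\phi_B$ has no inversion, i.e. $\phi(s)\ne\bar s$ for all $\phi\in\Phi$, $s\in S_\pm$. The vertices of $\Sigma$ are the endpoints of the components of $D$ and of the bases; $E(\Sigma)$ is the set of oriented segments of $D$ joining two adjacent vertices, with orientation reversal $e\mapsto\bar e$. Band complexes are considered through the combinatorial data that determine them: the ordering of the vertices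 on the components of $D$, the vertices to which the four corners of each band are glued, and the $\phi_B$. **Constraints.** Rational constraints in standard form on $\Sigma$ consist of a finite semigroup $\mathcal M$ with an involution and an action of $\mathrm{Aut}(S_\pm)$, an $\mathrm{Aut}(S_\pm)$-equivariant epimorphism $\rho:S_\pm^+\to\mathcal M$ commuting with the involutions, such that for each $\phi\in\mathrm{Aut}(S_\pm)$ the language $\{w\in S_\pm^+:\phi(w)=w\}$ is the preimage under $\rho$ of a subset of $\mathcal M$, and a family $\underline m=(m_e)_{e\in E(\Sigma)}$ in $\mathcal M$ with $m_{\bar e}=\overline{m_e}$. **Solutions.** A solution $\sigma$ of $(\Sigma,\underline m)$ assigns to each $e\in E(\Sigma)$ a word $\sigma_e\in S_\pm^+$ with $\sigma_{\bar e}=\overline{\sigma_e}$ and $\rho(\sigma_e)=m_e$, such that $\sigma_{J_1}=\phi_B(\sigma_{J_0})$ for every band $B$ with bases $J_0,J_1$, where $\sigma_{e_1\cdots e_k}=\sigma_{e_1}\cdots\sigma_{e_k}$. Its length is the total number of letters of the words labelling the components of $D$; a shortest solution is a solution of minimal length among all solutions of $(\Sigma,\underline m)$. The exponent of periodicity of $\sigma$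 is the largest integer $s$ such that, for some non-empty word $p$, the word $p^s$ is a subword of the label $\sigma_{D_0}$ of some component $D_0$ of $D$ (and $0$ if $D$ is empty). **Proposition 3.1.** There is a computable function which associates to every (explicitly encoded) finite set $S$, band complex $\Sigma$ over $S$, and rational constraints $\underline m$ in standard form on $\Sigma$, an integer $B(\Sigma,\underline m)\in\mathbb N$ such that every shortest solution of $(\Sigma,\underline m)$ has exponent of periodicity at most $B(\Sigma,\underline m)$. -/

import Mathlib

namespace TwistedBand

/-- The symmetrised alphabet `S ⊔ S̄` on a set `S` of `n` letters; `(a, true)` is the letter `a`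
and `(a, false)` is its formal inverse. -/
abbrev Letter (n : ℕ) : Type := Fin n × Bool

/-- The involution exchanging `a` and its formal inverse. -/
def Letter.bar {n : ℕ} (s : Letter n) : Letter n := (s.1, !s.2)

/-- Words over the symmetrised alphabet. -/
abbrev Word (n : ℕ) : Type := List (Letter n)

/-- The involution `s₁ … sₖ ↦ s̄ₖ … s̄₁` on words. -/
def Word.bar {n : ℕ} (w : Word n) : Word n := (w.map Letter.bar).reverse

/-- The finite group of permutations of the symmetrised alphabet that commute with the involution.
These are exactly the automorphisms of the free group on `S` preserving `S ∪ S⁻¹`. -/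
def autS (n : ℕ) : Subgroup (Equiv.Perm (Letter n)) where
  carrier := {φ | ∀ s, φ (Letter.bar s) = Letter.bar (φ s)}
  mul_mem' := by
    intro φ ψ hφ hψ s
    have h1 : ∀ s, φ (Letter.bar s) = Letter.bar (φ s) := hφ
    have h2 : ∀ s, ψ (Letter.bar s) = Letter.bar (ψ s) := hψ
    simp [h1, h2]
  one_mem' := by
    intro s
    rfl
  inv_mem' := by
    intro φ hφ s
    have h1 : ∀ s, φ (Letter.bar s) = Letter.bar (φ s) := hφ
    rw [Equiv.Perm.inv_eq_iff_eq, h1]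
    simp

/-- The action of the automorphisms on words, letter by letter. -/
def Word.act {n : ℕ} (φ : autS n) (w : Word n) : Word n := w.map (φ : Equiv.Perm (Letter n))

/-- The base of a band, when the components of the domain are indexed by `Fin c` and the `i`-th
component is cut by its vertices `0, …, len i` into `len i` elementary segments. A base is a
non-degenerate segment joining two vertices of a component, oriented by the attaching map:
`src` is the image of the left corner `a` and `tgt` the image of the right corner `b`. -/
structure Base {c : ℕ} (len : Fin c → ℕ) where
  comp : Fin c
  src : ℕ
  tgt : ℕ
  src_le : src ≤ len comp
  tgt_le : tgt ≤ len comp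
  src_ne_tgt : src ≠ tgt

/-- A band: its two oriented bases and its twisting automorphism. -/
structure Band (n : ℕ) {c : ℕ} (len : Fin c → ℕ) where
  base0 : Base len
  base1 : Base len
  twist : autS n

/-- A (twisted) band complex over an alphabet with `n` letters, given by the combinatorial data
that determine it: the ordered vertices of each component of the domain, the corners of the bands,
and the twisting automorphisms. -/
structure BandComplex (n : ℕ) where
  /-- number of components of the domain -/
  numComp : ℕ
  /-- number of elementary segments of each component; the vertices are `0, …, numSeg i` -/
  numSeg : Fin numComp → ℕ
  /-- components are non-degenerate segments -/
  numSeg_pos : ∀ i, 0 < numSeg i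
  numBand : ℕ
  band : Fin numBand → Band n numSeg
  /-- the vertices are the endpoints of the components and the endpoints of the bases -/
  vertex_is_endpoint : ∀ (i : Fin numComp) (v : ℕ), 0 < v → v < numSeg i →
    ∃ (b : Fin numBand) (J : Base numSeg), (J = (band b).base0 ∨ J = (band b).base1) ∧
      J.comp = i ∧ (J.src = v ∨ J.tgt = v)
  /-- the group generated by the twisting automorphisms has no inversion -/
  no_inversion : ∀ φ ∈ Subgroup.closure (Set.range fun b => (band b).twist), ∀ s : Letter n,
    (φ : Equiv.Perm (Letter n)) s ≠ s.bar

namespace BandComplex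

variable {n : ℕ} (X : BandComplex n)

/-- Oriented elementary segments: a component, the position of the elementary segment in it
(segment `j` joins the vertices `j` and `j + 1`), and an orientation (`true` is increasing). -/
abbrev OSeg : Type := (i : Fin X.numComp) × (Fin (X.numSeg i) × Bool)

variable {X}

/-- Orientation reversal. -/
def OSeg.bar (e : X.OSeg) : X.OSeg := ⟨e.1, (e.2.1, !e.2.2)⟩

variable (X)

/-- The oriented adapted segment of the `i`-th component running from the vertex `s` to the
vertex `t`, written as a concatenation of oriented elementary segments. -/
def path (i : Fin X.numComp) (s t : ℕ) : List X.OSeg :=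
  if s ≤ t then
    ((List.finRange (X.numSeg i)).filter fun j => s ≤ j.val ∧ j.val < t).map
      fun j => ⟨i, (j, true)⟩
  else
    (((List.finRange (X.numSeg i)).filter fun j => t ≤ j.val ∧ j.val < s).map
      fun j => ⟨i, (j, false)⟩).reverse

/-- A labelling of the oriented elementary segments by non-empty words. -/
structure Labelling where
  label : X.OSeg → Word n
  label_ne_nil : ∀ e, label e ≠ []
  label_bar : ∀ e, label (OSeg.bar e) = (label e).bar

variable {X}

namespace Labelling

variable (σ : X.Labelling)

/-- The word labelling the oriented adapted segment from `s` to `t` in the `i`-th component. -/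
def segWord (i : Fin X.numComp) (s t : ℕ) : Word n := (X.path i s t).flatMap σ.label

/-- The word labelling a base. -/
def baseWord (J : Base X.numSeg) : Word n := σ.segWord J.comp J.src J.tgt

/-- The word labelling the whole `i`-th component of the domain. -/
def compWord (i : Fin X.numComp) : Word n := σ.segWord i 0 (X.numSeg i)

/-- The labelling is a solution of the band complex. -/
def IsSolution : Prop :=
  ∀ b : Fin X.numBand, σ.baseWord (X.band b).base1 =
    (σ.baseWord (X.band b).base0).act (X.band b).twist

/-- The length: the total number of letters labelling the domain. -/
def length : ℕ := ∑ i, (σ.compWord i).length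

/-- The exponents `s` such that some subsegment of the domain is labelled by `p ^ s` for some
non-trivial word `p`. Subsegments are between arbitrary letters, not only between vertices. -/
def powerExponents : Set ℕ :=
  {s | ∃ (i : Fin X.numComp) (p : Word n), p ≠ [] ∧
    (List.replicate s p).flatten <:+: σ.compWord i}

/-- The set of these exponents is bounded, so that the following supremum is a maximum. -/
theorem bddAbove_powerExponents : BddAbove σ.powerExponents := by
  refine ⟨σ.length, ?_⟩
  rintro s ⟨i, p, hp, h⟩
  have h1 := h.length_le
  have h2 : (σ.compWord i).length ≤ σ.length :=
    Finset.single_le_sum (f := fun i => (σ.compWord i).length) (fun _ _ => Nat.zero_le _)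
      (Finset.mem_univ i)
  have h3 : 1 ≤ p.length := List.length_pos_iff.mpr hp
  simp only [List.length_flatten, List.map_replicate, List.sum_replicate, smul_eq_mul] at h1
  nlinarith

/-- The exponent of periodicity of a labelling (with value `0` if the domain is empty). -/
noncomputable def exponentOfPeriodicity : ℕ := sSup σ.powerExponents

end Labelling

end BandComplex

open BandComplex

/-- The extension of a map `f` from letters to a set with a binary operation to non-empty words,
`s₁ … sₖ ↦ f s₁ * … * f sₖ` (bracketed to the left); the value is `none` exactly on the empty
word. -/
def evalWord {α β : Type} (mul : α → α → α) (f : β → α) : List β → Option α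
  | [] => none
  | s :: w => some (w.foldl (fun a t => mul a (f t)) (f s))

/-- Rational constraints in standard form on a band complex: a finite semigroup with
an involution and an action of the signed permutations, an equivariant epimorphism `ρ` onto it from
the free semigroup of non-empty words, commuting with the involutions and representing all
the languages of fixed points, and an element of the semigroup for each
oriented elementary segment. -/
structure StandardForm {n : ℕ} (X : BandComplex n) where
  /-- the underlying set of the semigroup is `Fin card` -/
  card : ℕ
  mul : Fin card → Fin card → Fin card
  mul_assoc : ∀ a b c, mul (mul a b) c = mul a (mul b c)
  bar : Fin card → Fin card
  bar_bar : ∀ a, bar (bar a) = a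
  bar_mul : ∀ a b, bar (mul a b) = mul (bar b) (bar a)
  act : autS n →* Equiv.Perm (Fin card)
  act_mul : ∀ φ a b, act φ (mul a b) = mul (act φ a) (act φ b)
  /-- the values on letters of `ρ`, which is `evalWord mul rhoLetter` -/
  rhoLetter : Letter n → Fin card
  rho_surjective : ∀ a, ∃ w, evalWord mul rhoLetter w = some a
  rho_bar : ∀ w : Word n, evalWord mul rhoLetter w.bar = (evalWord mul rhoLetter w).map bar
  rho_act : ∀ (φ : autS n) (w : Word n),
    evalWord mul rhoLetter (w.act φ) = (evalWord mul rhoLetter w).map (act φ)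
  /-- `ρ` represents the language of non-empty words fixed by `φ` -/
  rho_fix : ∀ φ : autS n, ∃ A : Set (Fin card), ∀ w : Word n, w ≠ [] →
    (w.act φ = w ↔ ∃ a ∈ A, evalWord mul rhoLetter w = some a)
  /-- the constraint on each oriented elementary segment -/
  m : X.OSeg → Fin card
  m_bar : ∀ e, m (OSeg.bar e) = bar (m e)

/-- The epimorphism `ρ` on non-empty words. -/
def StandardForm.rho {n : ℕ} {X : BandComplex n} (C : StandardForm X) :
    Word n → Option (Fin C.card) :=
  evalWord C.mul C.rhoLetter

/-- `σ` is a solution of the band complex satisfying the rational constraints. -/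
def IsSolutionOf {n : ℕ} {X : BandComplex n} (C : StandardForm X) (σ : X.Labelling) : Prop :=
  σ.IsSolution ∧ ∀ e, C.rho (σ.label e) = some (C.m e)

/-- `σ` is a solution of minimal length. -/
def IsShortestSolution {n : ℕ} {X : BandComplex n} (C : StandardForm X) (σ : X.Labelling) : Prop :=
  IsSolutionOf C σ ∧ ∀ σ' : X.Labelling, IsSolutionOf C σ' → σ.length ≤ σ'.length

/-- Code of a base: component, source and target. -/
abbrev BaseCode : Type := ℕ × ℕ × ℕ

/-- Code of a band: its bases, and the images under its twisting automorphism of the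
letters of `S`. -/
abbrev BandCode : Type := BaseCode × BaseCode × List (ℕ × Bool)

/-- Code of a band complex: the numbers of letters of `S`, the list of the numbers of
elementary segments of the components, and the list of bands. -/
abbrev BandComplexCode : Type := ℕ × List ℕ × List BandCode

/-- Code of constraints in standard form: the number of elements of the semigroup, its
multiplication table, the table of its involution, the values of `ρ` on the pairs `a`, `ā`, and for
each component the list of constraints on its increasing elementary segments. The action and the
constraints on decreasing segments are determined by these data. -/
abbrev StandardFormCode : Type := ℕ × List (List ℕ) × List ℕ × List (ℕ × ℕ) × List (List ℕ)

/-- The code of a base. -/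
def Base.code {c : ℕ} {len : Fin c → ℕ} (J : Base len) : BaseCode := (J.comp.val, J.src, J.tgt)

/-- The code of a band. -/
def Band.code {n c : ℕ} {len : Fin c → ℕ} (B : Band n len) : BandCode :=
  (B.base0.code, B.base1.code, (List.finRange n).map fun a =>
    ((B.twist : Equiv.Perm (Letter n)) (a, true)).map Fin.val id)

/-- The code of a band complex. -/
def BandComplex.code {n : ℕ} (X : BandComplex n) : BandComplexCode :=
  (n, List.ofFn X.numSeg, (List.finRange X.numBand).map fun b => (X.band b).code)

/-- The code of constraints in standard form. -/
def StandardForm.code {n : ℕ} {X : BandComplex n} (C : StandardForm X) : StandardFormCode :=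
  (C.card,
    (List.finRange C.card).map (fun a => (List.finRange C.card).map fun b => (C.mul a b).val),
    (List.finRange C.card).map (fun a => (C.bar a).val),
    (List.finRange n).map (fun a => ((C.rhoLetter (a, true)).val, (C.rhoLetter (a, false)).val)),
    (List.finRange X.numComp).map fun i =>
      (List.finRange (X.numSeg i)).map fun j => (C.m ⟨i, (j, true)⟩).val)

end TwistedBand

/-! Suppose that a solution contains a very high power `p ^ s`, and put `d = p.length`. A strictly
shorter solution is built by deleting whole periods; this contradicts minimality.

Only the number `d` is followed, not the word `p`. A band matches its two bases by an injective map
on letters, possibly with a reversal, so it carries `d`-periodic stretches to `d`-periodic stretches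
whatever its twist. The relevant stretches are the runs: maximal intervals of positions whose
neighbourhood of radius `d` has period `d` (`Core`). Bands match runs away from the ends of the
bases.

Two facts say when deletion is harmless. If on both bases of a band the same number of letters, in
blocks of length divisible by `d`, is removed from matched runs, the shortened bases still match
(`map_filter_eq`, then `band_translate` and `band_reflect`). The constraint on a segment is the
final state of an automaton with `N = card + 1` states. In a `d`-periodic stretch, removing a
multiple of `N! * d` letters and keeping at least `N * d` does not change that state
(`foldl_delete_periods`).

It remains to choose how many blocks to delete. A run inside one segment that is equivalent, through
bands, only to such runs is easy: one block is deleted from every run of its class. The other runs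
reach the margin of some vertex. They are cut by the vertices into at most two pieces per segment,
so the number of unknowns depends on the complex alone. Compatibility with the bands is a
homogeneous linear system that the lengths of the pieces satisfy up to an error of order `d`. An
approximate solution with a large coordinate dominates a multiple of a nonzero integral solution
(`cone_decomposition`, `exists_small_solution`), and that solution tells how many blocks to delete
(`RunSystem.exists_plan`).

All thresholds are proportional to `d`, so measured in periods they depend only on the number of
segments and the size of the semigroup, through a primitive recursive function. -/

namespace TwistedBand

/-! ### Approximate solutions of homogeneous linear equations -/

section LinearEquations

open Finset

/-- A vector solves the equation `(A, B)` when its sums over `A` and over `B` coincide. -/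
def Solves {V : Type} (g : V → ℕ) (q : Finset V × Finset V) : Prop :=
  ∑ i ∈ q.1, g i = ∑ i ∈ q.2, g i

/-- The bound obtained after imposing a number of equations on at most `r` variables. -/
def coneBound (r : ℕ) : ℕ → ℕ
  | 0 => r + 1
  | s + 1 => 4 * coneBound r s * coneBound r s * coneBound r s

theorem coneBound_pos (r s : ℕ) : r + 1 ≤ coneBound r s := by
  induction s with
  | zero => exact le_rfl
  | succ s ih =>
    have h1 : 1 ≤ coneBound r s := by omega
    have h2 : 1 * 1 ≤ coneBound r s * coneBound r s := Nat.mul_le_mul h1 h1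
    simp only [coneBound]
    nlinarith

theorem coneBound_mono (r : ℕ) : Monotone (coneBound r) := by
  refine monotone_nat_of_le_succ fun s => ?_
  have h1 : 1 ≤ coneBound r s := by have := coneBound_pos r s; omega
  have h2 : 1 * 1 ≤ coneBound r s * coneBound r s := Nat.mul_le_mul h1 h1
  simp only [coneBound]
  nlinarith

/-- The difference of the two sides of an equation. -/
def defect {V : Type} (q : Finset V × Finset V) (g : V → ℚ) : ℚ :=
  ∑ i ∈ q.1, g i - ∑ i ∈ q.2, g i

theorem defect_add {V : Type} (q : Finset V × Finset V) (g h : V → ℚ) :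
    defect q (fun i => g i + h i) = defect q g + defect q h := by
  simp only [defect, sum_add_distrib]; ring

theorem defect_sum {V κ : Type} [Fintype κ] (q : Finset V × Finset V) (c : κ → ℚ)
    (g : κ → V → ℚ) :
    defect q (fun i => ∑ k, c k * g k i) = ∑ k, c k * defect q (g k) := by
  simp only [defect, mul_sub, sum_sub_distrib, mul_sum]
  rw [sum_comm, sum_comm (s := q.2)]

theorem abs_defect_le {V : Type} [Fintype V] (q : Finset V × Finset V) (g : V → ℚ) (b r : ℚ)
    (hr : (Fintype.card V : ℚ) ≤ r) (h0 : ∀ i, 0 ≤ g i) (hb : ∀ i, g i ≤ b) (hb0 : 0 ≤ b) :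
    |defect q g| ≤ r * b := by
  have key : ∀ s : Finset V, 0 ≤ ∑ i ∈ s, g i ∧ ∑ i ∈ s, g i ≤ r * b := by
    intro s
    refine ⟨sum_nonneg fun i _ => h0 i, ?_⟩
    calc ∑ i ∈ s, g i ≤ ∑ i, g i := sum_le_univ_sum_of_nonneg h0
      _ ≤ ∑ _i : V, b := sum_le_sum fun i _ => hb i
      _ = Fintype.card V * b := by simp
      _ ≤ r * b := by gcongr
  have h1 := key q.1
  have h2 := key q.2
  rw [abs_le]
  unfold defect
  constructor <;> linarith

theorem solves_iff_defect {V : Type} (q : Finset V × Finset V) (g : V → ℕ) :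
    Solves g q ↔ defect q (fun i => (g i : ℚ)) = 0 := by
  unfold Solves defect
  rw [sub_eq_zero]
  beta_reduce
  norm_cast

/-- Balancing: positive and negative parts of a combination can be paired. -/
theorem balance {κ : Type} [Fintype κ] (c a : κ → ℚ) (hc : ∀ k, 0 ≤ c k)
    (ha : ∀ k, a k = 0 ∨ 1 ≤ |a k|) :
    ∃ (t : κ × κ → ℚ) (e : κ → ℚ), (∀ k, 0 ≤ t k) ∧ (∀ k, 0 ≤ e k) ∧
      ∑ k, e k ≤ |∑ k, c k * a k| ∧
      ∀ g : κ → ℚ, ∑ k, c k * g k = ∑ k, c k * (if a k = 0 then g k else 0) +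
        ∑ k, t k * (if 0 < a k.1 ∧ a k.2 < 0 then a k.1 * g k.2 + (-a k.2) * g k.1 else 0) +
        ∑ k, e k * g k := by
  classical
  set P : ℚ := ∑ k, if 0 < a k then c k * a k else 0 with hP
  set N : ℚ := ∑ k, if a k < 0 then c k * (-a k) else 0 with hN
  set T := max P N with hT
  have hP0 : 0 ≤ P := sum_nonneg fun k _ => by
    split_ifs with h
    · exact mul_nonneg (hc k) h.le
    · exact le_rfl
  have hN0 : 0 ≤ N := sum_nonneg fun k _ => by
    split_ifs with h
    · exact mul_nonneg (hc k) (by linarith)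
    · exact le_rfl
  have hPT : P ≤ T := le_max_left _ _
  have hNT : N ≤ T := le_max_right _ _
  have hT0 : 0 ≤ T := hP0.trans hPT
  have hPT1 : P / T ≤ 1 := div_le_one_of_le₀ hPT hT0
  have hNT1 : N / T ≤ 1 := div_le_one_of_le₀ hNT hT0
  have hPN : ∑ k, c k * a k = P - N := by
    rw [hP, hN, ← sum_sub_distrib]
    refine sum_congr rfl fun k _ => ?_
    rcases lt_trichotomy (a k) 0 with h | h | h
    · simp [h, not_lt.mpr h.le]
    · simp [h]
    · simp [h, not_lt.mpr h.le]
  -- With these weights a positive index keeps the fraction `N / T` of its coefficient in pairs and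
  -- a negative one the fraction `P / T`. The smaller side is used up entirely, and `e` records what
  -- is left of the larger side.
  refine ⟨fun k => c k.1 * c k.2 / T,
    fun k => if 0 < a k then (1 - N / T) * c k else if a k < 0 then (1 - P / T) * c k else 0,
    fun k => div_nonneg (mul_nonneg (hc _) (hc _)) hT0, fun k => ?_, ?_, ?_⟩
  · dsimp only
    split_ifs
    · exact mul_nonneg (by linarith) (hc k)
    · exact mul_nonneg (by linarith) (hc k)
    · exact le_rfl
  -- Here `1 ≤ |a k|` is used: the leftover mass is at most the mass weighted by `|a k|`, and the
  -- latter equals `|P - N|`.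
  · have h1 : ∑ k, (if 0 < a k then (1 - N / T) * c k else
        if a k < 0 then (1 - P / T) * c k else 0) ≤ (1 - N / T) * P + (1 - P / T) * N := by
      rw [hP, hN, mul_sum, mul_sum, ← sum_add_distrib, ← hP, ← hN]
      refine sum_le_sum fun k _ => ?_
      rcases lt_trichotomy (a k) 0 with h | h | h
      · have h2 : 1 ≤ -a k := by
          rcases ha k with h3 | h3
          · exact absurd h3 h.ne
          · rwa [abs_of_neg h] at h3
        simp only [not_lt.mpr h.le, h, if_true, if_false, mul_zero, zero_add]
        refine mul_le_mul_of_nonneg_left ?_ (by linarith)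
        nlinarith [hc k]
      · simp [h]
      · have h2 : 1 ≤ a k := by
          rcases ha k with h3 | h3
          · exact absurd h3 h.ne'
          · rwa [abs_of_pos h] at h3
        simp only [not_lt.mpr h.le, h, if_true, if_false, mul_zero, add_zero]
        refine mul_le_mul_of_nonneg_left ?_ (by linarith)
        nlinarith [hc k]
    refine h1.trans ?_
    rw [hPN]
    -- If `T = 0`, the quotients are `0` by convention and nothing is paired, but then both totals
    -- vanish.
    rcases hT0.eq_or_lt with h0 | h0
    · have h2 : P = 0 := by linarith
      have h3 : N = 0 := by linarith
      rw [h2, h3]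
      simp
    rcases le_total P N with h | h
    · have : T = N := max_eq_right h
      rw [abs_of_nonpos (by linarith), this, div_self (by rw [← this]; exact h0.ne')]
      have : P / N * N = P := div_mul_cancel₀ _ (by rw [← this]; exact h0.ne')
      nlinarith
    · have : T = P := max_eq_left h
      rw [abs_of_nonneg (by linarith), this, div_self (by rw [← this]; exact h0.ne')]
      have : N / P * P = N := div_mul_cancel₀ _ (by rw [← this]; exact h0.ne')
      nlinarith
  · intro g
    have h1 : ∑ k : κ × κ, c k.1 * c k.2 / T *
        (if 0 < a k.1 ∧ a k.2 < 0 then a k.1 * g k.2 + (-a k.2) * g k.1 else 0) =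
        P / T * (∑ k, if a k < 0 then c k * g k else 0) +
          N / T * (∑ k, if 0 < a k then c k * g k else 0) := by
      rw [hP, hN, sum_div, sum_div, sum_mul_sum, sum_mul_sum, Fintype.sum_prod_type,
        sum_comm (s := univ) (t := univ) (f := fun i j => (if a i < 0 then c i * -a i else 0) / T *
          if 0 < a j then c j * g j else 0), ← sum_add_distrib]
      refine sum_congr rfl fun u _ => ?_
      rw [← sum_add_distrib]
      refine sum_congr rfl fun w _ => ?_
      by_cases hu : 0 < a u <;> by_cases hw : a w < 0 <;> simp [hu, hw]
      ring
    rw [h1, mul_sum, mul_sum, ← sum_add_distrib, ← sum_add_distrib, ← sum_add_distrib]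
    refine sum_congr rfl fun k _ => ?_
    rcases lt_trichotomy (a k) 0 with h | h | h
    · simp [h, h.ne, not_lt.mpr h.le]; ring
    · simp [h]
    · simp [h, h.ne', not_lt.mpr h.le]; ring

/-- Elimination of the equations one at a time, starting from the unit vectors. The generators
solving the earlier equations have integral defects for the new one; those of opposite signs are
combined in pairs so that their defects cancel. The unpaired part is controlled by the defect `ε`
and goes into the remainder `f`. One step replaces `Z` by at most `4 * Z ^ 3`. -/
theorem cone_decomposition {V : Type} [Fintype V] (r : ℕ) (hr : Fintype.card V ≤ r)
    (eqs : List (Finset V × Finset V)) (l : V → ℚ) (hl : ∀ i, 0 ≤ l i) (ε : ℚ) (hε : 0 ≤ ε)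
    (heq : ∀ q ∈ eqs, |defect q l| ≤ ε) :
    ∃ (κ : Type) (_ : Fintype κ) (c : κ → ℚ) (g : κ → V → ℕ) (f : V → ℚ),
      Fintype.card κ ≤ coneBound r eqs.length ∧ (∀ k, 0 ≤ c k) ∧
      (∀ k i, g k i ≤ coneBound r eqs.length) ∧ (∀ k, ∀ q ∈ eqs, Solves (g k) q) ∧
      (∀ i, 0 ≤ f i) ∧ (∀ i, f i ≤ coneBound r eqs.length * ε) ∧
      ∀ i, l i = ∑ k, c k * g k i + f i := by
  classical
  induction eqs with
  | nil =>
    refine ⟨V, inferInstance, l, fun k i => if i = k then 1 else 0, 0, ?_, hl, ?_, ?_, ?_, ?_, ?_⟩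
    · simp only [List.length_nil, coneBound]; omega
    · intro k i
      simp only [List.length_nil, coneBound]
      split_ifs <;> omega
    · intro k q hq
      simp at hq
    · simp
    · intro i
      simp only [Pi.zero_apply]
      positivity
    · intro i; simp
  | cons q eqs ih =>
    obtain ⟨κ, _, c, g, f, hκ, hc, hg, hsol, hf0, hf, hdec⟩ :=
      ih fun q' hq' => heq q' (List.mem_cons_of_mem _ hq')
    set Z := coneBound r eqs.length with hZ
    have hrZ : r + 1 ≤ Z := coneBound_pos _ _
    have hcard : (Fintype.card V : ℚ) ≤ Z := by exact_mod_cast (by omega : Fintype.card V ≤ Z)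
    let az : κ → ℤ := fun k => (∑ i ∈ q.1, (g k i : ℤ)) - ∑ i ∈ q.2, (g k i : ℤ)
    let a : κ → ℚ := fun k => defect q fun i => (g k i : ℚ)
    have haz : ∀ k, a k = az k := by
      intro k; simp [a, az, defect]
    obtain ⟨t, e, ht, he, hesum, hbal⟩ := balance c a hc (by
      intro k
      by_cases h : az k = 0
      · left; rw [haz, h]; simp
      · right; rw [haz]; exact_mod_cast Int.one_le_abs h)
    have habs : ∀ k, |az k| ≤ Z * Z := by
      intro k
      have := abs_defect_le q (fun i => (g k i : ℚ)) Z Z hcard (fun i => by positivity)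
        (fun i => by exact_mod_cast hg k i) (by positivity)
      have h2 : |a k| ≤ (Z : ℚ) * Z := this
      rw [haz] at h2
      exact_mod_cast h2
    have hZ1 : 1 ≤ Z := by omega
    have hZZ : Z ≤ Z * Z := Nat.le_mul_of_pos_left _ hZ1
    have hZZZ : Z * Z ≤ Z * Z * Z := Nat.le_mul_of_pos_right _ hZ1
    have hlen : coneBound r (q :: eqs).length = 4 * Z * Z * Z := rfl
    -- Old generators with zero defect survive. A pair with defects of opposite signs gets the
    -- combination of zero defect, with coefficients at most `Z * Z`. The zero vector fills the
    -- useless indices.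
    let g' : κ ⊕ κ × κ → V → ℕ := Sum.elim (fun k => if az k = 0 then g k else 0)
      fun k => if 0 < az k.1 ∧ az k.2 < 0 then
        fun i => (az k.1).toNat * g k.2 i + (-az k.2).toNat * g k.1 i else 0
    refine ⟨κ ⊕ κ × κ, inferInstance, Sum.elim c t, g', fun i => f i + ∑ k, e k * g k i,
      ?_, ?_, ?_, ?_, ?_, ?_, ?_⟩
    · rw [hlen, Fintype.card_sum, Fintype.card_prod]
      have := Nat.mul_le_mul hκ hκ
      nlinarith
    · rintro (k | k)
      · exact hc k
      · exact ht k
    · rw [hlen]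
      rintro (k | k) i
      · simp only [g', Sum.elim_inl]
        split_ifs
        · exact (hg k i).trans (by nlinarith)
        · simp
      · simp only [g', Sum.elim_inr]
        split_ifs with h
        · have h1 := (abs_le.mp (habs k.1)).2
          have h2 := (abs_le.mp (habs k.2)).1
          have h3 : (az k.1).toNat ≤ Z * Z := by zify; omega
          have h4 : (-az k.2).toNat ≤ Z * Z := by zify; omega
          have h5 := Nat.mul_le_mul h3 (hg k.2 i)
          have h6 := Nat.mul_le_mul h4 (hg k.1 i)
          nlinarith
        · simp
    · rintro (k | k) q' hq'
      · simp only [g', Sum.elim_inl]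
        split_ifs with h
        · rcases List.mem_cons.mp hq' with rfl | h'
          · rw [solves_iff_defect]
            have := haz k
            rw [h] at this
            simpa using this
          · exact hsol k q' h'
        · simp [Solves]
      · simp only [g', Sum.elim_inr]
        split_ifs with h
        · have h1 : (((az k.1).toNat : ℤ) : ℚ) = a k.1 := by
            rw [haz, Int.toNat_of_nonneg h.1.le]
          have h2 : (((-az k.2).toNat : ℤ) : ℚ) = -a k.2 := by
            rw [haz, Int.toNat_of_nonneg (by omega)]; push_cast; rfl
          push_cast at h1 h2
          have key : defect q' (fun i => (((az k.1).toNat * g k.2 i +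
              (-az k.2).toNat * g k.1 i : ℕ) : ℚ)) =
              a k.1 * defect q' (fun i => (g k.2 i : ℚ)) +
                (-a k.2) * defect q' (fun i => (g k.1 i : ℚ)) := by
            simp only [defect, Nat.cast_add, Nat.cast_mul, h1, h2, sum_add_distrib, ← mul_sum]
            ring
          rw [solves_iff_defect, key]
          rcases List.mem_cons.mp hq' with rfl | h'
          · simp only [a]; ring
          · rw [(solves_iff_defect _ _).mp (hsol k.1 q' h'),
              (solves_iff_defect _ _).mp (hsol k.2 q' h')]
            simp
        · simp [Solves]
    · intro i
      have := hf0 i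
      have h2 : 0 ≤ ∑ k, e k * (g k i : ℚ) := sum_nonneg fun k _ => mul_nonneg (he k) (by positivity)
      linarith
    · intro i
      rw [hlen]
      have h1 : ∑ k, e k * (g k i : ℚ) ≤ (∑ k, e k) * Z := by
        rw [sum_mul]
        refine sum_le_sum fun k _ => mul_le_mul_of_nonneg_left ?_ (he k)
        exact_mod_cast hg k i
      have h2 : defect q l = ∑ k, c k * a k + defect q f := by
        have : l = fun i => (∑ k, c k * (g k i : ℚ)) + f i := funext hdec
        rw [this, defect_add, defect_sum]
      have h3 : |defect q f| ≤ Z * (Z * ε) :=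
        abs_defect_le q f _ _ hcard hf0 hf (by positivity)
      have h4 := heq q List.mem_cons_self
      -- The total defect of the combination is that of `l` minus that of the old remainder; by
      -- `hesum` it bounds the mass moved to the new remainder.
      have h5 : |∑ k, c k * a k| ≤ ε + Z * (Z * ε) := by
        have : ∑ k, c k * a k = defect q l - defect q f := by rw [h2]; ring
        rw [this]
        exact (abs_sub _ _).trans (add_le_add h4 h3)
      have h6 : (∑ k, e k) * (Z : ℚ) ≤ (ε + Z * (Z * ε)) * Z :=
        mul_le_mul_of_nonneg_right (hesum.trans h5) (by positivity)
      have h7 := hf i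
      have hq1 : (1 : ℚ) ≤ Z := by exact_mod_cast hZ1
      have hq2 : (Z : ℚ) ≤ Z * Z * Z := by exact_mod_cast hZZ.trans hZZZ
      have hq3 : (Z : ℚ) * ε ≤ Z * Z * Z * ε := mul_le_mul_of_nonneg_right hq2 hε
      push_cast
      nlinarith
    · intro i
      rw [hdec i, hbal fun k => (g k i : ℚ), Fintype.sum_sum_type]
      have h1 : ∀ k, ((g' (Sum.inl k) i : ℕ) : ℚ) = if a k = 0 then (g k i : ℚ) else 0 := by
        intro k
        simp only [g', Sum.elim_inl, haz]
        norm_cast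
        split_ifs <;> simp
      have h2 : ∀ k, ((g' (Sum.inr k) i : ℕ) : ℚ) = if 0 < a k.1 ∧ a k.2 < 0 then
          a k.1 * g k.2 i + (-a k.2) * g k.1 i else 0 := by
        intro k
        simp only [g', Sum.elim_inr, haz, Int.cast_pos, Int.cast_lt_zero]
        split_ifs with h
        · have h1 : (((az k.1).toNat : ℤ) : ℚ) = az k.1 := by
            rw [Int.toNat_of_nonneg h.1.le]
          have h2 : (((-az k.2).toNat : ℤ) : ℚ) = -az k.2 := by
            rw [Int.toNat_of_nonneg (by omega)]; push_cast; rfl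
          push_cast at h1 h2 ⊢
          rw [h1, h2]
        · simp
      simp only [Sum.elim_inl, Sum.elim_inr, h1, h2]
      ring

/-- An approximate non-negative solution with a large coordinate dominates a multiple of a
non-zero integral solution. -/
theorem exists_small_solution {V : Type} [Fintype V] (r : ℕ) (hr : Fintype.card V ≤ r)
    (E : Set (Finset V × Finset V)) (l : V → ℕ) (ε Q : ℕ)
    (heq : ∀ q ∈ E, ∑ i ∈ q.1, l i ≤ ∑ i ∈ q.2, l i + ε ∧ ∑ i ∈ q.2, l i ≤ ∑ i ∈ q.1, l i + ε)
    (j : V) (hj : coneBound r (4 ^ r) * coneBound r (4 ^ r) * (ε + Q) < l j) :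
    ∃ v : V → ℕ, v ≠ 0 ∧ (∀ q ∈ E, Solves v q) ∧ ∀ i, Q * v i ≤ l i := by
  classical
  -- An equation is a pair of subsets of `V`, so there are at most `4 ^ r` of them however `E` is
  -- described.
  let E' : Finset (Finset V × Finset V) := univ.filter fun q => q ∈ E
  have hE' : E'.toList.length ≤ 4 ^ r := by
    rw [length_toList]
    refine (card_le_univ _).trans ?_
    rw [Fintype.card_prod, Fintype.card_finset, ← mul_pow]
    exact Nat.pow_le_pow_right (by norm_num) hr
  obtain ⟨κ, _, c, g, f, hκ, hc, hg, hsol, hf0, hf, hdec⟩ := cone_decomposition r hr E'.toList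
    (fun i => (l i : ℚ)) (fun i => by positivity) ε (by positivity) (by
      intro q hq
      have hq' : q ∈ E := by simpa [E'] using hq
      obtain ⟨h1, h2⟩ := heq q hq'
      rw [abs_le]
      unfold defect
      have h1' : (∑ i ∈ q.1, (l i : ℚ)) ≤ ∑ i ∈ q.2, (l i : ℚ) + ε := by exact_mod_cast h1
      have h2' : (∑ i ∈ q.2, (l i : ℚ)) ≤ ∑ i ∈ q.1, (l i : ℚ) + ε := by exact_mod_cast h2
      constructor <;> linarith)
  have hmono := coneBound_mono r hE'
  set Z := coneBound r (4 ^ r)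
  set Y := coneBound r E'.toList.length
  -- If every generator that is nonzero at `j` had coefficient below `Q`, the coordinate `l j` would
  -- be at most `Z * (Q * Z) + Z * ε`.
  obtain ⟨k, hk0, hkQ⟩ : ∃ k, g k j ≠ 0 ∧ (Q : ℚ) ≤ c k := by
    by_contra! hcon
    have h1 : ∑ k, c k * (g k j : ℚ) ≤ ∑ _k : κ, (Q : ℚ) * Z := by
      refine sum_le_sum fun k _ => ?_
      by_cases h0 : g k j = 0
      · rw [h0]; simp; positivity
      · refine mul_le_mul (hcon k h0).le ?_ (by positivity) (by positivity)
        exact_mod_cast (hg k j).trans hmono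
    have h2 : ∑ _k : κ, (Q : ℚ) * Z ≤ Z * (Q * Z) := by
      rw [sum_const, card_univ, nsmul_eq_mul]
      refine mul_le_mul_of_nonneg_right ?_ (by positivity)
      exact_mod_cast hκ.trans hmono
    have h3 : f j ≤ Z * ε := (hf j).trans (by gcongr)
    have h4 := hdec j
    have h5 : (Z : ℚ) * Z * (ε + Q) < l j := by exact_mod_cast hj
    have hZ1 : 1 ≤ Z := by have := coneBound_pos r (4 ^ r); omega
    have h6 : (Z : ℚ) * ε ≤ Z * Z * ε := by
      exact_mod_cast Nat.mul_le_mul_right ε (Nat.le_mul_of_pos_left Z hZ1)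
    nlinarith
  refine ⟨g k, fun h => hk0 (by rw [h]; rfl), fun q hq => hsol k q (by simpa [E'] using hq), ?_⟩
  intro i
  have h1 : c k * (g k i : ℚ) ≤ ∑ k, c k * (g k i : ℚ) :=
    single_le_sum (f := fun k => c k * (g k i : ℚ))
      (fun k _ => mul_nonneg (hc k) (by positivity)) (mem_univ k)
  have h2 := hdec i
  have h3 := hf0 i
  have h4 : (Q : ℚ) * g k i ≤ c k * g k i := mul_le_mul_of_nonneg_right hkQ (by positivity)
  have h5 : (Q : ℚ) * g k i ≤ l i := by linarith
  exact_mod_cast h5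

end LinearEquations

/-! ### Runs of a set of natural numbers -/

section Runs

/-- The first element of the interval of `K` containing `x`. -/
noncomputable def runStart (K : ℕ → Prop) (x : ℕ) : ℕ :=
  sInf {a | a ≤ x ∧ ∀ z, a ≤ z → z ≤ x → K z}

/-- The first element after `x` that is not in `K`. -/
noncomputable def runEnd (K : ℕ → Prop) (x : ℕ) : ℕ :=
  sInf {b | x ≤ b ∧ ¬ K b}

variable {K : ℕ → Prop} {x : ℕ}

theorem runStart_spec (hx : K x) :
    runStart K x ≤ x ∧ ∀ z, runStart K x ≤ z → z ≤ x → K z :=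
  Nat.sInf_mem (s := {a | a ≤ x ∧ ∀ z, a ≤ z → z ≤ x → K z})
    ⟨x, le_rfl, fun z h1 h2 => by rwa [le_antisymm h2 h1]⟩

theorem not_pred_runStart (hx : K x) {w : ℕ} (hw : w + 1 = runStart K x) : ¬ K w := by
  intro h
  obtain ⟨h1, h2⟩ := runStart_spec hx
  have : runStart K x ≤ w := Nat.sInf_le ⟨by omega, fun z h3 h4 => by
    rcases h3.eq_or_lt with rfl | h3
    · exact h
    · exact h2 z (by omega) h4⟩
  omega

theorem runEnd_spec {L : ℕ} (hL : ∀ z, K z → z < L) (x : ℕ) :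
    x ≤ runEnd K x ∧ ¬ K (runEnd K x) :=
  Nat.sInf_mem (s := {b | x ≤ b ∧ ¬ K b}) ⟨x + L, by omega, fun h => by have := hL _ h; omega⟩

theorem mem_of_lt_runEnd {z : ℕ} (h1 : x ≤ z) (h2 : z < runEnd K x) : K z := by
  by_contra h
  exact absurd (Nat.sInf_le (s := {b | x ≤ b ∧ ¬ K b}) ⟨h1, h⟩) (not_le.mpr h2)

theorem mem_of_mem_run (hx : K x) {z : ℕ} (h1 : runStart K x ≤ z) (h2 : z < runEnd K x) :
    K z := by
  rcases le_total z x with h | h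
  · exact (runStart_spec hx).2 z h1 h
  · exact mem_of_lt_runEnd h h2

theorem lt_runEnd {L : ℕ} (hL : ∀ z, K z → z < L) (hx : K x) : x < runEnd K x := by
  obtain ⟨h1, h2⟩ := runEnd_spec hL x
  refine lt_of_le_of_ne h1 fun h => h2 (h ▸ hx)

/-- A maximal interval of `K` is the run of each of its points. -/
theorem run_unique {A B : ℕ} (h1 : A ≤ x) (h2 : x < B)
    (hK : ∀ z, A ≤ z → z < B → K z) (hA : ∀ w, w + 1 = A → ¬ K w) (hB : ¬ K B) :
    runStart K x = A ∧ runEnd K x = B := by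
  have hx : K x := hK x h1 h2
  constructor
  · obtain ⟨h3, h4⟩ := runStart_spec hx
    refine le_antisymm (Nat.sInf_le ⟨h1, fun z h5 h6 => hK z h5 (by omega)⟩) ?_
    by_contra! hlt
    obtain ⟨w, rfl⟩ : ∃ w, A = w + 1 := ⟨A - 1, by omega⟩
    exact hA w rfl (h4 w (by omega) (by omega))
  · refine le_antisymm (Nat.sInf_le ⟨h2.le, hB⟩) ?_
    refine le_csInf ⟨B, h2.le, hB⟩ fun b hb => ?_
    by_contra! hlt
    exact hb.2 (hK b (by have := hb.1; omega) hlt)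

theorem run_eq_of_mem_run {L : ℕ} (hL : ∀ z, K z → z < L) (hx : K x) {z : ℕ}
    (h1 : runStart K x ≤ z) (h2 : z < runEnd K x) :
    runStart K z = runStart K x ∧ runEnd K z = runEnd K x :=
  run_unique h1 h2 (fun _ => mem_of_mem_run hx) (fun _ => not_pred_runStart hx) (runEnd_spec hL x).2

end Runs

/-! ### Counting -/

section Counting

theorem count_add_eq {p : ℕ → Prop} [DecidablePred p] {P n : ℕ}
    (h : ∀ z, P ≤ z → z < P + n → p z) : Nat.count p (P + n) = Nat.count p P + n := by
  induction n with
  | zero => rfl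
  | succ n ih =>
    rw [← Nat.add_assoc, Nat.count_succ, ih fun z h1 h2 => h z h1 (by omega),
      if_pos (h _ (by omega) (by omega))]
    omega

theorem count_eq_of_forall_not {p : ℕ → Prop} [DecidablePred p] {P Q : ℕ} (hPQ : P ≤ Q)
    (h : ∀ z, P ≤ z → z < Q → ¬ p z) : Nat.count p Q = Nat.count p P := by
  induction Q, hPQ using Nat.le_induction with
  | base => rfl
  | succ Q hQ ih =>
    rw [Nat.count_succ, ih fun z h1 h2 => h z h1 (by omega), if_neg (h _ hQ (by omega)), Nat.add_zero]

/-- A predicate that holds exactly on the interval from `s` to `s + k`. -/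
theorem count_interval {p : ℕ → Prop} [DecidablePred p] {P Q s k : ℕ} (hPQ : P ≤ Q)
    (hs : 0 < k → P ≤ s ∧ s + k ≤ Q)
    (h : ∀ z, P ≤ z → z < Q → (p z ↔ s ≤ z ∧ z < s + k)) :
    Nat.count p Q = Nat.count p P + k := by
  rcases Nat.eq_zero_or_pos k with rfl | hk
  · rw [count_eq_of_forall_not hPQ fun z h1 h2 => by rw [h z h1 h2]; omega, Nat.add_zero]
  · obtain ⟨h1, h2⟩ := hs hk
    rw [count_eq_of_forall_not h2 fun z h3 h4 => by rw [h z (by omega) h4]; omega,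
      count_add_eq fun z h3 h4 => (h z (by omega) (by omega)).mpr ⟨h3, h4⟩,
      count_eq_of_forall_not h1 fun z h3 h4 => by rw [h z h3 (by omega)]; omega]

theorem count_congr {p q : ℕ → Prop} [DecidablePred p] [DecidablePred q] {P Q : ℕ} (hPQ : P ≤ Q)
    (h : ∀ z, P ≤ z → z < Q → (p z ↔ q z)) :
    Nat.count p Q + Nat.count q P = Nat.count q Q + Nat.count p P := by
  induction Q, hPQ using Nat.le_induction with
  | base => omega
  | succ Q hQ ih =>
    have h1 := ih fun z h1 h2 => h z h1 (by omega)
    have h2 := h Q hQ (by omega)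
    rw [Nat.count_succ, Nat.count_succ]
    by_cases hq : q Q
    · rw [if_pos hq, if_pos (h2.mpr hq)]; omega
    · rw [if_neg hq, if_neg (mt h2.mp hq)]; omega

theorem count_not_add {p : ℕ → Prop} [DecidablePred p] (m : ℕ) :
    Nat.count (fun t => ¬ p t) m + Nat.count p m = m := by
  induction m with
  | zero => simp
  | succ m ih =>
    rw [Nat.count_succ, Nat.count_succ]
    by_cases h : p m <;> simp only [h, not_true_eq_false, not_false_eq_true, if_true, if_false] <;>
      omega

theorem exists_count_eq {p : ℕ → Prop} [DecidablePred p] {m j : ℕ} (hj : j < Nat.count p m) :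
    ∃ x < m, p x ∧ Nat.count p x = j := by
  induction m with
  | zero => simp at hj
  | succ m ih =>
    rw [Nat.count_succ] at hj
    by_cases h : j < Nat.count p m
    · obtain ⟨x, h1, h2⟩ := ih h
      exact ⟨x, by omega, h2⟩
    · by_cases hp : p m
      · exact ⟨m, by omega, hp, by rw [if_pos hp] at hj; omega⟩
      · rw [if_neg hp] at hj; omega

theorem filter_range_eq {p : ℕ → Prop} [DecidablePred p] (m : ℕ) :
    (List.range m).filter p = (List.range (Nat.count p m)).map (Nat.nth p) := by
  induction m with
  | zero => simp
  | succ m ih =>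
    rw [List.range_succ, List.filter_append, ih, Nat.count_succ]
    by_cases h : p m
    · simp [h, List.range_succ, Nat.nth_count h]
    · simp [h]

end Counting

/-! ### Deleting letters in periodic intervals -/

section Deletion

theorem eq_of_periodic {α : Type} {v : ℕ → α} {d x k : ℕ}
    (h : ∀ z, x ≤ z → z < x + k * d → z + d ≤ x + k * d → v z = v (z + d)) :
    v (x + k * d) = v x := by
  induction k with
  | zero => simp
  | succ k ih =>
    rcases Nat.eq_zero_or_pos d with rfl | hd
    · simp
    · have e : x + (k + 1) * d = x + k * d + d := by ring
      rw [e, ← h _ (by omega) (by omega) (by omega),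
        ih fun z h1 h2 h3 => h z h1 (by omega) (by omega)]

/-- Survivors of equal rank differ by a multiple of `d`, since rank and position agree modulo `d`.
No position `z` between them is outside `K`: it would survive, and its rank, common to both
deletions, would be at least that of `x₀` and less than that of `x₁`. Periodicity therefore carries
the letter from one to the other. -/
theorem survivors_letter_eq {α : Type} (v : ℕ → α) (d m : ℕ) (K p₀ p₁ : ℕ → Prop)
    [DecidablePred p₀] [DecidablePred p₁] (hper : ∀ x, K x → v x = v (x + d))
    (h₁ : ∀ x < m, ¬ K x → p₁ x)
    (hcount : ∀ x ≤ m, ¬ K x → Nat.count p₀ x = Nat.count p₁ x)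
    {x₀ x₁ : ℕ} (hx₁ : x₁ < m) (hle : x₀ ≤ x₁)
    (hj : Nat.count p₀ x₀ = Nat.count p₁ x₁)
    (hd₀ : Nat.count p₀ x₀ ≡ x₀ [MOD d]) (hd₁ : Nat.count p₁ x₁ ≡ x₁ [MOD d]) :
    v x₀ = v x₁ := by
  obtain ⟨k, hk⟩ : d ∣ x₁ - x₀ := (Nat.modEq_iff_dvd' hle).mp (hd₀.symm.trans (hj ▸ hd₁))
  have e : x₁ = x₀ + k * d := by rw [Nat.mul_comm k d, ← hk]; omega
  rw [e]
  symm
  refine eq_of_periodic fun z h1 h2 _ => hper z ?_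
  by_contra hz
  have hzm : z < x₁ := by omega
  have h3 := Nat.count_monotone p₀ h1
  have h4 := Nat.count_monotone p₁ (Nat.succ_le_of_lt hzm)
  rw [Nat.succ_eq_add_one, Nat.count_succ, if_pos (h₁ z (by omega) hz),
    ← hcount z (by omega) hz] at h4
  omega

/-- Two ways of deleting the same numbers of periods from the runs of a word agree. -/
theorem map_filter_eq {α : Type} (v : ℕ → α) (d m : ℕ) (K p₀ p₁ : ℕ → Prop)
    [DecidablePred p₀] [DecidablePred p₁] (hper : ∀ x, K x → v x = v (x + d))
    (h₀ : ∀ x < m, ¬ K x → p₀ x) (h₁ : ∀ x < m, ¬ K x → p₁ x)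
    (hcount : ∀ x ≤ m, ¬ K x → Nat.count p₀ x = Nat.count p₁ x) (hm : ¬ K m)
    (hd₀ : ∀ x < m, p₀ x → Nat.count p₀ x ≡ x [MOD d])
    (hd₁ : ∀ x < m, p₁ x → Nat.count p₁ x ≡ x [MOD d]) :
    ((List.range m).filter p₀).map v = ((List.range m).filter p₁).map v := by
  rw [filter_range_eq, filter_range_eq, hcount m le_rfl hm, List.map_map, List.map_map]
  refine List.map_congr_left fun j hj => ?_
  rw [List.mem_range] at hj
  obtain ⟨x₁, hx₁, hp₁, hc₁⟩ := exists_count_eq hj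
  obtain ⟨x₀, hx₀, hp₀, hc₀⟩ := exists_count_eq (by rwa [hcount m le_rfl hm] :
    j < Nat.count p₀ m)
  have e₀ := Nat.nth_count hp₀
  have e₁ := Nat.nth_count hp₁
  rw [hc₀] at e₀
  rw [hc₁] at e₁
  simp only [Function.comp_apply, e₀, e₁]
  rcases le_total x₀ x₁ with h | h
  · exact survivors_letter_eq v d m K p₀ p₁ hper h₁ hcount hx₁ h (hc₀.trans hc₁.symm)
      (hd₀ _ hx₀ hp₀) (hd₁ _ hx₁ hp₁)
  · exact (survivors_letter_eq v d m K p₁ p₀ hper h₀ (fun x hx hK => (hcount x hx hK).symm) hx₀ h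
      (hc₁.trans hc₀.symm) (hd₁ _ hx₁ hp₁) (hd₀ _ hx₀ hp₀)).symm

/-- Equality run by run adds up: each position outside `K` is compared with the previous such
position. -/
theorem count_eq_of_runs (m : ℕ) (K q₀ q₁ : ℕ → Prop)
    [DecidablePred q₀] [DecidablePred q₁] (hK0 : ¬ K 0)
    (hruns : ∀ A B, A < B → B ≤ m → ¬ K A → ¬ K B → (∀ z, A < z → z < B → K z) →
      Nat.count q₀ B + Nat.count q₁ A = Nat.count q₁ B + Nat.count q₀ A) :
    ∀ x ≤ m, ¬ K x → Nat.count q₀ x = Nat.count q₁ x := by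
  intro x
  induction x using Nat.strong_induction_on with
  | _ x ih =>
    intro hx hKx
    rcases Nat.eq_zero_or_pos x with rfl | hpos
    · simp
    classical
    let A := Nat.findGreatest (fun z => ¬ K z) (x - 1)
    have hA : ¬ K A := Nat.findGreatest_spec (P := fun z => ¬ K z) (Nat.zero_le _) hK0
    have hAx : A ≤ x - 1 := Nat.findGreatest_le _
    have h1 := hruns A x (by omega) hx hA hKx fun z h1 h2 => by
      by_contra h3
      exact absurd (Nat.le_findGreatest (P := fun z => ¬ K z) (by omega : z ≤ x - 1) h3)
        (not_le.mpr h1)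
    have h2 := ih A (by omega) (by omega) hA
    omega

theorem Ico_filter_map_eq_range {α : Type} (W : ℕ → α) (p : ℕ → Prop) [DecidablePred p]
    (P l : ℕ) : ((List.Ico P (P + l)).filter p).map W =
      ((List.range l).filter fun t => p (P + t)).map fun t => W (P + t) := by
  have : List.Ico P (P + l) = (List.range l).map (P + ·) := by
    rw [← List.Ico.zero_bot, List.Ico.map_add, Nat.zero_add, Nat.add_comm]
  rw [this, List.filter_map, List.map_map]
  rfl

theorem Ico_filter_map_reverse {α : Type} (W : ℕ → α) (p : ℕ → Prop) [DecidablePred p]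
    (P l : ℕ) : (((List.Ico P (P + l)).filter p).map W).reverse =
      ((List.range l).filter fun t => p (P + (l - 1 - t))).map fun t => W (P + (l - 1 - t)) := by
  rw [Ico_filter_map_eq_range, ← List.map_reverse, ← List.filter_reverse]
  have : (List.range l).reverse = (List.range l).map fun t => l - 1 - t := by
    rw [List.range_eq_range', List.reverse_range']
    simp [List.range_eq_range']
  rw [this, List.filter_map, List.map_map]
  rfl

theorem count_shift {p : ℕ → Prop} [DecidablePred p] (P t : ℕ) :
    Nat.count (fun t => p (P + t)) t + Nat.count p P = Nat.count p (P + t) := by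
  rw [Nat.count_add]; omega

theorem count_reflect {p : ℕ → Prop} [DecidablePred p] (P l t : ℕ) (ht : t ≤ l) :
    Nat.count (fun t => p (P + (l - 1 - t))) t + Nat.count p (P + (l - t)) =
      Nat.count p (P + l) := by
  induction t with
  | zero => simp
  | succ t ih =>
    rw [Nat.count_succ, ← ih (by omega)]
    have e : l - t = l - 1 - t + 1 := by omega
    have e2 : l - (t + 1) = l - 1 - t := by omega
    rw [e, e2, ← Nat.add_assoc, Nat.count_succ]
    omega

/-- A set of deleted positions that consists, between surviving positions, of blocks with
lengths divisible by `d`. -/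
def DividesBlocks (d : ℕ) (del : ℕ → Prop) [DecidablePred del] (L : ℕ) : Prop :=
  ∀ z ≤ L, ¬ del z → d ∣ Nat.count del z

theorem modEq_of_add_eq {a b c d : ℕ} (h : a + b = c) (hd : d ∣ b) : a ≡ c [MOD d] := by
  rw [← h]
  exact (Nat.modEq_iff_dvd' (by omega)).mpr (by simpa using hd)

/-- Deletion is compatible with a band preserving the orientation. -/
theorem deletion_translate {α β : Type} (W₀ : ℕ → α) (W₁ : ℕ → β) (φ : α → β)
    (d l P₀ P₁ L₀ L₁ : ℕ) (K del₀ del₁ : ℕ → Prop) [DecidablePred del₀] [DecidablePred del₁]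
    (hP₀ : P₀ + l ≤ L₀) (hP₁ : P₁ + l ≤ L₁)
    (hW : ∀ t < l, W₁ (P₁ + t) = φ (W₀ (P₀ + t)))
    (hK0 : ¬ K 0) (hKl : ¬ K l) (hper : ∀ t, K t → W₀ (P₀ + t) = W₀ (P₀ + t + d))
    (hdel₀ : ∀ t < l, del₀ (P₀ + t) → K t) (hdel₁ : ∀ t < l, del₁ (P₁ + t) → K t)
    (hd₀ : DividesBlocks d del₀ L₀) (hd₁ : DividesBlocks d del₁ L₁)
    (hP₀' : ¬ del₀ P₀) (hP₁' : ¬ del₁ P₁)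
    (hruns : ∀ A B, A < B → B ≤ l → ¬ K A → ¬ K B → (∀ z, A < z → z < B → K z) →
      Nat.count del₀ (P₀ + B) + Nat.count del₁ (P₁ + A) =
        Nat.count del₁ (P₁ + B) + Nat.count del₀ (P₀ + A)) :
    ((List.Ico P₁ (P₁ + l)).filter fun z => ¬ del₁ z).map W₁ =
      (((List.Ico P₀ (P₀ + l)).filter fun z => ¬ del₀ z).map W₀).map φ := by
  rw [Ico_filter_map_eq_range, Ico_filter_map_eq_range, List.map_map]
  have e : ((List.range l).filter fun t => ¬ del₁ (P₁ + t)).map (fun t => W₁ (P₁ + t)) =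
      ((List.range l).filter fun t => ¬ del₁ (P₁ + t)).map fun t => φ (W₀ (P₀ + t)) := by
    refine List.map_congr_left fun t ht => hW t ?_
    exact List.mem_range.mp (List.mem_filter.mp ht).1
  rw [e]
  symm
  -- Rank plus number of deletions is the position; at a survivor the number of deletions is
  -- divisible by `d`, hence the congruence that `map_filter_eq` requires.
  have c₀ : ∀ t, Nat.count (fun t => ¬ del₀ (P₀ + t)) t + (Nat.count del₀ (P₀ + t) -
      Nat.count del₀ P₀) = t := fun t => by
    rw [← count_shift, Nat.add_sub_cancel]; exact count_not_add t
  have c₁ : ∀ t, Nat.count (fun t => ¬ del₁ (P₁ + t)) t + (Nat.count del₁ (P₁ + t) -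
      Nat.count del₁ P₁) = t := fun t => by
    rw [← count_shift, Nat.add_sub_cancel]; exact count_not_add t
  refine map_filter_eq (fun t => φ (W₀ (P₀ + t))) d l K _ _
    (fun t ht => congrArg φ ((hper t ht).trans (by rw [Nat.add_assoc])))
    (fun t ht hK h => hK (hdel₀ t ht h)) (fun t ht hK h => hK (hdel₁ t ht h)) ?_ hKl ?_ ?_
  · intro t ht hK
    have h := count_eq_of_runs l K (fun t => del₀ (P₀ + t)) (fun t => del₁ (P₁ + t)) hK0
      (by
        intro A B hAB hB hA' hB' hz
        have := hruns A B hAB hB hA' hB' hz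
        have a1 := count_shift (p := del₀) P₀ A
        have a2 := count_shift (p := del₀) P₀ B
        have a3 := count_shift (p := del₁) P₁ A
        have a4 := count_shift (p := del₁) P₁ B
        omega) t ht hK
    have h1 := count_not_add (p := fun t => del₀ (P₀ + t)) t
    have h2 := count_not_add (p := fun t => del₁ (P₁ + t)) t
    omega
  · intro t ht hp
    exact modEq_of_add_eq (c₀ t)
      (Nat.dvd_sub (hd₀ _ (by omega) hp) (hd₀ _ (by omega) hP₀'))
  · intro t ht hp
    exact modEq_of_add_eq (c₁ t)
      (Nat.dvd_sub (hd₁ _ (by omega) hp) (hd₁ _ (by omega) hP₁'))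

/-- Deletion is compatible with a band reversing the orientation. -/
theorem deletion_reflect {α β : Type} (W₀ : ℕ → α) (W₁ : ℕ → β) (φ : α → β)
    (d l P₀ P₁ L₀ L₁ : ℕ) (K del₀ del₁ : ℕ → Prop) [DecidablePred del₀] [DecidablePred del₁]
    (hP₀ : P₀ + l ≤ L₀) (hP₁ : P₁ + l ≤ L₁)
    (hW : ∀ t < l, W₁ (P₁ + (l - 1 - t)) = φ (W₀ (P₀ + t)))
    (hK0 : ¬ K 0) (hKl : ¬ K l) (hper : ∀ t, K t → W₀ (P₀ + t) = W₀ (P₀ + t + d))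
    (hdel₀ : ∀ t < l, del₀ (P₀ + t) → K t)
    (hdel₁ : ∀ t < l, del₁ (P₁ + (l - 1 - t)) → K t)
    (hd₀ : DividesBlocks d del₀ L₀) (hd₁ : DividesBlocks d del₁ L₁)
    (hP₀' : ¬ del₀ P₀) (hP₁' : ¬ del₁ (P₁ + l))
    (hruns : ∀ A B, A < B → B ≤ l → ¬ K A → ¬ K B → (∀ z, A < z → z < B → K z) →
      Nat.count del₀ (P₀ + B) + Nat.count del₁ (P₁ + (l - B)) =
        Nat.count del₁ (P₁ + (l - A)) + Nat.count del₀ (P₀ + A)) :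
    (((List.Ico P₁ (P₁ + l)).filter fun z => ¬ del₁ z).map W₁).reverse =
      (((List.Ico P₀ (P₀ + l)).filter fun z => ¬ del₀ z).map W₀).map φ := by
  rw [Ico_filter_map_reverse, Ico_filter_map_eq_range, List.map_map]
  have e : ((List.range l).filter fun t => ¬ del₁ (P₁ + (l - 1 - t))).map
        (fun t => W₁ (P₁ + (l - 1 - t))) =
      ((List.range l).filter fun t => ¬ del₁ (P₁ + (l - 1 - t))).map
        fun t => φ (W₀ (P₀ + t)) := by
    refine List.map_congr_left fun t ht => hW t ?_
    exact List.mem_range.mp (List.mem_filter.mp ht).1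
  rw [e]
  symm
  have c₀ : ∀ t, Nat.count (fun t => ¬ del₀ (P₀ + t)) t + (Nat.count del₀ (P₀ + t) -
      Nat.count del₀ P₀) = t := fun t => by
    rw [← count_shift, Nat.add_sub_cancel]; exact count_not_add t
  have c₁ : ∀ t ≤ l, Nat.count (fun t => ¬ del₁ (P₁ + (l - 1 - t))) t +
      (Nat.count del₁ (P₁ + l) - Nat.count del₁ (P₁ + (l - t))) = t := fun t ht => by
    rw [← count_reflect P₁ l t ht, Nat.add_sub_cancel]; exact count_not_add t
  refine map_filter_eq (fun t => φ (W₀ (P₀ + t))) d l K _ _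
    (fun t ht => congrArg φ ((hper t ht).trans (by rw [Nat.add_assoc])))
    (fun t ht hK h => hK (hdel₀ t ht h)) (fun t ht hK h => hK (hdel₁ t ht h)) ?_ hKl ?_ ?_
  · intro t ht hK
    have h := count_eq_of_runs l K (fun t => del₀ (P₀ + t)) (fun t => del₁ (P₁ + (l - 1 - t))) hK0
      (by
        intro A B hAB hB hA' hB' hz
        have := hruns A B hAB hB hA' hB' hz
        have a1 := count_shift (p := del₀) P₀ A
        have a2 := count_shift (p := del₀) P₀ B
        have a3 := count_reflect (p := del₁) P₁ l A (by omega)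
        have a4 := count_reflect (p := del₁) P₁ l B (by omega)
        omega) t ht hK
    have h1 := count_not_add (p := fun t => del₀ (P₀ + t)) t
    have h2 := count_not_add (p := fun t => del₁ (P₁ + (l - 1 - t))) t
    omega
  · intro t ht hp
    exact modEq_of_add_eq (c₀ t)
      (Nat.dvd_sub (hd₀ _ (by omega) hp) (hd₀ _ (by omega) hP₀'))
  · intro t ht hp
    refine modEq_of_add_eq (c₁ t (by omega)) (Nat.dvd_sub (hd₁ _ (by omega) hP₁') ?_)
    -- Read backwards, the deletions before a survivor are those strictly to its right, so the count
    -- starts one position later.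
    have e1 : P₁ + (l - t) = P₁ + (l - 1 - t) + 1 := by omega
    rw [e1, Nat.count_succ, if_neg hp, Nat.add_zero]
    exact hd₁ _ (by omega) hp

end Deletion

/-! ### Iterates of a map on a finite set, and deletion of periods -/

section Finite

/-- By the pigeonhole principle the orbit of `a` becomes periodic within `N` steps, with a period at
most `N`, which divides `N!`. -/
theorem iterate_add_factorial {γ : Type} [Fintype γ] {N : ℕ} (hN : Fintype.card γ ≤ N)
    (f : γ → γ) (a : γ) (k : ℕ) : f^[N + N.factorial * k] a = f^[N] a := by
  obtain ⟨i, j, hij, he⟩ := Fintype.exists_ne_map_eq_of_card_lt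
    (fun i : Fin (N + 1) => f^[i] a) (by simpa using Nat.lt_succ_of_le hN)
  wlog hlt : i < j generalizing i j
  · exact this j i hij.symm he.symm (lt_of_le_of_ne (not_lt.mp hlt) hij.symm)
  have hi : (i : ℕ) < j := hlt
  have hj : (j : ℕ) ≤ N := Nat.lt_succ_iff.mp j.2
  set e := (j : ℕ) - i with hedef
  have hper : ∀ n, (i : ℕ) ≤ n → f^[n + e] a = f^[n] a := by
    intro n hn
    have e1 : n + e = (n - i) + j := by omega
    have e2 : n = (n - i) + i := by omega
    rw [e1, Function.iterate_add_apply, ← he, ← Function.iterate_add_apply, ← e2]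
  have hmul : ∀ q, f^[N + e * q] a = f^[N] a := by
    intro q
    induction q with
    | zero => rfl
    | succ q ih =>
      rw [Nat.mul_succ, ← Nat.add_assoc, hper _ (by have := Nat.zero_le (e * q); omega), ih]
  obtain ⟨q, hq⟩ : e ∣ N.factorial := Nat.dvd_factorial (by omega) (by omega)
  rw [hq, Nat.mul_assoc]
  exact hmul _

variable {α γ : Type} (step : γ → α → γ) (W : ℕ → α)

theorem map_Ico_shift {s e k d : ℕ} (hper : ∀ z, s ≤ z → z + d < e → W z = W (z + d)) {a b : ℕ}
    (ha : s ≤ a) (hb : b + k * d ≤ e) :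
    (List.Ico (a + k * d) (b + k * d)).map W = (List.Ico a b).map W := by
  rw [← List.Ico.map_add, List.map_map]
  refine List.map_congr_left fun z hz => ?_
  rw [List.Ico.mem] at hz
  simp only [Function.comp_apply]
  rw [Nat.add_comm]
  exact eq_of_periodic fun w h1 _ h2 => hper w (by omega) (by omega)

theorem foldl_periodic {s e d : ℕ}
    (hper : ∀ z, s ≤ z → z + d < e → W z = W (z + d)) (n : ℕ) (hn : s + n * d ≤ e) (a : γ) :
    ((List.Ico s (s + n * d)).map W).foldl step a =
      (fun a => ((List.Ico s (s + d)).map W).foldl step a)^[n] a := by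
  induction n with
  | zero => simp
  | succ n ih =>
    have e1 : s + (n + 1) * d = s + d + n * d := by ring
    have e2 : s + (n + 1) * d = s + n * d + d := by ring
    rw [Function.iterate_succ_apply', ← ih (by rw [e2] at hn; omega),
      ← List.Ico.append_consecutive (m := s + n * d) (by omega) (by rw [e2]; omega),
      List.map_append, List.foldl_append, e1, Nat.add_right_comm s d]
    have := map_Ico_shift W (k := n) hper (le_refl s) (b := s + d) (by rw [e1] at hn; exact hn)
    rw [Nat.add_right_comm s d] at this
    rw [this]

/-- Deleting a suitable number of periods does not change the action on a finite set. -/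
theorem foldl_delete_periods [Fintype γ] {N : ℕ} (hN : Fintype.card γ ≤ N) {s e d y : ℕ}
    (hd : 0 < d) (hper : ∀ z, s ≤ z → z + d < e → W z = W (z + d))
    (hlen : 0 < y → y * (N.factorial * d) + N * d ≤ e - s) (a : γ) :
    ((List.Ico (s + y * (N.factorial * d)) e).map W).foldl step a =
      ((List.Ico s e).map W).foldl step a := by
  rcases Nat.eq_zero_or_pos y with rfl | hy
  · simp
  have hl := hlen hy
  have e0 : y * (N.factorial * d) = (N.factorial * y) * d := by ring
  rw [e0] at hl ⊢
  have hpos : 0 < N.factorial * y * d := by positivity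
  have e1 : s + (N + N.factorial * y) * d = s + N * d + N.factorial * y * d := by ring
  -- Both words are cut after `N + N! * y` periods. Before the cut one word has all these periods
  -- and the other only `N`; they lead to the same state, and the tails coincide.
  rw [← List.Ico.append_consecutive (n := s) (m := s + (N + N.factorial * y) * d) (l := e)
      (by omega) (by omega),
    ← List.Ico.append_consecutive (n := s + N.factorial * y * d)
      (m := s + (N + N.factorial * y) * d) (l := e) (by omega) (by omega),
    List.map_append, List.map_append, List.foldl_append, List.foldl_append,
    foldl_periodic step W hper _ (by omega), iterate_add_factorial hN,
    ← foldl_periodic step W hper N (by omega), e1,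
    map_Ico_shift W hper le_rfl (by omega)]

end Finite

/-! ### Deletion schemes on a subdivided interval -/

section Scheme

/-- The length of the part of the run of `x` that lies in the `j`-th segment, at distance at least
`d` from its endpoints. -/
noncomputable def pieceLen (K : ℕ → Prop) (pos : ℕ → ℕ) (d j x : ℕ) : ℕ :=
  min (runEnd K x) (pos (j + 1) - d) - max (runStart K x) (pos j + d)

/-- The data of the number `y j x` of blocks of length `D` to be deleted in the `j`-th segment from
the run of `x`, leaving at least `e` positions of the run in the segment. -/
structure DeletionScheme (d D e : ℕ) where
  m : ℕ
  pos : ℕ → ℕ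
  K : ℕ → Prop
  y : ℕ → ℕ → ℕ
  pos_lt : ∀ j < m, pos j < pos (j + 1)
  K_lt : ∀ z, K z → z < pos m
  y_run : ∀ j x z, K x → runStart K x ≤ z → z < runEnd K x → y j z = y j x
  y_le : ∀ j < m, ∀ x, K x → 0 < y j x → y j x * D + e ≤ pieceLen K pos d j x

theorem pos_le_pos {m : ℕ} {pos : ℕ → ℕ} (h : ∀ j < m, pos j < pos (j + 1)) {j k : ℕ}
    (hjk : j ≤ k) (hk : k ≤ m) : pos j ≤ pos k := by
  induction k, hjk using Nat.le_induction with
  | base => exact le_rfl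
  | succ k _ ih => exact (ih (by omega)).trans (h k (by omega)).le

theorem segment_unique {m : ℕ} {pos : ℕ → ℕ} (h : ∀ j < m, pos j < pos (j + 1)) {j k z : ℕ}
    (hj : j < m) (hk : k < m) (h1 : pos j ≤ z) (h2 : z < pos (j + 1)) (h3 : pos k ≤ z)
    (h4 : z < pos (k + 1)) : j = k := by
  by_contra hne
  rcases lt_or_gt_of_ne hne with hlt | hlt
  · have := pos_le_pos h (Nat.succ_le_of_lt hlt) hk.le
    simp only [Nat.succ_eq_add_one] at this
    omega
  · have := pos_le_pos h (Nat.succ_le_of_lt hlt) hj.le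
    simp only [Nat.succ_eq_add_one] at this
    omega

namespace DeletionScheme

variable {d D e : ℕ} (S : DeletionScheme d D e)

/-- The first position of the run of `x` in the `j`-th segment at distance at least `d` from the
endpoints. -/
noncomputable def pieceStart (j x : ℕ) : ℕ := max (runStart S.K x) (S.pos j + d)

/-- The deleted positions. -/
def Deleted (z : ℕ) : Prop :=
  ∃ j < S.m, S.pos j + d ≤ z ∧ z + d < S.pos (j + 1) ∧ S.K z ∧ z < S.pieceStart j z + S.y j z * D

theorem deleted_iff {j z : ℕ} (hj : j < S.m) (h1 : S.pos j ≤ z) (h2 : z < S.pos (j + 1)) :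
    S.Deleted z ↔ S.pos j + d ≤ z ∧ z + d < S.pos (j + 1) ∧ S.K z ∧
      z < S.pieceStart j z + S.y j z * D := by
  constructor
  · rintro ⟨k, hk, h3, h4, h5⟩
    obtain rfl := segment_unique S.pos_lt hj hk h1 h2 (by omega) (by omega)
    exact ⟨h3, h4, h5⟩
  · exact fun h => ⟨j, hj, h⟩

theorem not_deleted_pos (hd : 0 < d) {j : ℕ} (hj : j ≤ S.m) : ¬ S.Deleted (S.pos j) := by
  rcases hj.eq_or_lt with rfl | hj
  · rintro ⟨k, hk, h3, h4, h5⟩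
    have := pos_le_pos S.pos_lt (Nat.succ_le_of_lt hk) le_rfl
    simp only [Nat.succ_eq_add_one] at this
    omega
  · rw [S.deleted_iff hj le_rfl (S.pos_lt j hj)]
    omega

theorem pieceStart_eq {j x z : ℕ} (hx : S.K x) (h1 : runStart S.K x ≤ z)
    (h2 : z < runEnd S.K x) : S.pieceStart j z = S.pieceStart j x := by
  unfold pieceStart
  rw [(run_eq_of_mem_run S.K_lt hx h1 h2).1]

theorem pieceStart_add_le {j x : ℕ} (hj : j < S.m) (hx : S.K x) (h : 0 < S.y j x) (hD : 0 < D) :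
    S.pieceStart j x + S.y j x * D + e ≤ runEnd S.K x ∧
      S.pieceStart j x + S.y j x * D + e + d ≤ S.pos (j + 1) := by
  have h1 := S.y_le j hj x hx h
  have h2 : 0 < S.y j x * D := Nat.mul_pos h hD
  unfold pieceLen at h1
  unfold pieceStart
  omega

/-- The inequality `y_le` keeps the block inside both the run and the margins of the segment, so a
run loses one initial interval of its part in each segment. -/
theorem mem_run_and_deleted_iff (hD : 0 < D) {j x z : ℕ} (hj : j < S.m) (hx : S.K x)
    (h1 : S.pos j ≤ z) (h2 : z < S.pos (j + 1)) :
    ((runStart S.K x ≤ z ∧ z < runEnd S.K x) ∧ S.Deleted z) ↔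
      S.pieceStart j x ≤ z ∧ z < S.pieceStart j x + S.y j x * D := by
  rw [S.deleted_iff hj h1 h2]
  have hps : S.pieceStart j x = max (runStart S.K x) (S.pos j + d) := rfl
  constructor
  · rintro ⟨⟨h3, h4⟩, h5, h6, h7, h8⟩
    rw [S.pieceStart_eq hx h3 h4, S.y_run j x z hx h3 h4] at h8
    omega
  · rintro ⟨h3, h4⟩
    have hy : 0 < S.y j x := by
      by_contra h0
      have : S.y j x = 0 := by omega
      rw [this] at h4
      omega
    obtain ⟨h5, h6⟩ := S.pieceStart_add_le hj hx hy hD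
    have h7 : runStart S.K x ≤ z := by omega
    have h8 : z < runEnd S.K x := by omega
    refine ⟨⟨h7, h8⟩, by omega, by omega, mem_of_mem_run hx h7 h8, ?_⟩
    rwa [S.pieceStart_eq hx h7 h8, S.y_run j x z hx h7 h8]

open Classical in
theorem count_run (hD : 0 < D) {x s t : ℕ} (hx : S.K x) (hst : s ≤ t) (ht : t ≤ S.m) :
    Nat.count (fun z => (runStart S.K x ≤ z ∧ z < runEnd S.K x) ∧ S.Deleted z) (S.pos t) =
      Nat.count (fun z => (runStart S.K x ≤ z ∧ z < runEnd S.K x) ∧ S.Deleted z) (S.pos s) +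
        (∑ j ∈ Finset.Ico s t, S.y j x) * D := by
  induction t, hst using Nat.le_induction with
  | base => simp
  | succ t hst ih =>
    rw [Finset.sum_Ico_succ_top hst, add_mul, ← Nat.add_assoc, ← ih (by omega)]
    refine count_interval (s := S.pieceStart t x) (S.pos_lt t ht).le (fun h => ?_)
      fun z h1 h2 => S.mem_run_and_deleted_iff hD ht hx h1 h2
    have hps : S.pieceStart t x = max (runStart S.K x) (S.pos t + d) := rfl
    have := S.pieceStart_add_le ht hx (Nat.pos_of_mul_pos_right h) hD
    omega

theorem core_of_deleted {s t z : ℕ} (hst : s ≤ t) (ht : t ≤ S.m) (h1 : S.pos s ≤ z)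
    (h2 : z < S.pos t) (h : S.Deleted z) : S.K z ∧ S.pos s + d ≤ z ∧ z + d < S.pos t := by
  obtain ⟨j, hj, h3, h4, h5, -⟩ := h
  refine ⟨h5, ?_, ?_⟩
  · have : s ≤ j := by
      by_contra hlt
      have := pos_le_pos S.pos_lt (by omega : j + 1 ≤ s) (hst.trans ht)
      omega
    have := pos_le_pos S.pos_lt this hj.le
    omega
  · have : j + 1 ≤ t := by
      by_contra hlt
      have := pos_le_pos S.pos_lt (by omega : t ≤ j) hj.le
      omega
    have := pos_le_pos S.pos_lt this ht
    omega

open Classical in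
/-- The number of deleted positions in a maximal interval of the core of a union of segments. -/
theorem count_deleted_run (hD : 0 < D) {s t a v x : ℕ} (hst : s ≤ t) (ht : t ≤ S.m)
    (hK : ∀ z, a ≤ z → z < v → S.K z ∧ S.pos s + d ≤ z ∧ z + d < S.pos t)
    (ha : ∀ w, w + 1 = a → ¬ (S.K w ∧ S.pos s + d ≤ w ∧ w + d < S.pos t))
    (hv : ¬ (S.K v ∧ S.pos s + d ≤ v ∧ v + d < S.pos t)) (hax : a ≤ x) (hxv : x < v) :
    Nat.count S.Deleted v = Nat.count S.Deleted a + (∑ j ∈ Finset.Ico s t, S.y j x) * D := by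
  have hx := (hK x hax hxv).1
  have hsa := hK a le_rfl (by omega)
  have hvt := hK (v - 1) (by omega) (by omega)
  -- Deleted positions avoid the margins at both ends of the union, so clipping the run to the core
  -- of the union loses none of them.
  have hrun : ∀ z, S.pos s ≤ z → z < S.pos t → S.Deleted z →
      ((runStart S.K x ≤ z ∧ z < runEnd S.K x) ↔ a ≤ z ∧ z < v) := by
    intro z h1 h2 hz
    have hzc := S.core_of_deleted hst ht h1 h2 hz
    constructor
    · rintro ⟨h3, h4⟩
      constructor
      · by_contra hlt
        obtain ⟨w, rfl⟩ : ∃ w, a = w + 1 := ⟨a - 1, by omega⟩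
        exact ha w rfl ⟨mem_of_mem_run hx (by omega)
          (by have := lt_runEnd S.K_lt hx; omega), by omega, by omega⟩
      · by_contra hlt
        exact hv ⟨mem_of_mem_run hx (by have := (runStart_spec hx).1; omega) (by omega),
          by omega, by omega⟩
    · rintro ⟨h3, h4⟩
      constructor
      · by_contra hlt
        exact not_pred_runStart hx (w := runStart S.K x - 1) (by omega)
          (hK _ (by omega) (by have := (runStart_spec hx).1; omega)).1
      · by_contra hlt
        exact (runEnd_spec S.K_lt x).2
          (hK _ (by have := (runEnd_spec S.K_lt x).1; omega) (by omega)).1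
  let p : ℕ → Prop := fun z => (runStart S.K x ≤ z ∧ z < runEnd S.K x) ∧ S.Deleted z
  have h1 : Nat.count p (S.pos t) = Nat.count p (S.pos s) +
      (∑ j ∈ Finset.Ico s t, S.y j x) * D := by
    convert S.count_run hD hx hst ht
  have h2 : Nat.count p a = Nat.count p (S.pos s) := by
    refine count_eq_of_forall_not (by omega) fun z h3 h4 h5 => ?_
    have := (hrun z h3 (by omega) h5.2).mp h5.1
    omega
  have h3 : Nat.count p (S.pos t) = Nat.count p v := by
    refine count_eq_of_forall_not (by omega) fun z h3 h4 h5 => ?_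
    have := (hrun z (by omega) h4 h5.2).mp h5.1
    omega
  have h4 := count_congr (p := p) (q := S.Deleted) (P := a) (Q := v) (by omega) fun z h5 h6 =>
    ⟨fun h => h.2, fun h => ⟨(hrun z (by omega) (by omega) h).mpr ⟨h5, h6⟩, h⟩⟩
  omega

-- Deletions come in complete blocks of length a multiple of `D`, each preceded by a surviving
-- position, from which the induction continues.
open Classical in
theorem dividesBlocks (hd : 0 < d) (hdD : d ∣ D) (hD : 0 < D) :
    DividesBlocks d S.Deleted (S.pos S.m) := by
  intro z
  induction z using Nat.strong_induction_on with
  | _ z ih =>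
    intro hz hdel
    rcases Nat.eq_zero_or_pos z with rfl | hpos
    · simp
    obtain ⟨w, rfl⟩ : ∃ w, z = w + 1 := ⟨z - 1, by omega⟩
    by_cases hw : S.Deleted w
    · obtain ⟨j, hj, h1, h2, h3, h4⟩ := id hw
      have hrs := (runStart_spec h3).1
      have hre := lt_runEnd S.K_lt h3
      have hps : S.pieceStart j w = max (runStart S.K w) (S.pos j + d) := rfl
      have hy : 0 < S.y j w := by
        by_contra h0
        have : S.y j w = 0 := by omega
        rw [this] at h4
        omega
      obtain ⟨h5, h6⟩ := S.pieceStart_add_le hj h3 hy hD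
      have hmem : ∀ z, S.pieceStart j w ≤ z → z < S.pieceStart j w + S.y j w * D →
          S.Deleted z := fun z h7 h8 =>
        ((S.mem_run_and_deleted_iff hD hj h3 (by omega) (by omega)).mpr ⟨h7, h8⟩).2
      -- A survivor right after a deleted position marks the end of a block.
      have hend : w + 1 = S.pieceStart j w + S.y j w * D := by
        by_contra hne
        exact hdel (hmem _ (by omega) (by omega))
      rw [hend, count_add_eq hmem]
      refine Nat.dvd_add ?_ (hdD.mul_left _)
      obtain ⟨u, hu⟩ : ∃ u, S.pieceStart j w = u + 1 := ⟨S.pieceStart j w - 1, by omega⟩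
      have hundel : ¬ S.Deleted u := by
        rw [S.deleted_iff hj (by omega) (by omega)]
        rintro ⟨h7, h8, h9, -⟩
        exact not_pred_runStart h3 (w := u) (by omega) h9
      rw [hu, Nat.count_succ, if_neg hundel, Nat.add_zero]
      exact ih u (by omega) (by omega) hundel
    · rw [Nat.count_succ, if_neg hw, Nat.add_zero]
      exact ih w (by omega) (by omega) hw

open Classical in
/-- Deletion does not change the action of a segment on a finite set. -/
theorem foldl_segment {α γ : Type} [Fintype γ] {N : ℕ} (hN : Fintype.card γ ≤ N)
    (hD : D = N.factorial * d) (he : e = N * d) (hd : 0 < d)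
    (step : γ → α → γ) (W : ℕ → α) (hW : ∀ z, S.K z → W z = W (z + d)) {j : ℕ} (hj : j < S.m)
    (a : γ) :
    (((List.Ico (S.pos j) (S.pos (j + 1))).filter fun z => ¬ S.Deleted z).map W).foldl step a =
      ((List.Ico (S.pos j) (S.pos (j + 1))).map W).foldl step a := by
  have hD0 : 0 < D := by rw [hD]; positivity
  -- The words are compared on initial parts ending outside the core of the segment, so that a piece
  -- of a run is treated as a whole.
  suffices h : ∀ x, S.pos j ≤ x → x ≤ S.pos (j + 1) →
      ¬ (S.K x ∧ S.pos j + d ≤ x ∧ x + d < S.pos (j + 1)) →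
      (((List.Ico (S.pos j) x).filter fun z => ¬ S.Deleted z).map W).foldl step a =
        ((List.Ico (S.pos j) x).map W).foldl step a from
    h _ (S.pos_lt j hj).le le_rfl (by omega)
  have hsingle : ∀ u, S.pos j ≤ u → u < S.pos (j + 1) →
      ¬ (S.K u ∧ S.pos j + d ≤ u ∧ u + d < S.pos (j + 1)) →
      (List.Ico (S.pos j) (u + 1)).filter (fun z => ¬ S.Deleted z) =
        (List.Ico (S.pos j) u).filter (fun z => ¬ S.Deleted z) ++ [u] := by
    intro u h1 h2 h3
    have : ¬ S.Deleted u := by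
      rw [S.deleted_iff hj h1 h2]
      tauto
    rw [List.Ico.succ_top h1, List.filter_append]
    simp [this]
  intro x
  induction x using Nat.strong_induction_on with
  | _ x ih =>
    intro hx1 hx2 hx3
    rcases hx1.eq_or_lt with rfl | hlt
    · simp
    obtain ⟨u, rfl⟩ : ∃ u, x = u + 1 := ⟨x - 1, by omega⟩
    by_cases hu : S.K u ∧ S.pos j + d ≤ u ∧ u + d < S.pos (j + 1)
    · obtain ⟨h1, h2, h3⟩ := hu
      have hrs := (runStart_spec h1).1
      have hre := lt_runEnd S.K_lt h1
      have hps : S.pieceStart j u = max (runStart S.K u) (S.pos j + d) := rfl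
      obtain ⟨w, hw⟩ : ∃ w, S.pieceStart j u = w + 1 := ⟨S.pieceStart j u - 1, by omega⟩
      have hwK : ¬ (S.K w ∧ S.pos j + d ≤ w ∧ w + d < S.pos (j + 1)) := by
        rintro ⟨h7, h8, -⟩
        exact not_pred_runStart h1 (w := w) (by omega) h7
      have hend : u + 1 = runEnd S.K u ∨ u + 1 + d = S.pos (j + 1) := by
        by_contra hne
        push Not at hne
        exact hx3 ⟨mem_of_mem_run h1 (by omega) (by omega), by omega, by omega⟩
      -- The piece of the run is the interval from `w + 1` to `u + 1`, and it loses exactly its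
      -- initial block.
      have hfil : (List.Ico (w + 1) (u + 1)).filter (fun z => ¬ S.Deleted z) =
          List.Ico (w + 1 + S.y j u * D) (u + 1) := by
        rw [← Nat.max_eq_right (Nat.le_add_right (w + 1) (S.y j u * D)), ← List.Ico.filter_le]
        refine List.filter_congr fun z hz => ?_
        rw [List.Ico.mem] at hz
        have := S.mem_run_and_deleted_iff (z := z) hD0 hj h1 (by omega) (by omega)
        have h9 : runStart S.K u ≤ z ∧ z < runEnd S.K u := by omega
        rw [decide_eq_decide]
        have h10 : S.Deleted z ↔ z < w + 1 + S.y j u * D := by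
          rw [hw] at this
          constructor
          · exact fun h => (this.mp ⟨h9, h⟩).2
          · exact fun h => (this.mpr ⟨hz.1, h⟩).2
        rw [h10]
        omega
      have hper : ∀ z, w + 1 ≤ z → z + d < u + 1 → W z = W (z + d) := fun z h4 h5 =>
        hW z (mem_of_mem_run h1 (by omega) (by omega))
      rw [← List.Ico.append_consecutive (n := S.pos j) (m := w + 1) (by omega) (by omega),
        List.filter_append, hsingle w (by omega) (by omega) hwK, hfil,
        List.Ico.succ_top (by omega : S.pos j ≤ w)]
      simp only [List.map_append, List.foldl_append]
      rw [ih w (by omega) (by omega) (by omega) hwK]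
      have hdelete := foldl_delete_periods (y := S.y j u) (e := u + 1) step W hN hd hper
      rw [← hD, ← he] at hdelete
      refine hdelete (fun hy => ?_) _
      have := S.y_le j hj u h1 hy
      unfold pieceLen at this
      omega
    · rw [hsingle u (by omega) (by omega) hu, List.Ico.succ_top (by omega)]
      simp only [List.map_append, List.foldl_append]
      rw [ih u (by omega) (by omega) (by omega) hu]

end DeletionScheme

end Scheme

/-! ### Compatibility of deletion schemes and of the core with bands. -/

section Bands

namespace DeletionScheme

variable {d D e : ℕ} (S₀ S₁ : DeletionScheme d D e)

-- A run that crosses several segments of a base may distribute its blocks differently on the two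
-- sides. Only the total number per run must agree, since inside a run the blocks can be slid by
-- periodicity.
open Classical in
theorem band_translate (hd : 0 < d) (hdD : d ∣ D) (hD : 0 < D) {s₀ t₀ s₁ t₁ l : ℕ}
    (hst₀ : s₀ ≤ t₀) (ht₀ : t₀ ≤ S₀.m) (hst₁ : s₁ ≤ t₁) (ht₁ : t₁ ≤ S₁.m)
    (hl₀ : S₀.pos t₀ = S₀.pos s₀ + l) (hl₁ : S₁.pos t₁ = S₁.pos s₁ + l)
    {α β : Type} (W₀ : ℕ → α) (W₁ : ℕ → β) (φ : α → β)
    (hW : ∀ t < l, W₁ (S₁.pos s₁ + t) = φ (W₀ (S₀.pos s₀ + t)))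
    (hper : ∀ z, S₀.K z → W₀ z = W₀ (z + d))
    (hKK : ∀ t, d ≤ t → t + d < l → (S₀.K (S₀.pos s₀ + t) ↔ S₁.K (S₁.pos s₁ + t)))
    (hy : ∀ t, d ≤ t → t + d < l → S₀.K (S₀.pos s₀ + t) →
      ∑ j ∈ Finset.Ico s₀ t₀, S₀.y j (S₀.pos s₀ + t) =
        ∑ j ∈ Finset.Ico s₁ t₁, S₁.y j (S₁.pos s₁ + t)) :
    ((List.Ico (S₁.pos s₁) (S₁.pos t₁)).filter fun z => ¬ S₁.Deleted z).map W₁ =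
      (((List.Ico (S₀.pos s₀) (S₀.pos t₀)).filter fun z => ¬ S₀.Deleted z).map W₀).map φ := by
  have hdel₀ : ∀ t < l, S₀.Deleted (S₀.pos s₀ + t) →
      d ≤ t ∧ t + d < l ∧ S₀.K (S₀.pos s₀ + t) := fun t ht h => by
    have := S₀.core_of_deleted hst₀ ht₀ (by omega) (by omega) h
    exact ⟨by omega, by omega, this.1⟩
  have hdel₁ : ∀ t < l, S₁.Deleted (S₁.pos s₁ + t) →
      d ≤ t ∧ t + d < l ∧ S₀.K (S₀.pos s₀ + t) := fun t ht h => by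
    have := S₁.core_of_deleted hst₁ ht₁ (by omega) (by omega) h
    exact ⟨by omega, by omega, (hKK t (by omega) (by omega)).mpr this.1⟩
  rw [hl₀, hl₁]
  refine deletion_translate W₀ W₁ φ d l _ _ (S₀.pos S₀.m) (S₁.pos S₁.m)
    (fun t => d ≤ t ∧ t + d < l ∧ S₀.K (S₀.pos s₀ + t)) S₀.Deleted S₁.Deleted
    (by rw [← hl₀]; exact pos_le_pos S₀.pos_lt ht₀ le_rfl)
    (by rw [← hl₁]; exact pos_le_pos S₁.pos_lt ht₁ le_rfl) hW (by omega) (by omega)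
    (fun t ht => hper _ ht.2.2) hdel₀ hdel₁ (S₀.dividesBlocks hd hdD hD)
    (S₁.dividesBlocks hd hdD hD) (S₀.not_deleted_pos hd (hst₀.trans ht₀))
    (S₁.not_deleted_pos hd (hst₁.trans ht₁)) ?_
  intro A B hAB hB hA hB' hz
  have hA₀ : ¬ S₀.Deleted (S₀.pos s₀ + A) := fun h => hA (hdel₀ A (by omega) h)
  have hA₁ : ¬ S₁.Deleted (S₁.pos s₁ + A) := fun h => hA (hdel₁ A (by omega) h)
  have c₀ : Nat.count S₀.Deleted (S₀.pos s₀ + A + 1) = Nat.count S₀.Deleted (S₀.pos s₀ + A) := by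
    rw [Nat.count_succ, if_neg hA₀, Nat.add_zero]
  have c₁ : Nat.count S₁.Deleted (S₁.pos s₁ + A + 1) = Nat.count S₁.Deleted (S₁.pos s₁ + A) := by
    rw [Nat.count_succ, if_neg hA₁, Nat.add_zero]
  -- `A` and `B` are consecutive positions outside the core of the base: either they are adjacent
  -- and nothing is deleted, or the run from `A + 1` to `B` is a maximal interval of the core.
  rcases (Nat.succ_le_of_lt hAB).eq_or_lt with rfl | hlt
  · simp only [Nat.succ_eq_add_one, ← Nat.add_assoc, c₀, c₁]
    omega
  simp only [Nat.succ_eq_add_one] at hlt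
  obtain ⟨x1, x2, x3⟩ := hz (A + 1) (by omega) hlt
  have n₀ := S₀.count_deleted_run hD (a := S₀.pos s₀ + A + 1) (v := S₀.pos s₀ + B)
    (x := S₀.pos s₀ + (A + 1)) hst₀ ht₀
    (fun z h1 h2 => by
      obtain ⟨t, rfl⟩ := Nat.exists_eq_add_of_le (by omega : S₀.pos s₀ ≤ z)
      obtain ⟨h3, h4, h5⟩ := hz t (by omega) (by omega)
      exact ⟨h5, by omega, by omega⟩)
    (fun w h1 => by
      obtain rfl : w = S₀.pos s₀ + A := by omega
      rintro ⟨h3, h4, h5⟩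
      exact hA ⟨by omega, by omega, h3⟩)
    (by
      rintro ⟨h3, h4, h5⟩
      exact hB' ⟨by omega, by omega, h3⟩) (by omega) (by omega)
  have n₁ := S₁.count_deleted_run hD (a := S₁.pos s₁ + A + 1) (v := S₁.pos s₁ + B)
    (x := S₁.pos s₁ + (A + 1)) hst₁ ht₁
    (fun z h1 h2 => by
      obtain ⟨t, rfl⟩ := Nat.exists_eq_add_of_le (by omega : S₁.pos s₁ ≤ z)
      obtain ⟨h3, h4, h5⟩ := hz t (by omega) (by omega)
      exact ⟨(hKK t h3 h4).mp h5, by omega, by omega⟩)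
    (fun w h1 => by
      obtain rfl : w = S₁.pos s₁ + A := by omega
      rintro ⟨h3, h4, h5⟩
      exact hA ⟨by omega, by omega, (hKK A (by omega) (by omega)).mpr h3⟩)
    (by
      rintro ⟨h3, h4, h5⟩
      exact hB' ⟨by omega, by omega, (hKK B (by omega) (by omega)).mpr h3⟩) (by omega) (by omega)
  rw [hy (A + 1) x1 x2 x3] at n₀
  omega

open Classical in
theorem band_reflect (hd : 0 < d) (hdD : d ∣ D) (hD : 0 < D) {s₀ t₀ s₁ t₁ l : ℕ}
    (hst₀ : s₀ ≤ t₀) (ht₀ : t₀ ≤ S₀.m) (hst₁ : s₁ ≤ t₁) (ht₁ : t₁ ≤ S₁.m)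
    (hl₀ : S₀.pos t₀ = S₀.pos s₀ + l) (hl₁ : S₁.pos t₁ = S₁.pos s₁ + l)
    {α β : Type} (W₀ : ℕ → α) (W₁ : ℕ → β) (φ : α → β)
    (hW : ∀ t < l, W₁ (S₁.pos s₁ + (l - 1 - t)) = φ (W₀ (S₀.pos s₀ + t)))
    (hper : ∀ z, S₀.K z → W₀ z = W₀ (z + d))
    (hKK : ∀ t, d ≤ t → t + d < l → (S₀.K (S₀.pos s₀ + t) ↔ S₁.K (S₁.pos s₁ + (l - 1 - t))))
    (hy : ∀ t, d ≤ t → t + d < l → S₀.K (S₀.pos s₀ + t) →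
      ∑ j ∈ Finset.Ico s₀ t₀, S₀.y j (S₀.pos s₀ + t) =
        ∑ j ∈ Finset.Ico s₁ t₁, S₁.y j (S₁.pos s₁ + (l - 1 - t))) :
    (((List.Ico (S₁.pos s₁) (S₁.pos t₁)).filter fun z => ¬ S₁.Deleted z).map W₁).reverse =
      (((List.Ico (S₀.pos s₀) (S₀.pos t₀)).filter fun z => ¬ S₀.Deleted z).map W₀).map φ := by
  have hdel₀ : ∀ t < l, S₀.Deleted (S₀.pos s₀ + t) →
      d ≤ t ∧ t + d < l ∧ S₀.K (S₀.pos s₀ + t) := fun t ht h => by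
    have := S₀.core_of_deleted hst₀ ht₀ (by omega) (by omega) h
    exact ⟨by omega, by omega, this.1⟩
  have hdel₁ : ∀ t < l, S₁.Deleted (S₁.pos s₁ + (l - 1 - t)) →
      d ≤ t ∧ t + d < l ∧ S₀.K (S₀.pos s₀ + t) := fun t ht h => by
    have := S₁.core_of_deleted hst₁ ht₁ (by omega) (by omega) h
    exact ⟨by omega, by omega, (hKK t (by omega) (by omega)).mpr this.1⟩
  have hend₁ : ¬ S₁.Deleted (S₁.pos s₁ + l) := by
    rw [← hl₁]
    exact S₁.not_deleted_pos hd ht₁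
  rw [hl₀, hl₁]
  refine deletion_reflect W₀ W₁ φ d l _ _ (S₀.pos S₀.m) (S₁.pos S₁.m)
    (fun t => d ≤ t ∧ t + d < l ∧ S₀.K (S₀.pos s₀ + t)) S₀.Deleted S₁.Deleted
    (by rw [← hl₀]; exact pos_le_pos S₀.pos_lt ht₀ le_rfl)
    (by rw [← hl₁]; exact pos_le_pos S₁.pos_lt ht₁ le_rfl) hW (by omega) (by omega)
    (fun t ht => hper _ ht.2.2) hdel₀ hdel₁ (S₀.dividesBlocks hd hdD hD)
    (S₁.dividesBlocks hd hdD hD) (S₀.not_deleted_pos hd (hst₀.trans ht₀))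
    hend₁ ?_
  intro A B hAB hB hA hB' hz
  have hA₀ : ¬ S₀.Deleted (S₀.pos s₀ + A) := fun h => hA (hdel₀ A (by omega) h)
  have hA₁ : ¬ S₁.Deleted (S₁.pos s₁ + (l - 1 - A)) := fun h => hA (hdel₁ A (by omega) h)
  have c₀ : Nat.count S₀.Deleted (S₀.pos s₀ + A + 1) = Nat.count S₀.Deleted (S₀.pos s₀ + A) := by
    rw [Nat.count_succ, if_neg hA₀, Nat.add_zero]
  have c₁ : Nat.count S₁.Deleted (S₁.pos s₁ + (l - A)) =
      Nat.count S₁.Deleted (S₁.pos s₁ + (l - 1 - A)) := by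
    rw [show S₁.pos s₁ + (l - A) = S₁.pos s₁ + (l - 1 - A) + 1 by omega, Nat.count_succ,
      if_neg hA₁, Nat.add_zero]
  rw [c₁]
  rcases (Nat.succ_le_of_lt hAB).eq_or_lt with rfl | hlt
  · simp only [Nat.succ_eq_add_one, ← Nat.add_assoc, c₀]
    rw [show l - (A + 1) = l - 1 - A by omega]
    omega
  simp only [Nat.succ_eq_add_one] at hlt
  obtain ⟨x1, x2, x3⟩ := hz (A + 1) (by omega) hlt
  have n₀ := S₀.count_deleted_run hD (a := S₀.pos s₀ + A + 1) (v := S₀.pos s₀ + B)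
    (x := S₀.pos s₀ + (A + 1)) hst₀ ht₀
    (fun z h1 h2 => by
      obtain ⟨t, rfl⟩ := Nat.exists_eq_add_of_le (by omega : S₀.pos s₀ ≤ z)
      obtain ⟨h3, h4, h5⟩ := hz t (by omega) (by omega)
      exact ⟨h5, by omega, by omega⟩)
    (fun w h1 => by
      obtain rfl : w = S₀.pos s₀ + A := by omega
      rintro ⟨h3, h4, h5⟩
      exact hA ⟨by omega, by omega, h3⟩)
    (by
      rintro ⟨h3, h4, h5⟩
      exact hB' ⟨by omega, by omega, h3⟩) (by omega) (by omega)
  -- The reflection `t ↦ l - 1 - t` sends the half-open interval from `A + 1` to `B` onto the one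
  -- from `l - B` to `l - 1 - A`.
  have n₁ := S₁.count_deleted_run hD (a := S₁.pos s₁ + (l - B)) (v := S₁.pos s₁ + (l - 1 - A))
    (x := S₁.pos s₁ + (l - 1 - (A + 1))) hst₁ ht₁
    (fun z h1 h2 => by
      obtain ⟨t, ht, rfl⟩ : ∃ t < l, z = S₁.pos s₁ + (l - 1 - t) :=
        ⟨S₁.pos s₁ + l - 1 - z, by omega, by omega⟩
      obtain ⟨h3, h4, h5⟩ := hz t (by omega) (by omega)
      exact ⟨(hKK t h3 h4).mp h5, by omega, by omega⟩)
    (fun w h1 => by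
      rintro ⟨h3, h4, h5⟩
      obtain rfl : w = S₁.pos s₁ + (l - 1 - B) := by omega
      exact hB' ⟨by omega, by omega, (hKK B (by omega) (by omega)).mpr h3⟩)
    (by
      rintro ⟨h3, h4, h5⟩
      exact hA ⟨by omega, by omega, (hKK A (by omega) (by omega)).mpr h3⟩) (by omega) (by omega)
  rw [hy (A + 1) x1 x2 x3] at n₀
  omega

end DeletionScheme

/-- The positions of a word of length `L` in whose neighbourhood of radius `d` the word has
period `d`. -/
def Core {α : Type} (W : ℕ → α) (L d x : ℕ) : Prop :=
  d ≤ x ∧ x + d < L ∧ ∀ z, x ≤ z + d → z ≤ x → W z = W (z + d)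

/-- The core at a position depends only on letters at distance at most `d`, all inside the base
here, and an injective letter map preserves and reflects their equalities. This is why twisting does
no harm. -/
theorem core_translate {α β : Type} {W₀ : ℕ → α} {W₁ : ℕ → β} {φ : α → β}
    (hφ : Function.Injective φ) {d l P₀ P₁ L₀ L₁ : ℕ} (h₀ : P₀ + l ≤ L₀) (h₁ : P₁ + l ≤ L₁)
    (hW : ∀ t < l, W₁ (P₁ + t) = φ (W₀ (P₀ + t))) {t : ℕ} (h1 : d ≤ t) (h2 : t + d < l) :
    Core W₀ L₀ d (P₀ + t) ↔ Core W₁ L₁ d (P₁ + t) := by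
  unfold Core
  have key : (∀ z, P₀ + t ≤ z + d → z ≤ P₀ + t → W₀ z = W₀ (z + d)) ↔
      ∀ z, P₁ + t ≤ z + d → z ≤ P₁ + t → W₁ z = W₁ (z + d) := by
    constructor
    · intro h z h3 h4
      obtain ⟨u, rfl⟩ := Nat.exists_eq_add_of_le (by omega : P₁ ≤ z)
      rw [Nat.add_assoc, hW u (by omega), hW (u + d) (by omega), h _ (by omega) (by omega),
        Nat.add_assoc]
    · intro h z h3 h4
      obtain ⟨u, rfl⟩ := Nat.exists_eq_add_of_le (by omega : P₀ ≤ z)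
      apply hφ
      rw [Nat.add_assoc, ← hW u (by omega), ← hW (u + d) (by omega), h _ (by omega) (by omega),
        Nat.add_assoc]
  rw [key]
  constructor <;> rintro ⟨-, -, h⟩ <;> exact ⟨by omega, by omega, h⟩

/-- The window of radius `d` in `Core` is symmetric about the position, so reversal preserves it. -/
theorem core_reflect {α β : Type} {W₀ : ℕ → α} {W₁ : ℕ → β} {φ : α → β}
    (hφ : Function.Injective φ) {d l P₀ P₁ L₀ L₁ : ℕ} (h₀ : P₀ + l ≤ L₀) (h₁ : P₁ + l ≤ L₁)
    (hW : ∀ t < l, W₁ (P₁ + (l - 1 - t)) = φ (W₀ (P₀ + t))) {t : ℕ} (h1 : d ≤ t)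
    (h2 : t + d < l) :
    Core W₀ L₀ d (P₀ + t) ↔ Core W₁ L₁ d (P₁ + (l - 1 - t)) := by
  unfold Core
  have key : (∀ z, P₀ + t ≤ z + d → z ≤ P₀ + t → W₀ z = W₀ (z + d)) ↔
      ∀ z, P₁ + (l - 1 - t) ≤ z + d → z ≤ P₁ + (l - 1 - t) → W₁ z = W₁ (z + d) := by
    constructor
    · intro h z h3 h4
      obtain ⟨u, hu, rfl⟩ : ∃ u < l, z = P₁ + (l - 1 - u) :=
        ⟨P₁ + l - 1 - z, by omega, by omega⟩
      have e : P₁ + (l - 1 - u) + d = P₁ + (l - 1 - (u - d)) := by omega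
      have e2 : P₀ + (u - d) + d = P₀ + u := by omega
      rw [e, hW u (by omega), hW (u - d) (by omega), h (P₀ + (u - d)) (by omega) (by omega), e2]
    · intro h z h3 h4
      obtain ⟨u, rfl⟩ := Nat.exists_eq_add_of_le (by omega : P₀ ≤ z)
      apply hφ
      have e2 : P₁ + (l - 1 - (u + d)) + d = P₁ + (l - 1 - u) := by omega
      rw [Nat.add_assoc, ← hW u (by omega), ← hW (u + d) (by omega),
        h (P₁ + (l - 1 - (u + d))) (by omega) (by omega), e2]
  rw [key]
  constructor <;> rintro ⟨-, -, h⟩ <;> exact ⟨by omega, by omega, h⟩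

end Bands

/-! ### Existence of a family of deletions compatible with the bands -/

/-- Subdivided intervals, a set of positions on each of them, and partial isometries between unions
of segments that preserve these sets away from the endpoints. -/
structure RunSystem where
  c : ℕ
  m : Fin c → ℕ
  pos : Fin c → ℕ → ℕ
  K : Fin c → ℕ → Prop
  d : ℕ
  d_pos : 0 < d
  pos_zero : ∀ i, pos i 0 = 0
  pos_lt : ∀ i, ∀ j < m i, pos i j < pos i (j + 1)
  K_spec : ∀ i x, K i x → d ≤ x ∧ x + d < pos i (m i)
  β : Type
  i₀ : β → Fin c
  s₀ : β → ℕ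
  t₀ : β → ℕ
  i₁ : β → Fin c
  s₁ : β → ℕ
  t₁ : β → ℕ
  l : β → ℕ
  flip : β → Bool
  st₀ : ∀ b, s₀ b < t₀ b
  t₀_le : ∀ b, t₀ b ≤ m (i₀ b)
  st₁ : ∀ b, s₁ b < t₁ b
  t₁_le : ∀ b, t₁ b ≤ m (i₁ b)
  pos_t₀ : ∀ b, pos (i₀ b) (t₀ b) = pos (i₀ b) (s₀ b) + l b
  pos_t₁ : ∀ b, pos (i₁ b) (t₁ b) = pos (i₁ b) (s₁ b) + l b
  K_band : ∀ b t, d ≤ t → t + d < l b → (K (i₀ b) (pos (i₀ b) (s₀ b) + t) ↔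
    K (i₁ b) (pos (i₁ b) (s₁ b) + if flip b then l b - 1 - t else t))

/-! ### Clipping, reflecting and cutting runs. -/

section Restriction

/-- The run of a point in the core of a subinterval. -/
theorem run_restrict {K : ℕ → Prop} {L d P l t : ℕ} (hL : ∀ z, K z → z < L) (h1 : d ≤ t)
    (h2 : t + d < l) (h3 : K (P + t)) :
    P + runStart (fun t => d ≤ t ∧ t + d < l ∧ K (P + t)) t = max (runStart K (P + t)) (P + d) ∧
    P + runEnd (fun t => d ≤ t ∧ t + d < l ∧ K (P + t)) t = min (runEnd K (P + t)) (P + l - d) := by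
  have hrs := (runStart_spec h3).1
  have hre := lt_runEnd hL h3
  have := run_unique (K := fun t => d ≤ t ∧ t + d < l ∧ K (P + t)) (x := t)
    (A := max (runStart K (P + t)) (P + d) - P) (B := min (runEnd K (P + t)) (P + l - d) - P)
    (by omega) (by omega)
    (fun z h4 h5 => ⟨by omega, by omega, mem_of_mem_run h3 (by omega) (by omega)⟩)
    (fun w hw h => by
      obtain ⟨h4, h5, h6⟩ := h
      exact not_pred_runStart h3 (w := P + w) (by omega) h6)
    (fun h => by
      obtain ⟨h4, h5, h6⟩ := h
      have e : P + (min (runEnd K (P + t)) (P + l - d) - P) = runEnd K (P + t) := by omega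
      rw [e] at h6
      exact (runEnd_spec hL _).2 h6)
  omega

/-- Reflection exchanges the two ends of a run; since runs are half-open, matching ends add up to
`l` and not to `l - 1`. -/
theorem run_reflect {K K' : ℕ → Prop} {l t : ℕ} (hK : ∀ z, K z → z < l) (hK' : ∀ z, K' z → z < l)
    (h : ∀ z < l, K z ↔ K' (l - 1 - z)) (ht : K t) :
    runStart K' (l - 1 - t) + runEnd K t = l ∧ runEnd K' (l - 1 - t) + runStart K t = l := by
  have htl := hK t ht
  have hrs := (runStart_spec ht).1
  have hre := lt_runEnd hK ht
  have hrl : runEnd K t ≤ l := by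
    have := hK _ (mem_of_mem_run ht (z := runEnd K t - 1) (by omega) (by omega))
    omega
  have := run_unique (K := K') (x := l - 1 - t) (A := l - runEnd K t) (B := l - runStart K t)
    (by omega) (by omega)
    (fun z h4 h5 => by
      have e : z = l - 1 - (l - 1 - z) := by omega
      rw [e]
      exact (h _ (by omega)).mp (mem_of_mem_run ht (by omega) (by omega)))
    (fun w hw h' => by
      have e : w = l - 1 - runEnd K t := by omega
      rw [e] at h'
      exact (runEnd_spec hK t).2 ((h _ (by omega)).mpr h'))
    (fun h' => by
      have hlt := hK' _ h'
      have e : l - runStart K t = l - 1 - (runStart K t - 1) := by omega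
      rw [e] at h'
      exact not_pred_runStart ht (w := runStart K t - 1) (by omega) ((h _ (by omega)).mpr h'))
  omega

/-- Cutting at an inner vertex loses at most the two margins of width `d` around it. -/
theorem sum_piece_bounds {m : ℕ} {pos : ℕ → ℕ} (hpos : ∀ j < m, pos j < pos (j + 1)) (A B d : ℕ)
    {s t : ℕ} (hst : s < t) (ht : t ≤ m) :
    (∑ j ∈ Finset.Ico s t, (min B (pos (j + 1) - d) - max A (pos j + d)) ≤
      min B (pos t - d) - max A (pos s + d)) ∧
    min B (pos t - d) - max A (pos s + d) ≤
      (∑ j ∈ Finset.Ico s t, (min B (pos (j + 1) - d) - max A (pos j + d))) + 2 * d * (t - s) := by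
  induction t, Nat.succ_le_of_lt hst using Nat.le_induction with
  | base => simp
  | succ t hst ih =>
    rw [Finset.sum_Ico_succ_top (by omega)]
    obtain ⟨h1, h2⟩ := ih (by omega) (by omega)
    have h3 := hpos t (by omega)
    have h4 := pos_le_pos hpos (by omega : s ≤ t) (by omega)
    have h5 : 2 * d * (t + 1 - s) = 2 * d * (t - s) + 2 * d := by
      rw [Nat.sub_add_comm (by omega)]; ring
    rw [h5]
    constructor <;> omega

end Restriction

/-! ### Runs and bases: lengths, free runs, boundary runs. -/

namespace RunSystem

variable (R : RunSystem)

/-- The reparametrisation of a base by the other one. -/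
def turn (b : R.β) (t : ℕ) : ℕ := if R.flip b then R.l b - 1 - t else t

/-- The position with coordinate `t` in the first base of the band. -/
def x₀ (b : R.β) (t : ℕ) : ℕ := R.pos (R.i₀ b) (R.s₀ b) + t

/-- The position of the second base matched to the coordinate `t` of the first base. -/
def x₁ (b : R.β) (t : ℕ) : ℕ := R.pos (R.i₁ b) (R.s₁ b) + R.turn b t

theorem x₁_of_not_flip {b : R.β} (t : ℕ) (h : R.flip b = false) :
    R.x₁ b t = R.pos (R.i₁ b) (R.s₁ b) + t := by
  simp [x₁, turn, h]

theorem x₁_of_flip {b : R.β} (t : ℕ) (h : R.flip b = true) :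
    R.x₁ b t = R.pos (R.i₁ b) (R.s₁ b) + (R.l b - 1 - t) := by
  simp [x₁, turn, h]

/-- The coordinate lies in the core of the base. -/
def OnBand (b : R.β) (t : ℕ) : Prop := R.d ≤ t ∧ t + R.d < R.l b ∧ R.K (R.i₀ b) (R.x₀ b t)

theorem K_lt (i : Fin R.c) (z : ℕ) (h : R.K i z) : z < R.pos i (R.m i) := by
  have := R.K_spec i z h; omega

/-- The length of the run of `x`. -/
noncomputable def runLen (i : Fin R.c) (x : ℕ) : ℕ := runEnd (R.K i) x - runStart (R.K i) x

/-- The run of `x` is not contained in the interior of the core of a segment. -/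
def Boundary (i : Fin R.c) (x : ℕ) : Prop :=
  ¬ ∃ j < R.m i, R.pos i j + R.d < runStart (R.K i) x ∧ runEnd (R.K i) x + R.d < R.pos i (j + 1)

/-- The length of the part of the run of `x` in the core of the union of the segments
from `s` to `t`. -/
noncomputable def baseLen (i : Fin R.c) (s t x : ℕ) : ℕ :=
  min (runEnd (R.K i) x) (R.pos i t - R.d) - max (runStart (R.K i) x) (R.pos i s + R.d)

/-- The run of `x` lies in the interior of the core of the union of the segments
from `s` to `t`. -/
def Free (i : Fin R.c) (s t x : ℕ) : Prop :=
  R.pos i s + R.d < runStart (R.K i) x ∧ runEnd (R.K i) x + R.d < R.pos i t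

theorem K_x₁ {b : R.β} {t : ℕ} (h : R.OnBand b t) : R.K (R.i₁ b) (R.x₁ b t) :=
  (R.K_band b t h.1 h.2.1).mp h.2.2

/-- The band sees only the runs clipped to the cores of its bases, and matches these. The strict
inequalities in `Free` make freeness visible on the clipped run: it touches neither end of the core.
-/
theorem base_match {b : R.β} {t : ℕ} (h : R.OnBand b t) :
    R.baseLen (R.i₁ b) (R.s₁ b) (R.t₁ b) (R.x₁ b t) =
      R.baseLen (R.i₀ b) (R.s₀ b) (R.t₀ b) (R.x₀ b t) ∧
    (R.Free (R.i₁ b) (R.s₁ b) (R.t₁ b) (R.x₁ b t) ↔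
      R.Free (R.i₀ b) (R.s₀ b) (R.t₀ b) (R.x₀ b t)) := by
  obtain ⟨h1, h2, h3⟩ := h
  have h4 : R.K (R.i₁ b) (R.x₁ b t) := R.K_x₁ ⟨h1, h2, h3⟩
  have ht : R.d ≤ R.turn b t ∧ R.turn b t + R.d < R.l b := by
    unfold turn; split_ifs <;> omega
  have r₀ := run_restrict (R.K_lt (R.i₀ b)) h1 h2 h3
  have r₁ := run_restrict (R.K_lt (R.i₁ b)) ht.1 ht.2 h4
  have hs₀ := runStart_spec h3
  have hs₁ := runStart_spec h4
  have he₀ := lt_runEnd (R.K_lt _) h3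
  have he₁ := lt_runEnd (R.K_lt _) h4
  set K₀ := fun t => R.d ≤ t ∧ t + R.d < R.l b ∧ R.K (R.i₀ b) (R.pos (R.i₀ b) (R.s₀ b) + t)
    with hK₀
  set K₁ := fun t => R.d ≤ t ∧ t + R.d < R.l b ∧ R.K (R.i₁ b) (R.pos (R.i₁ b) (R.s₁ b) + t)
    with hK₁
  have hrun : (runStart K₁ (R.turn b t) = runStart K₀ t ∧ runEnd K₁ (R.turn b t) = runEnd K₀ t) ∨
      (runStart K₁ (R.turn b t) + runEnd K₀ t = R.l b ∧
        runEnd K₁ (R.turn b t) + runStart K₀ t = R.l b) := by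
    cases hf : R.flip b with
    | false =>
      left
      have e : K₁ = K₀ := by
        funext z
        have := R.K_band b z
        simp only [hf, Bool.false_eq_true, if_false] at this
        apply propext
        simp only [hK₀, hK₁]
        constructor
        · rintro ⟨h5, h6, h7⟩; exact ⟨h5, h6, (this h5 h6).mpr h7⟩
        · rintro ⟨h5, h6, h7⟩; exact ⟨h5, h6, (this h5 h6).mp h7⟩
      have e2 : R.turn b t = t := by simp [turn, hf]
      rw [e, e2]
      exact ⟨rfl, rfl⟩
    | true =>
      right
      have e2 : R.turn b t = R.l b - 1 - t := by simp [turn, hf]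
      rw [e2]
      refine run_reflect (fun z hz => by have := hz.2.1; omega)
        (fun z hz => by have := hz.2.1; omega) (fun z hz => ?_) ⟨h1, h2, h3⟩
      have := R.K_band b z
      simp only [hf, if_true] at this
      simp only [hK₀, hK₁]
      constructor
      · rintro ⟨h5, h6, h7⟩; exact ⟨by omega, by omega, (this h5 h6).mp h7⟩
      · rintro ⟨h5, h6, h7⟩; exact ⟨by omega, by omega, (this (by omega) (by omega)).mpr h7⟩
  have p₀ := R.pos_t₀ b
  have p₁ := R.pos_t₁ b
  unfold baseLen Free
  unfold x₀ at *
  unfold x₁ at *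
  constructor
  · rcases hrun with ⟨h5, h6⟩ | ⟨h5, h6⟩ <;> omega
  · rcases hrun with ⟨h5, h6⟩ | ⟨h5, h6⟩ <;> omega

theorem baseLen_of_free {i : Fin R.c} {s t x : ℕ} (h : R.Free i s t x) :
    R.baseLen i s t x = R.runLen i x := by
  unfold Free at h
  unfold baseLen runLen
  omega

theorem baseLen_univ {i : Fin R.c} {x : ℕ} (hx : R.K i x) :
    R.baseLen i 0 (R.m i) x = R.runLen i x := by
  have h1 := runStart_spec hx
  have h2 := R.K_spec i _ (h1.2 _ le_rfl h1.1)
  have h3 := lt_runEnd (R.K_lt i) hx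
  have h4 := R.K_spec i _ (mem_of_mem_run hx (z := runEnd (R.K i) x - 1) (by omega) (by omega))
  unfold baseLen runLen
  rw [R.pos_zero]
  omega

/-- A run of a base that is not free is a boundary run. -/
theorem boundary_of_not_free {i : Fin R.c} {s t x : ℕ} (ht : t ≤ R.m i) (hst : s < t)
    (hx : R.K i x) (h1 : R.pos i s + R.d ≤ x) (h2 : x + R.d < R.pos i t)
    (h : ¬ R.Free i s t x) : R.Boundary i x := by
  rintro ⟨j, hj, h3, h4⟩
  refine h ?_
  have h5 := (runStart_spec hx).1
  have h6 := lt_runEnd (R.K_lt i) hx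
  have h7 : s ≤ j := by
    by_contra hlt
    have := pos_le_pos (R.pos_lt i) (by omega : j + 1 ≤ s) (by omega)
    omega
  have h8 : j + 1 ≤ t := by
    by_contra hlt
    have := pos_le_pos (R.pos_lt i) (by omega : t ≤ j) (by omega)
    omega
  have h9 := pos_le_pos (R.pos_lt i) h7 (by omega)
  have h10 := pos_le_pos (R.pos_lt i) h8 ht
  exact ⟨by omega, by omega⟩

/-! ### Classes of runs under the bands. -/

/-- Points in the same run, or matched by a band in free runs. -/
inductive Adj : Fin R.c × ℕ → Fin R.c × ℕ → Prop
  | run {i : Fin R.c} {x z : ℕ} (hx : R.K i x) (h1 : runStart (R.K i) x ≤ z)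
      (h2 : z < runEnd (R.K i) x) : Adj (i, x) (i, z)
  | band {b : R.β} {t : ℕ} (h : R.OnBand b t)
      (hf : R.Free (R.i₀ b) (R.s₀ b) (R.t₀ b) (R.x₀ b t)) :
      Adj (R.i₀ b, R.x₀ b t) (R.i₁ b, R.x₁ b t)

theorem adj_invariant {p q : Fin R.c × ℕ} (h : R.Adj p q) :
    R.K p.1 p.2 ∧ R.K q.1 q.2 ∧ R.runLen p.1 p.2 = R.runLen q.1 q.2 := by
  cases h with
  | run hx h1 h2 =>
    refine ⟨hx, mem_of_mem_run hx h1 h2, ?_⟩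
    obtain ⟨h3, h4⟩ := run_eq_of_mem_run (R.K_lt _) hx h1 h2
    simp only [runLen, h3, h4]
  | band h hf =>
    obtain ⟨h1, h2⟩ := R.base_match h
    refine ⟨h.2.2, R.K_x₁ h, ?_⟩
    rw [R.baseLen_of_free hf, R.baseLen_of_free (h2.mpr hf)] at h1
    exact h1.symm

/-- Length is an invariant of the class, so a number of blocks that fits in one run of a class fits
in all of them. -/
theorem eqvGen_invariant {p q : Fin R.c × ℕ} (h : Relation.EqvGen R.Adj p q) :
    (R.K p.1 p.2 ↔ R.K q.1 q.2) ∧ R.runLen p.1 p.2 = R.runLen q.1 q.2 := by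
  induction h with
  | rel p q h =>
    obtain ⟨h1, h2, h3⟩ := R.adj_invariant h
    exact ⟨⟨fun _ => h2, fun _ => h1⟩, h3⟩
  | refl p => exact ⟨Iff.rfl, rfl⟩
  | symm p q _ ih => exact ⟨ih.1.symm, ih.2.symm⟩
  | trans p q r _ _ ih1 ih2 => exact ⟨ih1.1.trans ih2.1, ih1.2.trans ih2.2⟩

/-! ### The unknowns and the linear equations. -/

/-- The parts of the boundary runs in the cores of the segments: component, segment, and start of
the run. -/
def Piece : Type :=
  {w : Fin R.c × ℕ × ℕ // w.2.1 < R.m w.1 ∧ R.K w.1 w.2.2 ∧ runStart (R.K w.1) w.2.2 = w.2.2 ∧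
    R.Boundary w.1 w.2.2 ∧ 0 < pieceLen (R.K w.1) (R.pos w.1) R.d w.2.1 w.2.2}

theorem run_congr {i : Fin R.c} {x z w : ℕ} (hx : R.K i x) (hz : R.K i z)
    (h1 : runStart (R.K i) x ≤ w) (h2 : w < runEnd (R.K i) x)
    (h3 : runStart (R.K i) z ≤ w) (h4 : w < runEnd (R.K i) z) :
    runStart (R.K i) x = runStart (R.K i) z :=
  (run_eq_of_mem_run (R.K_lt i) hx h1 h2).1.symm.trans (run_eq_of_mem_run (R.K_lt i) hz h3 h4).1

/-- A segment meets at most two boundary runs in its core. -/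
def pieceSide (w : R.Piece) : (Σ i, Fin (R.m i)) × Prop :=
  (⟨w.1.1, ⟨w.1.2.1, w.2.1⟩⟩, w.1.2.2 ≤ R.pos w.1.1 w.1.2.1 + R.d)

/-- A boundary run meeting the core of a segment contains the first or the last position of that
core, and two runs sharing a position coincide. -/
theorem pieceSide_injective : Function.Injective R.pieceSide := by
  rintro ⟨⟨i, j, a⟩, h1, h2, h3, h4, h5⟩ ⟨⟨i', j', a'⟩, h1', h2', h3', h4', h5'⟩ h
  simp only [pieceSide, Prod.mk.injEq, Sigma.mk.injEq] at h
  obtain ⟨⟨rfl, hj⟩, hs⟩ := h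
  simp only [heq_eq_eq, Fin.mk.injEq] at hj
  subst hj
  simp only at h1 h2 h3 h4 h5 h1' h2' h3' h4' h5'
  unfold pieceLen at h5 h5'
  have key : a = a' := by
    by_cases hle : a ≤ R.pos i j + R.d
    · have hle' : a' ≤ R.pos i j + R.d := hs ▸ hle
      rw [← h3, ← h3']
      exact R.run_congr h2 h2' (w := R.pos i j + R.d) (by omega) (by omega) (by omega) (by omega)
    · have hle' : ¬ a' ≤ R.pos i j + R.d := hs ▸ hle
      have hb : ¬ (runEnd (R.K i) a + R.d < R.pos i (j + 1)) := fun h =>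
        h4 ⟨j, h1, by omega, h⟩
      have hb' : ¬ (runEnd (R.K i) a' + R.d < R.pos i (j + 1)) := fun h =>
        h4' ⟨j, h1, by omega, h⟩
      rw [← h3, ← h3']
      exact R.run_congr h2 h2' (w := R.pos i (j + 1) - R.d - 1) (by omega) (by omega) (by omega)
        (by omega)
  subst key
  rfl

/-- The number of segments. -/
def numSegs : ℕ := ∑ i, R.m i

open Classical in
noncomputable instance : Fintype R.Piece := Fintype.ofInjective _ R.pieceSide_injective

/-- The number of unknowns is bounded by the complex alone, not by the solution. -/
theorem card_piece_le : Fintype.card R.Piece ≤ 2 * R.numSegs := by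
  classical
  refine (Fintype.card_le_of_injective _ R.pieceSide_injective).trans ?_
  rw [Fintype.card_prod, Fintype.card_sigma, Fintype.card_prop]
  simp only [Fintype.card_fin, numSegs]
  omega

theorem m_le (i : Fin R.c) : R.m i ≤ R.numSegs :=
  Finset.single_le_sum (f := R.m) (fun _ _ => Nat.zero_le _) (Finset.mem_univ i)

open Classical in
/-- The pieces of the run of `x` in the segments from `s` to `t`. -/
noncomputable def pieces (i : Fin R.c) (s t x : ℕ) : Finset R.Piece :=
  Finset.univ.filter fun w => (w.1.1 = i ∧ w.1.2.2 = runStart (R.K i) x) ∧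
    s ≤ w.1.2.1 ∧ w.1.2.1 < t

open Classical in
/-- The value of a function on the piece of the run of `x` in the `j`-th segment. -/
noncomputable def pieceVal (g : R.Piece → ℕ) (i : Fin R.c) (j x : ℕ) : ℕ :=
  ∑ w : R.Piece with (w.1.1 = i ∧ w.1.2.2 = runStart (R.K i) x) ∧ w.1.2.1 = j, g w

theorem sum_pieces (g : R.Piece → ℕ) (i : Fin R.c) (s t x : ℕ) :
    ∑ w ∈ R.pieces i s t x, g w = ∑ j ∈ Finset.Ico s t, R.pieceVal g i j x := by
  classical
  rw [← Finset.sum_fiberwise_of_maps_to (g := fun w : R.Piece => w.1.2.1) (t := Finset.Ico s t)]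
  · refine Finset.sum_congr rfl fun j hj => ?_
    rw [Finset.mem_Ico] at hj
    unfold pieceVal pieces
    rw [Finset.filter_filter]
    refine Finset.sum_congr (Finset.filter_congr fun w _ => ?_) fun _ _ => rfl
    constructor
    · rintro ⟨⟨h1, h2⟩, h3⟩; exact ⟨h1, h3⟩
    · rintro ⟨h1, rfl⟩; exact ⟨⟨h1, hj⟩, rfl⟩
  · intro w hw
    simp only [pieces, Finset.mem_filter] at hw
    exact Finset.mem_Ico.mpr hw.2.2

theorem pieceVal_self (g : R.Piece → ℕ) (w : R.Piece) {x : ℕ}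
    (hx : w.1.2.2 = runStart (R.K w.1.1) x) : R.pieceVal g w.1.1 w.1.2.1 x = g w := by
  classical
  unfold pieceVal
  rw [Finset.sum_eq_single_of_mem w]
  · simp [hx]
  · intro w' hw' hne
    refine absurd ?_ hne
    simp only [Finset.mem_filter, Finset.mem_univ, true_and] at hw'
    obtain ⟨⟨h1, h2⟩, h3⟩ := hw'
    exact Subtype.ext (Prod.ext h1 (Prod.ext h3 (h2.trans hx.symm)))

theorem pieceVal_pos {g : R.Piece → ℕ} {i : Fin R.c} {j x : ℕ} (h : 0 < R.pieceVal g i j x) :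
    ∃ w : R.Piece, w.1.1 = i ∧ w.1.2.1 = j ∧ w.1.2.2 = runStart (R.K i) x ∧
      R.pieceVal g i j x = g w := by
  classical
  obtain ⟨w, hw, -⟩ := Finset.exists_ne_zero_of_sum_ne_zero h.ne'
  simp only [Finset.mem_filter, Finset.mem_univ, true_and] at hw
  obtain ⟨⟨rfl, h2⟩, rfl⟩ := hw
  exact ⟨w, rfl, rfl, h2, R.pieceVal_self g w h2⟩

theorem run_runStart {i : Fin R.c} {x : ℕ} (hx : R.K i x) :
    runStart (R.K i) (runStart (R.K i) x) = runStart (R.K i) x ∧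
    runEnd (R.K i) (runStart (R.K i) x) = runEnd (R.K i) x :=
  run_eq_of_mem_run (R.K_lt i) hx le_rfl
    ((runStart_spec hx).1.trans_lt (lt_runEnd (R.K_lt i) hx))

/-- The length of a piece. -/
noncomputable def len (w : R.Piece) : ℕ :=
  pieceLen (R.K w.1.1) (R.pos w.1.1) R.d w.1.2.1 w.1.2.2

/-- The piece of a boundary run in a segment whose core it meets. -/
theorem exists_piece {i : Fin R.c} {j x : ℕ} (hx : R.K i x) (hb : R.Boundary i x) (hj : j < R.m i)
    (h : 0 < pieceLen (R.K i) (R.pos i) R.d j x) :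
    ∃ w : R.Piece, w.1.1 = i ∧ w.1.2.1 = j ∧ w.1.2.2 = runStart (R.K i) x ∧
      R.len w = pieceLen (R.K i) (R.pos i) R.d j x := by
  obtain ⟨h1, h2⟩ := R.run_runStart hx
  refine ⟨⟨(i, j, runStart (R.K i) x), hj, (runStart_spec hx).2 _ le_rfl (runStart_spec hx).1, h1,
    ?_, ?_⟩, rfl, rfl, rfl, ?_⟩
  · simpa only [Boundary, h1, h2] using hb
  · simpa only [pieceLen, h1, h2] using h
  · simp only [len, pieceLen, h1, h2]

theorem pieceVal_len {i : Fin R.c} {j x : ℕ} (hx : R.K i x) (hb : R.Boundary i x)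
    (hj : j < R.m i) : R.pieceVal R.len i j x = pieceLen (R.K i) (R.pos i) R.d j x := by
  rcases Nat.eq_zero_or_pos (pieceLen (R.K i) (R.pos i) R.d j x) with h | h
  · rw [h]
    by_contra h0
    obtain ⟨w, rfl, rfl, h3, -⟩ := R.pieceVal_pos (Nat.pos_of_ne_zero h0)
    have h4 := w.2.2.2.2.2
    obtain ⟨h5, h6⟩ := R.run_runStart hx
    simp only [h3, pieceLen, h5, h6] at h4
    unfold pieceLen at h
    omega
  · obtain ⟨w, rfl, rfl, h3, h4⟩ := R.exists_piece hx hb hj h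
    rw [R.pieceVal_self _ w h3, h4]

theorem sum_len_bounds {i : Fin R.c} {s t x : ℕ} (hx : R.K i x) (hb : R.Boundary i x)
    (hst : s < t) (ht : t ≤ R.m i) :
    ∑ w ∈ R.pieces i s t x, R.len w ≤ R.baseLen i s t x ∧
      R.baseLen i s t x ≤ ∑ w ∈ R.pieces i s t x, R.len w + 2 * R.d * R.numSegs := by
  have h1 : ∑ w ∈ R.pieces i s t x, R.len w =
      ∑ j ∈ Finset.Ico s t, pieceLen (R.K i) (R.pos i) R.d j x := by
    rw [R.sum_pieces]
    refine Finset.sum_congr rfl fun j hj => R.pieceVal_len hx hb ?_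
    rw [Finset.mem_Ico] at hj
    omega
  rw [h1]
  have h2 := sum_piece_bounds (R.pos_lt i) (runStart (R.K i) x) (runEnd (R.K i) x) R.d hst ht
  have h3 : 2 * R.d * (t - s) ≤ 2 * R.d * R.numSegs :=
    Nat.mul_le_mul_left _ (by have := R.m_le i; omega)
  unfold pieceLen baseLen
  omega

/-- The equations for the numbers of deleted blocks in the pieces. -/
def equations : Set (Finset R.Piece × Finset R.Piece) :=
  {q | (∃ p p' : Fin R.c × ℕ, R.K p.1 p.2 ∧ R.Boundary p.1 p.2 ∧ R.Boundary p'.1 p'.2 ∧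
      Relation.EqvGen R.Adj p p' ∧
      q = (R.pieces p.1 0 (R.m p.1) p.2, R.pieces p'.1 0 (R.m p'.1) p'.2)) ∨
    ∃ (b : R.β) (t : ℕ), R.OnBand b t ∧ R.Boundary (R.i₀ b) (R.x₀ b t) ∧
      R.Boundary (R.i₁ b) (R.x₁ b t) ∧
      q = (R.pieces (R.i₀ b) (R.s₀ b) (R.t₀ b) (R.x₀ b t),
        R.pieces (R.i₁ b) (R.s₁ b) (R.t₁ b) (R.x₁ b t))}

theorem m_pos {i : Fin R.c} {x : ℕ} (hx : R.K i x) : 0 < R.m i := by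
  by_contra h
  have h1 : R.m i = 0 := by omega
  have := R.K_lt i x hx
  rw [h1, R.pos_zero] at this
  omega

/-- Bands and classes preserve lengths exactly; the error comes only from the margins at inner
vertices, which belong to no piece. -/
theorem len_approx (q : Finset R.Piece × Finset R.Piece) (hq : q ∈ R.equations) :
    ∑ w ∈ q.1, R.len w ≤ ∑ w ∈ q.2, R.len w + 2 * R.d * R.numSegs ∧
      ∑ w ∈ q.2, R.len w ≤ ∑ w ∈ q.1, R.len w + 2 * R.d * R.numSegs := by
  rcases hq with ⟨p, p', hK, hb, hb', he, rfl⟩ | ⟨b, t, h, hb, hb', rfl⟩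
  · obtain ⟨h1, h2⟩ := R.eqvGen_invariant he
    have hK' := h1.mp hK
    have h3 := R.sum_len_bounds hK hb (R.m_pos hK) le_rfl
    have h4 := R.sum_len_bounds hK' hb' (R.m_pos hK') le_rfl
    rw [R.baseLen_univ hK] at h3
    rw [R.baseLen_univ hK'] at h4
    dsimp only
    omega
  · have h3 := R.sum_len_bounds h.2.2 hb (R.st₀ b) (R.t₀_le b)
    have h4 := R.sum_len_bounds (R.K_x₁ h) hb' (R.st₁ b) (R.t₁_le b)
    have h5 := (R.base_match h).1
    dsimp only
    omega

/-! ### The numbers of deleted blocks. -/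

open Classical in
/-- The number of blocks to be deleted from a run, determined by its class. -/
noncomputable def total (v : R.Piece → ℕ) (p₁ p : Fin R.c × ℕ) : ℕ :=
  if h : ∃ q : Fin R.c × ℕ, Relation.EqvGen R.Adj p q ∧ R.Boundary q.1 q.2 then
    ∑ w ∈ R.pieces h.choose.1 0 (R.m h.choose.1) h.choose.2, v w
  else if Relation.EqvGen R.Adj p₁ p then 1 else 0

/-- The equations of the first kind say precisely that the chosen boundary run of the class does not
matter. -/
theorem total_of_boundary {v : R.Piece → ℕ} (hv : ∀ q ∈ R.equations, Solves v q)
    (p₁ : Fin R.c × ℕ) {p q : Fin R.c × ℕ} (hp : R.K p.1 p.2) (hq : R.Boundary q.1 q.2)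
    (h : Relation.EqvGen R.Adj p q) :
    R.total v p₁ p = ∑ w ∈ R.pieces q.1 0 (R.m q.1) q.2, v w := by
  have hex : ∃ q : Fin R.c × ℕ, Relation.EqvGen R.Adj p q ∧ R.Boundary q.1 q.2 := ⟨q, h, hq⟩
  unfold total
  rw [dif_pos hex]
  obtain ⟨h1, h2⟩ := hex.choose_spec
  refine hv (_, _) (Or.inl ⟨hex.choose, q, ?_, h2, hq, h1.symm.trans _ _ _ h, rfl⟩)
  exact (R.eqvGen_invariant h1).1.mp hp

theorem total_congr {v : R.Piece → ℕ} (hv : ∀ q ∈ R.equations, Solves v q)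
    (p₁ : Fin R.c × ℕ) {p q : Fin R.c × ℕ} (hp : R.K p.1 p.2) (h : Relation.EqvGen R.Adj p q) :
    R.total v p₁ p = R.total v p₁ q := by
  by_cases hex : ∃ r : Fin R.c × ℕ, Relation.EqvGen R.Adj p r ∧ R.Boundary r.1 r.2
  · obtain ⟨r, h1, h2⟩ := hex
    rw [R.total_of_boundary hv p₁ hp h2 h1, R.total_of_boundary hv p₁
      ((R.eqvGen_invariant h).1.mp hp) h2 (h.symm.trans _ _ _ h1)]
  · have hex' : ¬ ∃ r : Fin R.c × ℕ, Relation.EqvGen R.Adj q r ∧ R.Boundary r.1 r.2 :=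
      fun ⟨r, h1, h2⟩ => hex ⟨r, h.trans _ _ _ h1, h2⟩
    unfold total
    rw [dif_neg hex, dif_neg hex']
    have : Relation.EqvGen R.Adj p₁ p ↔ Relation.EqvGen R.Adj p₁ q :=
      ⟨fun h1 => h1.trans _ _ _ h, fun h1 => h1.trans _ _ _ h.symm⟩
    by_cases he : Relation.EqvGen R.Adj p₁ p
    · rw [if_pos he, if_pos (this.mp he)]
    · rw [if_neg he, if_neg (mt this.mpr he)]

/-- The run of `x` lies in the interior of the core of the `j`-th segment. -/
def Interior (i : Fin R.c) (j x : ℕ) : Prop :=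
  j < R.m i ∧ R.pos i j + R.d < runStart (R.K i) x ∧ runEnd (R.K i) x + R.d < R.pos i (j + 1)

open Classical in
/-- The number of blocks to be deleted from the piece of the run of `x` in the `j`-th segment. -/
noncomputable def plan (v : R.Piece → ℕ) (p₁ : Fin R.c × ℕ) (i : Fin R.c) (j x : ℕ) : ℕ :=
  if R.Boundary i x then R.pieceVal v i j x
  else if R.Interior i j x then R.total v p₁ (i, x) else 0

theorem plan_run {v : R.Piece → ℕ} (hv : ∀ q ∈ R.equations, Solves v q) (p₁ : Fin R.c × ℕ)
    {i : Fin R.c} (j : ℕ) {x z : ℕ} (hx : R.K i x) (h1 : runStart (R.K i) x ≤ z)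
    (h2 : z < runEnd (R.K i) x) : R.plan v p₁ i j z = R.plan v p₁ i j x := by
  obtain ⟨h3, h4⟩ := run_eq_of_mem_run (R.K_lt i) hx h1 h2
  have h5 := R.total_congr hv p₁ hx (.rel _ _ (.run hx h1 h2))
  simp only [plan, Boundary, Interior, pieceVal, h3, h4, h5]

theorem pieceLen_pos_of_plan {v : R.Piece → ℕ} {p₁ : Fin R.c × ℕ}
    {i : Fin R.c} {j x : ℕ} (hx : R.K i x) (h : 0 < R.plan v p₁ i j x) :
    0 < pieceLen (R.K i) (R.pos i) R.d j x := by
  have h1 := (runStart_spec hx).1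
  have h2 := lt_runEnd (R.K_lt i) hx
  unfold plan at h
  split_ifs at h with hb hi
  · obtain ⟨w, rfl, rfl, h3, -⟩ := R.pieceVal_pos h
    have h4 := w.2.2.2.2.2
    obtain ⟨h5, h6⟩ := R.run_runStart hx
    simp only [h3, pieceLen, h5, h6] at h4
    exact h4
  · obtain ⟨-, h3, h4⟩ := hi
    unfold pieceLen
    omega
  · omega

theorem sum_plan {v : R.Piece → ℕ} (hv : ∀ q ∈ R.equations, Solves v q) (p₁ : Fin R.c × ℕ)
    {i : Fin R.c} {x : ℕ} (hx : R.K i x) :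
    ∑ j ∈ Finset.Ico 0 (R.m i), R.plan v p₁ i j x = R.total v p₁ (i, x) := by
  by_cases hb : R.Boundary i x
  · rw [R.total_of_boundary hv p₁ (p := (i, x)) (q := (i, x)) hx hb (.refl _), R.sum_pieces]
    exact Finset.sum_congr rfl fun j _ => by rw [plan, if_pos hb]
  · obtain ⟨j, hj, h1, h2⟩ := not_not.mp hb
    have h3 := (runStart_spec hx).1
    have h4 := lt_runEnd (R.K_lt i) hx
    rw [Finset.sum_eq_single_of_mem j (Finset.mem_Ico.mpr ⟨Nat.zero_le _, hj⟩)]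
    · rw [plan, if_neg hb, if_pos ⟨hj, h1, h2⟩]
    · intro k hk hkj
      rw [plan, if_neg hb, if_neg]
      rintro ⟨hk, h5, h6⟩
      exact hkj (segment_unique (R.pos_lt i) hk hj (z := x) (by omega) (by omega) (by omega)
        (by omega))

/-- A free run meets no segment outside the base, so the base already sees all its deletions. -/
theorem sum_plan_of_free {v : R.Piece → ℕ} (hv : ∀ q ∈ R.equations, Solves v q)
    (p₁ : Fin R.c × ℕ) {i : Fin R.c} {x s t : ℕ} (hx : R.K i x) (hst : s ≤ t) (ht : t ≤ R.m i)
    (hf : R.Free i s t x) :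
    ∑ j ∈ Finset.Ico s t, R.plan v p₁ i j x = R.total v p₁ (i, x) := by
  rw [← R.sum_plan hv p₁ hx]
  refine Finset.sum_subset (Finset.Ico_subset_Ico (Nat.zero_le _) ht) fun j hj hj' => ?_
  rw [Finset.mem_Ico] at hj hj'
  by_contra h0
  have h1 := R.pieceLen_pos_of_plan hx (Nat.pos_of_ne_zero h0)
  unfold Free at hf
  unfold pieceLen at h1
  rcases lt_or_ge j s with h | h
  · have := pos_le_pos (R.pos_lt i) (by omega : j + 1 ≤ s) (by omega)
    omega
  · have := pos_le_pos (R.pos_lt i) (by omega : t ≤ j) (by omega)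
    omega

/-- If the matched runs are free, they are in the same class and their totals agree. Otherwise both
are boundary runs, and the equality is an equation of the second kind. -/
theorem plan_band {v : R.Piece → ℕ} (hv : ∀ q ∈ R.equations, Solves v q)
    (p₁ : Fin R.c × ℕ) {b : R.β} {t : ℕ} (h : R.OnBand b t) :
    ∑ j ∈ Finset.Ico (R.s₀ b) (R.t₀ b), R.plan v p₁ (R.i₀ b) j (R.x₀ b t) =
      ∑ j ∈ Finset.Ico (R.s₁ b) (R.t₁ b), R.plan v p₁ (R.i₁ b) j (R.x₁ b t) := by
  have hm := (R.base_match h).2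
  by_cases hf : R.Free (R.i₀ b) (R.s₀ b) (R.t₀ b) (R.x₀ b t)
  · rw [R.sum_plan_of_free hv p₁ h.2.2 (R.st₀ b).le (R.t₀_le b) hf,
      R.sum_plan_of_free hv p₁ (R.K_x₁ h) (R.st₁ b).le (R.t₁_le b) (hm.mpr hf)]
    exact R.total_congr hv p₁ h.2.2 (.rel _ _ (.band h hf))
  · have p₀ := R.pos_t₀ b
    have p₁' := R.pos_t₁ b
    have hb₀ := R.boundary_of_not_free (R.t₀_le b) (R.st₀ b) h.2.2
      (by have := h.1; unfold x₀; omega) (by have := h.2.1; unfold x₀; omega) hf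
    have hb₁ := R.boundary_of_not_free (R.t₁_le b) (R.st₁ b) (R.K_x₁ h)
      (by have := h.1; have := h.2.1; unfold x₁ turn; split_ifs <;> omega)
      (by have := h.1; have := h.2.1; unfold x₁ turn; split_ifs <;> omega) (mt hm.mp hf)
    have := hv (_, _) (Or.inr ⟨b, t, h, hb₀, hb₁, rfl⟩)
    simp only [Solves, R.sum_pieces] at this
    simpa only [plan, if_pos hb₀, if_pos hb₁] using this

/-- A long run allows to delete blocks compatibly with the bands. -/
theorem exists_plan (Q : ℕ) (i₁ : Fin R.c) (x₁ : ℕ) (hx₁ : R.K i₁ x₁)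
    (hQ : Q ≤ R.runLen i₁ x₁)
    (hlong : R.numSegs * (coneBound (2 * R.numSegs) (4 ^ (2 * R.numSegs)) *
      coneBound (2 * R.numSegs) (4 ^ (2 * R.numSegs)) * (2 * R.d * R.numSegs + Q)) +
        2 * R.d * R.numSegs < R.runLen i₁ x₁) :
    ∃ y : Fin R.c → ℕ → ℕ → ℕ,
      (∀ i j x z, R.K i x → runStart (R.K i) x ≤ z → z < runEnd (R.K i) x → y i j z = y i j x) ∧
      (∀ i, ∀ j < R.m i, ∀ x, R.K i x → y i j x * Q ≤ pieceLen (R.K i) (R.pos i) R.d j x) ∧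
      (∀ b t, R.OnBand b t → ∑ j ∈ Finset.Ico (R.s₀ b) (R.t₀ b), y (R.i₀ b) j (R.x₀ b t) =
        ∑ j ∈ Finset.Ico (R.s₁ b) (R.t₁ b), y (R.i₁ b) j (R.x₁ b t)) ∧
      ∃ i, ∃ j < R.m i, ∃ x, R.K i x ∧ 0 < y i j x := by
  obtain ⟨v, hv, hvQ, hpos⟩ : ∃ v : R.Piece → ℕ, (∀ q ∈ R.equations, Solves v q) ∧
      (∀ w, Q * v w ≤ R.len w) ∧
      ∃ i, ∃ j < R.m i, ∃ x, R.K i x ∧ 0 < R.plan v (i₁, x₁) i j x := by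
    by_cases hex : ∃ q : Fin R.c × ℕ, Relation.EqvGen R.Adj (i₁, x₁) q ∧ R.Boundary q.1 q.2
    · obtain ⟨q, hq, hb⟩ := hex
      obtain ⟨hK, hl⟩ := R.eqvGen_invariant hq
      have hKq := hK.mp hx₁
      have hbd := (R.sum_len_bounds hKq hb (R.m_pos hKq) le_rfl).2
      rw [R.baseLen_univ hKq, ← hl, R.sum_pieces] at hbd
      set T := coneBound (2 * R.numSegs) (4 ^ (2 * R.numSegs)) *
        coneBound (2 * R.numSegs) (4 ^ (2 * R.numSegs)) * (2 * R.d * R.numSegs + Q)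
      -- The boundary run `q` is as long as the given one and is cut into at most `numSegs` pieces,
      -- so one piece exceeds the threshold `T` of `exists_small_solution`.
      obtain ⟨j, hj, hjT⟩ : ∃ j ∈ Finset.Ico 0 (R.m q.1), T < R.pieceVal R.len q.1 j q.2 := by
        by_contra! hcon
        have h1 := Finset.sum_le_card_nsmul _ _ _ hcon
        rw [Nat.card_Ico, smul_eq_mul, Nat.sub_zero] at h1
        have h2 := Nat.mul_le_mul_right T (R.m_le q.1)
        dsimp only at hbd
        omega
      obtain ⟨w, -, -, -, hw⟩ := R.pieceVal_pos (by omega : 0 < R.pieceVal R.len q.1 j q.2)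
      rw [hw] at hjT
      obtain ⟨v, hv0, hv, hvQ⟩ := exists_small_solution (2 * R.numSegs) R.card_piece_le
        R.equations R.len (2 * R.d * R.numSegs) Q R.len_approx w hjT
      refine ⟨v, hv, hvQ, ?_⟩
      obtain ⟨u, hu⟩ := Function.ne_iff.mp hv0
      refine ⟨u.1.1, u.1.2.1, u.2.1, u.1.2.2, u.2.2.1, ?_⟩
      rw [plan, if_pos u.2.2.2.2.1, R.pieceVal_self v u u.2.2.2.1.symm]
      exact Nat.pos_of_ne_zero hu
    -- No run of the class is a boundary run. With `v = 0` the last clause of `total` deletes one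
    -- block from each run of this class, and nothing elsewhere.
    · refine ⟨0, fun q _ => by simp [Solves], fun w => by simp, ?_⟩
      have hb : ¬ R.Boundary i₁ x₁ := fun h => hex ⟨(i₁, x₁), .refl _, h⟩
      obtain ⟨j, hj, h1, h2⟩ := not_not.mp hb
      refine ⟨i₁, j, hj, x₁, hx₁, ?_⟩
      rw [plan, if_neg hb, if_pos ⟨hj, h1, h2⟩, total, dif_neg hex, if_pos (.refl _)]
      exact Nat.one_pos
  refine ⟨R.plan v (i₁, x₁), fun i j x z hx h1 h2 => R.plan_run hv _ j hx h1 h2, ?_,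
    fun b t h => R.plan_band hv _ h, hpos⟩
  intro i j hj x hx
  by_cases hb : R.Boundary i x
  · rw [plan, if_pos hb]
    rcases Nat.eq_zero_or_pos (R.pieceVal v i j x) with h0 | h0
    · rw [h0]; simp
    · obtain ⟨w, rfl, rfl, h3, h4⟩ := R.pieceVal_pos h0
      rw [h4, Nat.mul_comm, ← R.pieceVal_len hx hb hj, R.pieceVal_self _ w h3]
      exact hvQ w
  · rw [plan, if_neg hb]
    split_ifs with hi
    · have hlen : pieceLen (R.K i) (R.pos i) R.d j x = R.runLen i x := by
        obtain ⟨-, h1, h2⟩ := hi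
        unfold pieceLen runLen
        omega
      rw [hlen]
      -- An interior run has room for its blocks: an equivalent boundary run of the same length
      -- accommodates them piece by piece. Without such a run, `hQ` gives room for the single block.
      by_cases hex : ∃ q : Fin R.c × ℕ, Relation.EqvGen R.Adj (i, x) q ∧ R.Boundary q.1 q.2
      · obtain ⟨q, hq, hbq⟩ := hex
        obtain ⟨hK, hl⟩ := R.eqvGen_invariant hq
        have hKq := hK.mp hx
        have hbd := (R.sum_len_bounds hKq hbq (R.m_pos hKq) le_rfl).1
        rw [R.baseLen_univ hKq, ← hl] at hbd
        rw [R.total_of_boundary hv _ (p := (i, x)) hx hbq hq, Finset.sum_mul]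
        refine le_trans (Finset.sum_le_sum fun w _ => ?_) hbd
        rw [Nat.mul_comm]
        exact hvQ w
      · unfold total
        rw [dif_neg hex]
        split_ifs with he
        · have := (R.eqvGen_invariant he).2
          dsimp only at this
          omega
        · simp
    · simp

end RunSystem

/-! ### Words as functions on positions -/

section Words

/-- Passage from labels of segments to positions in the whole word. The default letter `a₀` is never
read inside the slice. -/
theorem flatMap_slice {α : Type} (lab : ℕ → List α) (pos : ℕ → ℕ) (h0 : pos 0 = 0)
    (hpos : ∀ k, pos (k + 1) = pos k + (lab k).length) (a₀ : α) {m s t : ℕ} (hst : s ≤ t)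
    (ht : t ≤ m) : (List.Ico s t).flatMap lab =
      (List.Ico (pos s) (pos t)).map fun x => ((List.Ico 0 m).flatMap lab).getD x a₀ := by
  have hlen : ∀ k, ((List.Ico 0 k).flatMap lab).length = pos k := by
    intro k
    induction k with
    | zero => simp [h0]
    | succ k ih =>
      rw [List.Ico.succ_top (Nat.zero_le k), List.flatMap_append, List.length_append, ih, hpos]
      simp
  induction t, hst using Nat.le_induction with
  | base => simp
  | succ t hst ih =>
    have hmono : pos s ≤ pos t := by
      clear ih
      induction t, hst using Nat.le_induction with
      | base => exact le_rfl
      | succ t _ ih => exact (ih (by omega)).trans (by rw [hpos]; omega)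
    rw [List.Ico.succ_top hst, List.flatMap_append, ih (by omega),
      ← List.Ico.append_consecutive (n := pos s) (m := pos t) (l := pos (t + 1)) hmono
        (by rw [hpos]; omega),
      List.map_append]
    congr 1
    have hsplit : (List.Ico 0 m).flatMap lab =
        (List.Ico 0 t).flatMap lab ++ (lab t ++ (List.Ico (t + 1) m).flatMap lab) := by
      rw [← List.Ico.append_consecutive (Nat.zero_le t) (by omega : t ≤ m),
        List.Ico.eq_cons (by omega : t < m), List.flatMap_append, List.flatMap_cons]
    simp only [List.flatMap_cons, List.flatMap_nil, List.append_nil]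
    refine List.ext_getElem (by simp [hpos]) fun k h1 h2 => ?_
    have e : (List.Ico (pos t) (pos (t + 1)))[k]'(by simp [hpos]; exact h1) = pos t + k := by
      simp [List.Ico]
    rw [List.getElem_map, e, hsplit, List.getD_append_right _ _ _ _ (by rw [hlen]; omega), hlen,
      Nat.add_sub_cancel_left, List.getD_append _ _ _ _ h1, List.getD_eq_getElem _ _ h1]

theorem Ico_map_eq_range {α : Type} (W : ℕ → α) (P l : ℕ) :
    (List.Ico P (P + l)).map W = (List.range l).map fun t => W (P + t) := by
  simpa using Ico_filter_map_eq_range W (fun _ => True) P l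

theorem Ico_map_reverse {α : Type} (W : ℕ → α) (P l : ℕ) :
    ((List.Ico P (P + l)).map W).reverse =
      (List.range l).map fun t => W (P + (l - 1 - t)) := by
  simpa using Ico_filter_map_reverse W (fun _ => True) P l

theorem eq_of_translate {α β : Type} {W₀ : ℕ → α} {W₁ : ℕ → β} {φ : α → β} {P₀ Q₀ P₁ Q₁ : ℕ}
    (h₀ : P₀ ≤ Q₀) (h₁ : P₁ ≤ Q₁)
    (h : (List.Ico P₁ Q₁).map W₁ = ((List.Ico P₀ Q₀).map W₀).map φ) :
    Q₁ = P₁ + (Q₀ - P₀) ∧ ∀ t < Q₀ - P₀, W₁ (P₁ + t) = φ (W₀ (P₀ + t)) := by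
  have hlen := congrArg List.length h
  simp only [List.length_map, List.Ico.length] at hlen
  have e₀ : Q₀ = P₀ + (Q₀ - P₀) := by omega
  have e₁ : Q₁ = P₁ + (Q₀ - P₀) := by omega
  refine ⟨e₁, fun t ht => ?_⟩
  generalize Q₀ - P₀ = l at *
  subst e₀ e₁
  rw [Ico_map_eq_range, Ico_map_eq_range, List.map_map] at h
  exact List.map_inj_left.mp h t (List.mem_range.mpr ht)

theorem eq_of_reflect {α β : Type} {W₀ : ℕ → α} {W₁ : ℕ → β} {φ : α → β} {P₀ Q₀ P₁ Q₁ : ℕ}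
    (h₀ : P₀ ≤ Q₀) (h₁ : P₁ ≤ Q₁)
    (h : ((List.Ico P₁ Q₁).map W₁).reverse = ((List.Ico P₀ Q₀).map W₀).map φ) :
    Q₁ = P₁ + (Q₀ - P₀) ∧
      ∀ t < Q₀ - P₀, W₁ (P₁ + (Q₀ - P₀ - 1 - t)) = φ (W₀ (P₀ + t)) := by
  have hlen := congrArg List.length h
  simp only [List.length_map, List.Ico.length, List.length_reverse] at hlen
  have e₀ : Q₀ = P₀ + (Q₀ - P₀) := by omega
  have e₁ : Q₁ = P₁ + (Q₀ - P₀) := by omega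
  refine ⟨e₁, fun t ht => ?_⟩
  generalize Q₀ - P₀ = l at *
  subst e₀ e₁
  rw [Ico_map_reverse, Ico_map_eq_range, List.map_map] at h
  exact List.map_inj_left.mp h t (List.mem_range.mpr ht)

theorem getD_replicate_flatten {α : Type} (p : List α) (a₀ : α) (s k : ℕ)
    (hk : k + p.length < s * p.length) :
    ((List.replicate s p).flatten).getD k a₀ =
      ((List.replicate s p).flatten).getD (k + p.length) a₀ := by
  rcases s with _ | s
  · omega
  have e : (s + 1) * p.length = s * p.length + p.length := by ring
  have hlen : ((List.replicate s p).flatten).length = s * p.length := by simp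
  have h1 : (List.replicate (s + 1) p).flatten = p ++ (List.replicate s p).flatten := by
    simp [List.replicate_succ]
  have h2 : (List.replicate (s + 1) p).flatten = (List.replicate s p).flatten ++ p := by
    simp [List.replicate_succ']
  have h3 : ((List.replicate (s + 1) p).flatten).getD (k + p.length) a₀ =
      ((List.replicate s p).flatten).getD k a₀ := by
    rw [h1, List.getD_append_right _ _ _ _ (by omega), Nat.add_sub_cancel]
  rw [h3, h2, List.getD_append _ _ _ _ (by omega)]

theorem getD_of_infix_power {α : Type} {w p : List α} {s : ℕ}
    (h : (List.replicate s p).flatten <:+: w) (a₀ : α) :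
    ∃ a, a + s * p.length ≤ w.length ∧
      ∀ z, a ≤ z → z + p.length < a + s * p.length →
        w.getD z a₀ = w.getD (z + p.length) a₀ := by
  obtain ⟨u, v, rfl⟩ := h
  have hlen : ((List.replicate s p).flatten).length = s * p.length := by simp
  refine ⟨u.length, by simp only [List.length_append, hlen]; omega, fun z h1 h2 => ?_⟩
  obtain ⟨k, rfl⟩ := Nat.exists_eq_add_of_le h1
  have h3 : ∀ j < s * p.length, (u ++ (List.replicate s p).flatten ++ v).getD (u.length + j) a₀ =
      ((List.replicate s p).flatten).getD j a₀ := by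
    intro j hj
    rw [List.append_assoc, List.getD_append_right u _ _ _ (Nat.le_add_right _ _),
      Nat.add_sub_cancel_left, List.getD_append _ _ _ _ (by omega)]
  rw [Nat.add_assoc, h3 _ (by omega), h3 _ (by omega)]
  exact getD_replicate_flatten p a₀ s k (by omega)

theorem subset_run {K : ℕ → Prop} {L A B x : ℕ} (hL : ∀ z, K z → z < L)
    (hK : ∀ z, A ≤ z → z < B → K z) (h1 : A ≤ x) (h2 : x < B) :
    runStart K x ≤ A ∧ B ≤ runEnd K x := by
  have hx := hK x h1 h2
  have h3 := (runStart_spec hx).1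
  constructor
  · by_contra h
    exact not_pred_runStart hx (w := runStart K x - 1) (by omega) (hK _ (by omega) (by omega))
  · by_contra h
    have h4 := runEnd_spec hL x
    exact h4.2 (hK _ (by omega) (by omega))

theorem Letter.bar_bar {n : ℕ} (s : Letter n) : s.bar.bar = s := by
  simp [Letter.bar]

theorem Letter.bar_injective {n : ℕ} : Function.Injective (Letter.bar (n := n)) :=
  Function.LeftInverse.injective Letter.bar_bar

theorem Word.bar_bar {n : ℕ} (w : Word n) : w.bar.bar = w := by
  simp [Word.bar, Function.comp_def, Letter.bar_bar]

theorem Word.bar_injective {n : ℕ} : Function.Injective (Word.bar (n := n)) :=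
  Function.LeftInverse.injective Word.bar_bar

theorem Word.act_bar {n : ℕ} (φ : autS n) (w : Word n) : w.bar.act φ = (w.act φ).bar := by
  simp only [Word.bar, Word.act, List.map_reverse, List.map_map]
  congr 2
  funext s
  exact φ.2 s

/-- The inversion of letters is absorbed into the letter map, leaving a plain reversal of positions.
-/
theorem Word.bar_eq_act_iff {n : ℕ} (φ : autS n) (w w' : Word n) :
    w'.bar = w.act φ ↔
      w'.reverse = w.map fun s => Letter.bar ((φ : Equiv.Perm (Letter n)) s) := by
  have e : (w.map fun s => Letter.bar ((φ : Equiv.Perm (Letter n)) s)) =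
      (w.act φ).map Letter.bar := by
    simp [Word.act, Function.comp_def]
  have e2 : w'.reverse = w'.bar.map Letter.bar := by
    simp [Word.bar, Function.comp_def, Letter.bar_bar]
  rw [e, e2]
  exact (List.map_injective_iff.mpr Letter.bar_injective).eq_iff.symm

end Words

/-! ### The semigroup evaluation as a finite automaton. -/

section Automaton

/-- One step of the evaluation of a word. -/
def evalStep {α β : Type} (mul : α → α → α) (f : β → α) (a : Option α) (s : β) : Option α :=
  some (a.elim (f s) fun a => mul a (f s))

/-- The initial state `none` makes the evaluation an action on a finite set with one element more
than the semigroup. -/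
theorem evalWord_eq_foldl {α β : Type} (mul : α → α → α) (f : β → α) (w : List β) :
    evalWord mul f w = w.foldl (evalStep mul f) none := by
  cases w with
  | nil => rfl
  | cons s w =>
    have h : ∀ (w : List β) (a : α), w.foldl (evalStep mul f) (some a) =
        some (w.foldl (fun a t => mul a (f t)) a) := by
      intro w
      induction w with
      | nil => intro a; rfl
      | cons t w ih => intro a; exact ih _
    exact (h w (f s)).symm

end Automaton

/-! ### Solutions as words indexed by positions. -/

namespace BandComplex.Labelling

variable {n : ℕ} {X : BandComplex n} (σ : X.Labelling)

/-- The label of the `k`-th elementary segment of a component. -/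
def labelAt (i : Fin X.numComp) (k : ℕ) : Word n :=
  if h : k < X.numSeg i then σ.label ⟨i, (⟨k, h⟩, true)⟩ else []

/-- The position of the `k`-th vertex of a component. -/
def vertexPos (i : Fin X.numComp) (k : ℕ) : ℕ := ∑ j ∈ Finset.range k, (σ.labelAt i j).length

/-- The letters of a component. -/
def letterAt (a₀ : Letter n) (i : Fin X.numComp) (x : ℕ) : Letter n := (σ.compWord i).getD x a₀

theorem finRange_filter_map_val {m s t : ℕ} (ht : t ≤ m) :
    ((List.finRange m).filter fun j => s ≤ j.val ∧ j.val < t).map Fin.val = List.Ico s t := by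
  have h : (List.finRange m).map Fin.val = List.range m := by
    rw [List.finRange_eq_pmap_range, List.map_pmap]
    simp
  have h2 : ((List.finRange m).filter fun j => s ≤ j.val ∧ j.val < t).map Fin.val =
      (List.range m).filter fun j => s ≤ j ∧ j < t := by
    rw [← h, List.filter_map]
    rfl
  rw [h2, ← List.Ico.zero_bot]
  have h3 : (List.Ico 0 m).filter (fun j => s ≤ j ∧ j < t) =
      ((List.Ico 0 m).filter fun j => j < t).filter fun j => s ≤ j := by
    rw [List.filter_filter]
    refine List.filter_congr fun j _ => ?_
    simp
  rw [h3, List.Ico.filter_lt, List.Ico.filter_le, Nat.min_eq_right ht, Nat.max_eq_right (Nat.zero_le s)]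

theorem segWord_eq_flatMap {i : Fin X.numComp} {s t : ℕ} (hst : s ≤ t) (ht : t ≤ X.numSeg i) :
    σ.segWord i s t = (List.Ico s t).flatMap (σ.labelAt i) := by
  rw [← finRange_filter_map_val ht, List.flatMap_map, segWord, path, if_pos hst, List.flatMap_map]
  congr 1
  funext j
  simp [labelAt]

theorem flatMap_bar_reverse {α : Type} {n : ℕ} (l : List α) (f : α → Word n) :
    (l.reverse).flatMap (fun a => (f a).bar) = Word.bar (l.flatMap f) := by
  induction l with
  | nil => rfl
  | cons a l ih =>
    simp only [List.reverse_cons, List.flatMap_append, ih, List.flatMap_cons, List.flatMap_nil,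
      List.append_nil]
    simp [Word.bar]

theorem segWord_swap {i : Fin X.numComp} {s t : ℕ} (hst : s < t) :
    σ.segWord i t s = (σ.segWord i s t).bar := by
  rw [segWord, segWord, path, if_neg (not_le.mpr hst), path, if_pos hst.le, ← List.map_reverse,
    List.flatMap_map, List.flatMap_map, ← flatMap_bar_reverse]
  congr 1
  funext j
  exact σ.label_bar ⟨i, (j, true)⟩

theorem vertexPos_succ (i : Fin X.numComp) (k : ℕ) :
    σ.vertexPos i (k + 1) = σ.vertexPos i k + (σ.labelAt i k).length :=
  Finset.sum_range_succ _ _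

theorem vertexPos_lt {i : Fin X.numComp} {k : ℕ} (hk : k < X.numSeg i) :
    σ.vertexPos i k < σ.vertexPos i (k + 1) := by
  rw [vertexPos_succ, labelAt, dif_pos hk]
  have := List.length_pos_iff.mpr (σ.label_ne_nil ⟨i, (⟨k, hk⟩, true)⟩)
  omega

theorem vertexPos_mono {i : Fin X.numComp} {s t : ℕ} (hst : s ≤ t) (ht : t ≤ X.numSeg i) :
    σ.vertexPos i s ≤ σ.vertexPos i t :=
  pos_le_pos (pos := σ.vertexPos i) (fun _ hj => σ.vertexPos_lt hj) hst ht

theorem segWord_eq_map (a₀ : Letter n) {i : Fin X.numComp} {s t : ℕ} (hst : s ≤ t)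
    (ht : t ≤ X.numSeg i) : σ.segWord i s t =
      (List.Ico (σ.vertexPos i s) (σ.vertexPos i t)).map (σ.letterAt a₀ i) := by
  rw [σ.segWord_eq_flatMap hst ht,
    flatMap_slice (σ.labelAt i) (σ.vertexPos i) rfl (σ.vertexPos_succ i) a₀ hst ht,
    ← σ.segWord_eq_flatMap (Nat.zero_le _) le_rfl]
  rfl

theorem length_compWord (a₀ : Letter n) (i : Fin X.numComp) :
    (σ.compWord i).length = σ.vertexPos i (X.numSeg i) := by
  rw [compWord, σ.segWord_eq_map a₀ (Nat.zero_le _) le_rfl, List.length_map, List.Ico.length]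
  rfl

/-- The increasing word of a base. -/
def incWord (J : Base X.numSeg) : Word n := σ.segWord J.comp (min J.src J.tgt) (max J.src J.tgt)

theorem baseWord_of_lt {J : Base X.numSeg} (h : J.src < J.tgt) : σ.baseWord J = σ.incWord J := by
  rw [baseWord, incWord, min_eq_left h.le, max_eq_right h.le]

theorem baseWord_of_not_lt {J : Base X.numSeg} (h : ¬ J.src < J.tgt) :
    σ.baseWord J = (σ.incWord J).bar := by
  have h' : J.tgt < J.src := lt_of_le_of_ne (not_lt.mp h) J.src_ne_tgt.symm
  rw [baseWord, incWord, min_eq_right h'.le, max_eq_left h'.le, σ.segWord_swap h']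

end BandComplex.Labelling

/-- A band reverses the orientations of the components. -/
def Band.reverses {n c : ℕ} {len : Fin c → ℕ} (B : Band n len) : Bool :=
  decide (B.base0.src < B.base0.tgt) != decide (B.base1.src < B.base1.tgt)

namespace BandComplex.Labelling

variable {n : ℕ} {X : BandComplex n} (σ : X.Labelling)

/-- The four choices of orientation of the bases reduce to two: the increasing words are matched by
a translation or by a reflection. -/
theorem band_equation_iff (B : Band n X.numSeg) :
    σ.baseWord B.base1 = (σ.baseWord B.base0).act B.twist ↔
      if B.reverses then (σ.incWord B.base1).reverse =
        (σ.incWord B.base0).map fun s => Letter.bar ((B.twist : Equiv.Perm (Letter n)) s)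
      else σ.incWord B.base1 =
        (σ.incWord B.base0).map (B.twist : Equiv.Perm (Letter n)) := by
  by_cases h0 : B.base0.src < B.base0.tgt <;> by_cases h1 : B.base1.src < B.base1.tgt <;>
    simp only [Band.reverses, h0, h1, decide_true, decide_false, bne_self_eq_false,
      Bool.false_eq_true, if_false, if_true, Bool.true_bne, Bool.false_bne, Bool.not_false]
  · rw [σ.baseWord_of_lt h0, σ.baseWord_of_lt h1]; rfl
  · rw [σ.baseWord_of_lt h0, σ.baseWord_of_not_lt h1]; exact Word.bar_eq_act_iff _ _ _
  · rw [σ.baseWord_of_not_lt h0, σ.baseWord_of_lt h1, Word.act_bar, ← Word.bar_eq_act_iff]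
    rw [← Word.bar_injective.eq_iff, Word.bar_bar]
  · rw [σ.baseWord_of_not_lt h0, σ.baseWord_of_not_lt h1, Word.act_bar, Word.bar_injective.eq_iff]
    rfl

end BandComplex.Labelling

/-! ### Shortening a solution with a high power. -/

section Shortening

namespace BandComplex.Labelling

variable {n : ℕ} {X : BandComplex n} (σ : X.Labelling)

open Classical in
/-- The labelling obtained by deleting letters at positions that are not vertices. -/
noncomputable def delete (a₀ : Letter n) (del : Fin X.numComp → ℕ → Prop)
    (hdel : ∀ i, ∀ k < X.numSeg i, ¬ del i (σ.vertexPos i k)) : X.Labelling where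
  label e := if e.2.2 then
      ((List.Ico (σ.vertexPos e.1 e.2.1) (σ.vertexPos e.1 (e.2.1 + 1))).filter
        fun z => ¬ del e.1 z).map (σ.letterAt a₀ e.1)
    else Word.bar (((List.Ico (σ.vertexPos e.1 e.2.1) (σ.vertexPos e.1 (e.2.1 + 1))).filter
        fun z => ¬ del e.1 z).map (σ.letterAt a₀ e.1))
  label_ne_nil := by
    rintro ⟨i, k, ε⟩
    have h : ((List.Ico (σ.vertexPos i k) (σ.vertexPos i (k + 1))).filter
        fun z => ¬ del i z).map (σ.letterAt a₀ i) ≠ [] := by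
      rw [Ne, List.map_eq_nil_iff]
      refine List.ne_nil_of_mem (a := σ.vertexPos i k) (List.mem_filter.mpr ⟨?_, ?_⟩)
      · exact List.Ico.mem.mpr ⟨le_rfl, σ.vertexPos_lt k.2⟩
      · exact decide_eq_true (hdel i k k.2)
    cases ε
    · simpa [Word.bar] using h
    · simpa using h
  label_bar := by
    rintro ⟨i, k, ε⟩
    cases ε
    · simp [OSeg.bar, Word.bar_bar]
    · simp [OSeg.bar]

variable (a₀ : Letter n) (del : Fin X.numComp → ℕ → Prop)
    (hdel : ∀ i, ∀ k < X.numSeg i, ¬ del i (σ.vertexPos i k))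

open Classical in
theorem segWord_delete {i : Fin X.numComp} {s t : ℕ} (hst : s ≤ t) (ht : t ≤ X.numSeg i) :
    (σ.delete a₀ del hdel).segWord i s t =
      ((List.Ico (σ.vertexPos i s) (σ.vertexPos i t)).filter fun z => ¬ del i z).map
        (σ.letterAt a₀ i) := by
  rw [segWord_eq_flatMap _ hst ht]
  induction t, hst using Nat.le_induction with
  | base => simp
  | succ t hst ih =>
    rw [List.Ico.succ_top hst, List.flatMap_append, ih (by omega),
      ← List.Ico.append_consecutive (n := σ.vertexPos i s) (m := σ.vertexPos i t)
        (l := σ.vertexPos i (t + 1))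
        (σ.vertexPos_mono hst (by omega)) (σ.vertexPos_lt ht).le,
      List.filter_append, List.map_append]
    congr 1
    simp only [List.flatMap_cons, List.flatMap_nil, List.append_nil]
    rw [labelAt, dif_pos (show t < X.numSeg i from ht)]
    rfl

theorem incWord_eq_map (a₀ : Letter n) (J : Base X.numSeg) :
    σ.incWord J = (List.Ico (σ.vertexPos J.comp (min J.src J.tgt))
      (σ.vertexPos J.comp (max J.src J.tgt))).map (σ.letterAt a₀ J.comp) :=
  σ.segWord_eq_map a₀ min_le_max (max_le J.src_le J.tgt_le)

variable {σ}

theorem band_translation (hσ : σ.IsSolution) (b : Fin X.numBand)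
    (hf : (X.band b).reverses = false) :
    σ.vertexPos (X.band b).base1.comp (max (X.band b).base1.src (X.band b).base1.tgt) =
      σ.vertexPos (X.band b).base1.comp (min (X.band b).base1.src (X.band b).base1.tgt) +
      (σ.vertexPos (X.band b).base0.comp (max (X.band b).base0.src (X.band b).base0.tgt) -
        σ.vertexPos (X.band b).base0.comp (min (X.band b).base0.src (X.band b).base0.tgt)) ∧
    ∀ t < σ.vertexPos (X.band b).base0.comp (max (X.band b).base0.src (X.band b).base0.tgt) -
        σ.vertexPos (X.band b).base0.comp (min (X.band b).base0.src (X.band b).base0.tgt),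
      σ.letterAt a₀ (X.band b).base1.comp (σ.vertexPos (X.band b).base1.comp
        (min (X.band b).base1.src (X.band b).base1.tgt) + t) =
      ((X.band b).twist : Equiv.Perm (Letter n)) (σ.letterAt a₀ (X.band b).base0.comp
        (σ.vertexPos (X.band b).base0.comp
          (min (X.band b).base0.src (X.band b).base0.tgt) + t)) := by
  have h := (σ.band_equation_iff (X.band b)).mp (hσ b)
  rw [hf, if_neg Bool.false_ne_true, σ.incWord_eq_map a₀, σ.incWord_eq_map a₀] at h
  exact eq_of_translate
    (σ.vertexPos_mono min_le_max
      (max_le (X.band b).base0.src_le (X.band b).base0.tgt_le))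
    (σ.vertexPos_mono min_le_max
      (max_le (X.band b).base1.src_le (X.band b).base1.tgt_le)) h

theorem band_reflection (hσ : σ.IsSolution) (b : Fin X.numBand)
    (hf : (X.band b).reverses = true) :
    σ.vertexPos (X.band b).base1.comp (max (X.band b).base1.src (X.band b).base1.tgt) =
      σ.vertexPos (X.band b).base1.comp (min (X.band b).base1.src (X.band b).base1.tgt) +
      (σ.vertexPos (X.band b).base0.comp (max (X.band b).base0.src (X.band b).base0.tgt) -
        σ.vertexPos (X.band b).base0.comp (min (X.band b).base0.src (X.band b).base0.tgt)) ∧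
    ∀ t < σ.vertexPos (X.band b).base0.comp (max (X.band b).base0.src (X.band b).base0.tgt) -
        σ.vertexPos (X.band b).base0.comp (min (X.band b).base0.src (X.band b).base0.tgt),
      σ.letterAt a₀ (X.band b).base1.comp (σ.vertexPos (X.band b).base1.comp
        (min (X.band b).base1.src (X.band b).base1.tgt) +
        (σ.vertexPos (X.band b).base0.comp (max (X.band b).base0.src (X.band b).base0.tgt) -
          σ.vertexPos (X.band b).base0.comp (min (X.band b).base0.src (X.band b).base0.tgt)
          - 1 - t)) =
      Letter.bar (((X.band b).twist : Equiv.Perm (Letter n)) (σ.letterAt a₀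
        (X.band b).base0.comp (σ.vertexPos (X.band b).base0.comp
          (min (X.band b).base0.src (X.band b).base0.tgt) + t))) := by
  have h := (σ.band_equation_iff (X.band b)).mp (hσ b)
  rw [hf, if_pos rfl, σ.incWord_eq_map a₀, σ.incWord_eq_map a₀] at h
  exact eq_of_reflect (φ := fun s => Letter.bar (((X.band b).twist : Equiv.Perm (Letter n)) s))
    (σ.vertexPos_mono min_le_max
      (max_le (X.band b).base0.src_le (X.band b).base0.tgt_le))
    (σ.vertexPos_mono min_le_max
      (max_le (X.band b).base1.src_le (X.band b).base1.tgt_le)) h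

theorem min_lt_max_base (J : Base X.numSeg) : min J.src J.tgt < max J.src J.tgt := by
  have := J.src_ne_tgt
  omega

theorem vertexPos_base_le (J : Base X.numSeg) : σ.vertexPos J.comp (max J.src J.tgt) ≤
    σ.vertexPos J.comp (X.numSeg J.comp) :=
  σ.vertexPos_mono (max_le J.src_le J.tgt_le) le_rfl

theorem vertexPos_base_lt (J : Base X.numSeg) : σ.vertexPos J.comp (min J.src J.tgt) ≤
    σ.vertexPos J.comp (max J.src J.tgt) :=
  σ.vertexPos_mono min_le_max (max_le J.src_le J.tgt_le)

/-- The runs of period `d` in a solution. -/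
noncomputable def runSystem (hσ : σ.IsSolution) (d : ℕ) (hd : 0 < d) : RunSystem where
  c := X.numComp
  m := X.numSeg
  pos := σ.vertexPos
  K i := Core (σ.letterAt a₀ i) (σ.vertexPos i (X.numSeg i)) d
  d := d
  d_pos := hd
  pos_zero _ := rfl
  pos_lt _ _ hj := σ.vertexPos_lt hj
  K_spec _ _ h := ⟨h.1, h.2.1⟩
  β := Fin X.numBand
  i₀ b := (X.band b).base0.comp
  s₀ b := min (X.band b).base0.src (X.band b).base0.tgt
  t₀ b := max (X.band b).base0.src (X.band b).base0.tgt
  i₁ b := (X.band b).base1.comp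
  s₁ b := min (X.band b).base1.src (X.band b).base1.tgt
  t₁ b := max (X.band b).base1.src (X.band b).base1.tgt
  l b := σ.vertexPos (X.band b).base0.comp (max (X.band b).base0.src (X.band b).base0.tgt) -
    σ.vertexPos (X.band b).base0.comp (min (X.band b).base0.src (X.band b).base0.tgt)
  flip b := (X.band b).reverses
  st₀ b := min_lt_max_base _
  t₀_le b := max_le (X.band b).base0.src_le (X.band b).base0.tgt_le
  st₁ b := min_lt_max_base _
  t₁_le b := max_le (X.band b).base1.src_le (X.band b).base1.tgt_le
  pos_t₀ b := by have := vertexPos_base_lt (σ := σ) (X.band b).base0; omega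
  pos_t₁ b := by
    cases hf : (X.band b).reverses
    · exact (band_translation a₀ hσ b hf).1
    · exact (band_reflection a₀ hσ b hf).1
  K_band b t h1 h2 := by
    have h3 := vertexPos_base_lt (σ := σ) (X.band b).base0
    have h4 := vertexPos_base_le (σ := σ) (X.band b).base0
    have h5 := vertexPos_base_le (σ := σ) (X.band b).base1
    cases hf : (X.band b).reverses
    · obtain ⟨h6, h7⟩ := band_translation a₀ hσ b hf
      rw [if_neg Bool.false_ne_true]
      exact core_translate (Equiv.injective _) (by omega) (by omega) h7 h1 h2
    · obtain ⟨h6, h7⟩ := band_reflection a₀ hσ b hf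
      rw [if_pos rfl]
      exact core_reflect
        (φ := fun s => Letter.bar (((X.band b).twist : Equiv.Perm (Letter n)) s))
        (Letter.bar_injective.comp (Equiv.injective _)) (by omega) (by omega) h7 h1 h2

end BandComplex.Labelling

/-- A bound on the exponent of periodicity in terms of the number of elementary segments of the
band complex and of the number of elements of the semigroup. -/
def exponentBound (S c : ℕ) : ℕ :=
  S * (coneBound (2 * S) (4 ^ (2 * S)) * coneBound (2 * S) (4 ^ (2 * S)) *
    (2 * S + ((c + 1).factorial + (c + 1)))) + 2 * S + ((c + 1).factorial + (c + 1)) + 2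

open BandComplex.Labelling in
theorem exists_shorter {n : ℕ} {X : BandComplex n} (C : StandardForm X) {σ : X.Labelling}
    (hσ : IsSolutionOf C σ) (a₀ : Letter n) (d : ℕ) (hd : 0 < d)
    (y : Fin X.numComp → ℕ → ℕ → ℕ)
    (hrun : ∀ i j x z, (runSystem a₀ hσ.1 d hd).K i x →
      runStart ((runSystem a₀ hσ.1 d hd).K i) x ≤ z →
      z < runEnd ((runSystem a₀ hσ.1 d hd).K i) x → y i j z = y i j x)
    (hlen : ∀ i, ∀ j < X.numSeg i, ∀ x, (runSystem a₀ hσ.1 d hd).K i x →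
      y i j x * ((C.card + 1).factorial * d + (C.card + 1) * d) ≤
        pieceLen ((runSystem a₀ hσ.1 d hd).K i) (σ.vertexPos i) d j x)
    (hband : ∀ b t, (runSystem a₀ hσ.1 d hd).OnBand b t →
      ∑ j ∈ Finset.Ico ((runSystem a₀ hσ.1 d hd).s₀ b) ((runSystem a₀ hσ.1 d hd).t₀ b),
        y ((runSystem a₀ hσ.1 d hd).i₀ b) j ((runSystem a₀ hσ.1 d hd).x₀ b t) =
      ∑ j ∈ Finset.Ico ((runSystem a₀ hσ.1 d hd).s₁ b) ((runSystem a₀ hσ.1 d hd).t₁ b),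
        y ((runSystem a₀ hσ.1 d hd).i₁ b) j ((runSystem a₀ hσ.1 d hd).x₁ b t))
    (hpos : ∃ i, ∃ j < X.numSeg i, ∃ x, (runSystem a₀ hσ.1 d hd).K i x ∧ 0 < y i j x) :
    ∃ σ' : X.Labelling, IsSolutionOf C σ' ∧ σ'.length < σ.length := by
  classical
  set R := runSystem a₀ hσ.1 d hd
  -- The number of states of the automaton: the elements of the semigroup and `none`.
  set N := C.card + 1 with hN
  have hD : 0 < N.factorial * d := Nat.mul_pos N.factorial_pos hd
  let S : Fin X.numComp → DeletionScheme d (N.factorial * d) (N * d) := fun i =>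
    { m := X.numSeg i
      pos := σ.vertexPos i
      K := R.K i
      y := y i
      pos_lt := fun j hj => σ.vertexPos_lt hj
      K_lt := R.K_lt i
      y_run := fun j x z => hrun i j x z
      y_le := fun j hj x hx h => by
        refine le_trans ?_ (hlen i j hj x hx)
        have := Nat.le_mul_of_pos_left (N * d) h
        rw [Nat.mul_add]
        omega }
  have hSd : ∀ i, ∀ k < X.numSeg i, ¬ (S i).Deleted (σ.vertexPos i k) := fun i k hk =>
    (S i).not_deleted_pos hd (le_of_lt hk)
  have hper : ∀ i z, R.K i z → σ.letterAt a₀ i z = σ.letterAt a₀ i (z + d) := fun i z h =>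
    h.2.2 z (by omega) le_rfl
  refine ⟨σ.delete a₀ (fun i => (S i).Deleted) hSd, ⟨?_, ?_⟩, ?_⟩
  · intro b
    rw [band_equation_iff]
    have e : ∀ J : Base X.numSeg, (σ.delete a₀ (fun i => (S i).Deleted) hSd).incWord J =
        ((List.Ico (σ.vertexPos J.comp (min J.src J.tgt))
          (σ.vertexPos J.comp (max J.src J.tgt))).filter fun z => ¬ (S J.comp).Deleted z).map
            (σ.letterAt a₀ J.comp) := fun J =>
      σ.segWord_delete a₀ _ hSd min_le_max (max_le J.src_le J.tgt_le)
    rw [e, e]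
    cases hf : (X.band b).reverses
    · rw [if_neg Bool.false_ne_true]
      refine (S (X.band b).base0.comp).band_translate (S (X.band b).base1.comp) hd
        (Nat.dvd_mul_left _ _) hD (R.st₀ b).le (R.t₀_le b) (R.st₁ b).le (R.t₁_le b) (R.pos_t₀ b)
        (R.pos_t₁ b) _ _ _ (band_translation a₀ hσ.1 b hf).2 (hper _) (fun t h1 h2 => ?_)
        fun t h1 h2 h3 => ?_
      · have := R.K_band b t h1 h2
        rwa [show R.flip b = false from hf, if_neg Bool.false_ne_true] at this
      · have := hband b t ⟨h1, h2, h3⟩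
        exact this.trans (Finset.sum_congr rfl fun j _ =>
          congrArg (y _ j) (R.x₁_of_not_flip (b := b) t hf))
    · rw [if_pos rfl]
      refine (S (X.band b).base0.comp).band_reflect (S (X.band b).base1.comp) hd
        (Nat.dvd_mul_left _ _) hD (R.st₀ b).le (R.t₀_le b) (R.st₁ b).le (R.t₁_le b) (R.pos_t₀ b)
        (R.pos_t₁ b) _ _ _ (band_reflection a₀ hσ.1 b hf).2 (hper _) (fun t h1 h2 => ?_)
        fun t h1 h2 h3 => ?_
      · have := R.K_band b t h1 h2
        rwa [show R.flip b = true from hf, if_pos rfl] at this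
      · have := hband b t ⟨h1, h2, h3⟩
        exact this.trans (Finset.sum_congr rfl fun j _ =>
          congrArg (y _ j) (R.x₁_of_flip (b := b) t hf))
  · have key : ∀ i (j : Fin (X.numSeg i)),
        C.rho ((σ.delete a₀ (fun i => (S i).Deleted) hSd).label ⟨i, (j, true)⟩) =
          some (C.m ⟨i, (j, true)⟩) := by
      intro i j
      rw [← hσ.2 ⟨i, (j, true)⟩]
      have h1 : σ.label ⟨i, (j, true)⟩ =
          (List.Ico (σ.vertexPos i j) (σ.vertexPos i (j + 1))).map (σ.letterAt a₀ i) := by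
        rw [← σ.segWord_eq_map a₀ (Nat.le_succ _) j.2, σ.segWord_eq_flatMap (Nat.le_succ _) j.2,
          Nat.succ_eq_add_one, List.Ico.succ_singleton]
        simp [labelAt]
      rw [h1]
      unfold StandardForm.rho
      rw [evalWord_eq_foldl, evalWord_eq_foldl]
      exact (S i).foldl_segment (N := N) (by simp [hN]) rfl rfl hd _ _ (hper i) j.2 _
    rintro ⟨i, j, ε⟩
    cases ε
    -- The constraint on a decreasing segment follows from the increasing one by the involutions.
    · have h1 := (σ.delete a₀ (fun i => (S i).Deleted) hSd).label_bar ⟨i, (j, true)⟩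
      have h2 := C.m_bar ⟨i, (j, true)⟩
      simp only [BandComplex.OSeg.bar, Bool.not_true] at h1 h2
      rw [h1, h2]
      unfold StandardForm.rho
      rw [C.rho_bar]
      have := key i j
      unfold StandardForm.rho at this
      rw [this]
      rfl
    · exact key i j
  · have hcomp : ∀ i, (σ.delete a₀ (fun i => (S i).Deleted) hSd).compWord i =
        ((List.Ico 0 (σ.vertexPos i (X.numSeg i))).filter fun z => ¬ (S i).Deleted z).map
          (σ.letterAt a₀ i) := fun i =>
      σ.segWord_delete a₀ _ hSd (Nat.zero_le _) le_rfl
    have hcl : ∀ i, (σ.compWord i).length =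
        (List.Ico 0 (σ.vertexPos i (X.numSeg i))).length := fun i => by
      rw [σ.length_compWord a₀]; simp
    unfold BandComplex.Labelling.length
    refine Finset.sum_lt_sum (fun i _ => ?_) ?_
    · rw [hcomp, hcl, List.length_map]
      exact List.length_filter_le _ _
    -- A positive number of blocks deletes at least the first position of its piece, so the length
    -- strictly drops.
    · obtain ⟨i, j, hj, x, hx, hy⟩ := hpos
      refine ⟨i, Finset.mem_univ _, ?_⟩
      rw [hcomp, hcl, List.length_map]
      have h1 := (S i).pieceStart_add_le hj hx hy hD
      have h2 : 0 < (S i).y j x * (N.factorial * d) := Nat.mul_pos hy hD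
      have h3 : (S i).pos j + d ≤ (S i).pieceStart j x := le_max_right _ _
      have h4 : (S i).Deleted ((S i).pieceStart j x) :=
        (((S i).mem_run_and_deleted_iff hD hj hx (by omega) (by omega)).mpr
          ⟨le_rfl, by omega⟩).2
      have h5 : (S i).pos (j + 1) ≤ σ.vertexPos i (X.numSeg i) :=
        σ.vertexPos_mono hj le_rfl
      refine List.length_filter_lt_length_iff_exists.mpr
        ⟨(S i).pieceStart j x, List.Ico.mem.mpr ⟨Nat.zero_le _, by omega⟩, ?_⟩
      simpa using h4

open BandComplex.Labelling in
theorem exponentOfPeriodicity_le {n : ℕ} {X : BandComplex n} (C : StandardForm X)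
    (σ : X.Labelling) (hσ : IsShortestSolution C σ) :
    σ.exponentOfPeriodicity ≤ exponentBound (∑ i, X.numSeg i) C.card := by
  refine csSup_le' ?_
  rintro s ⟨i, p, hp, hinf⟩
  by_contra! hs
  have hd : 0 < p.length := List.length_pos_iff.mpr hp
  obtain ⟨a₀, -⟩ := List.exists_mem_of_ne_nil p hp
  obtain ⟨a, ha, hper⟩ := getD_of_infix_power hinf a₀
  rw [σ.length_compWord a₀] at ha
  set d := p.length
  set R := runSystem a₀ hσ.1.1 d hd
  set S := ∑ i, X.numSeg i
  -- The core requires periodicity at radius `d`, so the first and last periods of the power are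
  -- given up; this is the summand `2` in `exponentBound`.
  have hcore : ∀ z, a + d ≤ z → z < a + (s - 1) * d → R.K i z := by
    intro z h1 h2
    obtain ⟨r, rfl⟩ : ∃ r, s = r + 1 := ⟨s - 1, by unfold exponentBound at hs; omega⟩
    have e : (r + 1) * d = r * d + d := by ring
    rw [Nat.add_sub_cancel] at h2
    exact ⟨by omega, by omega, fun w h3 h4 => hper w (by omega) (by omega)⟩
  have hs2 : exponentBound S C.card - 2 < s - 2 := by
    have : 2 ≤ exponentBound S C.card := by unfold exponentBound; omega
    omega
  have hs1 : (s - 1) * d = (s - 2) * d + d := by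
    have : s - 1 = s - 2 + 1 := by omega
    rw [this]; ring
  have hsd : 0 < (s - 2) * d := Nat.mul_pos (by omega) hd
  obtain ⟨h1, h2⟩ := subset_run (R.K_lt i) hcore (x := a + d) le_rfl (by omega)
  have hlen : (s - 2) * d ≤ R.runLen i (a + d) := by
    unfold RunSystem.runLen; omega
  have hB : (exponentBound S C.card - 2) * d < (s - 2) * d := Nat.mul_lt_mul_of_pos_right hs2 hd
  -- The error `2 * d * S` and the block requirement `Q = N! * d + N * d` are both multiples of `d`.
  -- The threshold of `exists_plan` is thus `d` times a quantity independent of `d`; the extra `Q`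
  -- in the bound secures `Q ≤ runLen`.
  have hBd : (exponentBound S C.card - 2) * d =
      S * (coneBound (2 * S) (4 ^ (2 * S)) * coneBound (2 * S) (4 ^ (2 * S)) *
        (2 * d * S + ((C.card + 1).factorial * d + (C.card + 1) * d))) + 2 * d * S +
        ((C.card + 1).factorial * d + (C.card + 1) * d) := by
    unfold exponentBound
    rw [Nat.add_sub_cancel]
    ring
  obtain ⟨y, hy1, hy2, hy3, hy4⟩ := R.exists_plan
    ((C.card + 1).factorial * d + (C.card + 1) * d) i (a + d) (hcore _ le_rfl (by omega))
    (by omega) (by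
      have e : R.numSegs = S := rfl
      have e' : R.d = d := rfl
      rw [e, e']
      omega)
  obtain ⟨σ', h3, h4⟩ := exists_shorter C hσ.1 a₀ d hd y hy1 hy2 hy3 hy4
  exact absurd (hσ.2 σ' h3) (not_le.mpr h4)

end Shortening

/-! ### Computability of the bound -/

section Computability

theorem primrec_coneBound : Primrec₂ coneBound := by
  have h : Primrec₂ fun r s : ℕ => Nat.rec (motive := fun _ => ℕ) (r + 1)
      (fun _ Z => 4 * Z * Z * Z) s := by
    refine Primrec.nat_rec (f := fun r => r + 1) (g := fun _ p => 4 * p.2 * p.2 * p.2)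
      Primrec.succ ?_
    have hz : Primrec fun q : ℕ × ℕ × ℕ => q.2.2 := Primrec.snd.comp Primrec.snd
    exact Primrec.nat_mul.comp (Primrec.nat_mul.comp
      (Primrec.nat_mul.comp (Primrec.const 4) hz) hz) hz
  refine h.of_eq fun r s => ?_
  induction s with
  | zero => rfl
  | succ s ih => simp only [coneBound, ← ih]

theorem primrec_four_pow : Primrec fun s : ℕ => 4 ^ s := by
  have h : Primrec fun s : ℕ => Nat.rec (motive := fun _ => ℕ) 1 (fun _ Z => 4 * Z) s :=
    Primrec.nat_rec₁ (f := fun _ Z => 4 * Z) 1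
      (Primrec.nat_mul.comp (Primrec.const 4) Primrec.snd)
  refine h.of_eq fun s => ?_
  induction s with
  | zero => rfl
  | succ s ih => simp only [ih]; ring

theorem primrec_factorial : Primrec Nat.factorial := by
  have h : Primrec fun s : ℕ => Nat.rec (motive := fun _ => ℕ) 1 (fun k Z => (k + 1) * Z) s :=
    Primrec.nat_rec₁ (f := fun k Z => (k + 1) * Z) 1
      (Primrec.nat_mul.comp (Primrec.succ.comp Primrec.fst) Primrec.snd)
  refine h.of_eq fun s => ?_
  induction s with
  | zero => rfl
  | succ s ih => simp only [ih, Nat.factorial_succ]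

theorem primrec_exponentBound : Primrec₂ exponentBound := by
  have hS : Primrec fun p : ℕ × ℕ => 2 * p.1 :=
    Primrec.nat_mul.comp (Primrec.const 2) Primrec.fst
  have hZ : Primrec fun p : ℕ × ℕ => coneBound (2 * p.1) (4 ^ (2 * p.1)) :=
    primrec_coneBound.comp hS (primrec_four_pow.comp hS)
  have hc : Primrec fun p : ℕ × ℕ => p.2 + 1 := Primrec.succ.comp Primrec.snd
  have hQ : Primrec fun p : ℕ × ℕ => (p.2 + 1).factorial + (p.2 + 1) :=
    Primrec.nat_add.comp (primrec_factorial.comp hc) hc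
  have h1 : Primrec fun p : ℕ × ℕ => p.1 * (coneBound (2 * p.1) (4 ^ (2 * p.1)) *
      coneBound (2 * p.1) (4 ^ (2 * p.1)) * (2 * p.1 + ((p.2 + 1).factorial + (p.2 + 1)))) :=
    Primrec.nat_mul.comp Primrec.fst
      (Primrec.nat_mul.comp (Primrec.nat_mul.comp hZ hZ) (Primrec.nat_add.comp hS hQ))
  exact Primrec.nat_add.comp (Primrec.nat_add.comp (Primrec.nat_add.comp h1 hS) hQ)
    (Primrec.const 2)

theorem primrec_list_sum : Primrec (List.sum : List ℕ → ℕ) := by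
  have h : Primrec fun l : List ℕ => l.foldr (fun a b => a + b) 0 :=
    Primrec.list_foldr (f := fun l : List ℕ => l) (g := fun _ => 0) (h := fun _ p => p.1 + p.2)
      Primrec.id (Primrec.const 0)
      (Primrec.nat_add.comp (Primrec.fst.comp Primrec.snd) (Primrec.snd.comp Primrec.snd))
  exact h.of_eq fun l => rfl

end Computability

end TwistedBand

theorem proposition3p1 :
    ∃ B : TwistedBand.BandComplexCode × TwistedBand.StandardFormCode → ℕ,
      Computable B ∧
      ∀ (n : ℕ) (X : TwistedBand.BandComplex n) (C : TwistedBand.StandardForm X)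
        (σ : X.Labelling), TwistedBand.IsShortestSolution C σ →
          σ.exponentOfPeriodicity ≤ B (X.code, C.code) := by
  -- Two numbers are read off the codes: the total number of elementary segments and the size of the
  -- semigroup.
  refine ⟨fun q => TwistedBand.exponentBound q.1.2.1.sum q.2.1, ?_, fun n X C σ hσ => ?_⟩
  · refine (TwistedBand.primrec_exponentBound.comp (TwistedBand.primrec_list_sum.comp ?_)
      ?_).to_comp
    · exact Primrec.fst.comp (Primrec.snd.comp Primrec.fst)
    · exact Primrec.fst.comp Primrec.snd
  · have h := TwistedBand.exponentOfPeriodicity_le C σ hσ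
    have e : (X.code.2.1).sum = ∑ i, X.numSeg i := by
      simp [TwistedBand.BandComplex.code, List.sum_ofFn]
    simp only [e]
    exact h
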